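/- Let $\gamma=\frac{1+\sqrt5}{2}$, let $F_0=0$, $F_1=1$, $F_{k+2}=F_{k+1}+F_k$, and let $\delta_k(n)\in\{0,1\}$ ($k\ge 2$) be the digits of the Zeckendorf expansion $n=\sum_{k\ge2}\delta_k(n)F_k$ of $n$, in which $\delta_{k+1}(n)=1$ implies $\delta_k(n)=0$ (put $\delta_0(n)=\delta_1(n)=0$). The length of the expansion of $n\ge 1$ is the largest $k$ with $\delta_k(n)=1$. For real $x\ge 2$ let $L=L(x)$ be the maximal length of the Zeckendorf expansion of a positive integer $\le x$. For $0<\nu<\frac12$ put $$L'=\#\{k\in\mathbb Z: L^\nu\le k\le L-L^\nu\},\qquad T_x(n)=\sum_{L^\nu\le k\le L-L^\nu}\delta_k(n),$$ $$\mu=\frac1{\gamma^2+1},\qquad \sigma^2=\frac{\gamma^3}{(\gamma^2+1)^3}.$$ Let $(Z_k)_{k\ge0}$ be the Markov chain on $\{0,1\}$ with $\mathbb P[Z_0=0]=\frac{\gamma^2}{\gamma^2+1}$, $\mathbb P[Z_0=1]=\frac1{\gamma^2+1}$ and transition probabilities $\mathbb P[Z_{k+1}=0\mid Z_k=0]=\frac1\gamma$,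 $\mathbb P[Z_{k+1}=1\mid Z_k=0]=\frac1{\gamma^2}$, $\mathbb P[Z_{k+1}=0\mid Z_k=1]=1$, $\mathbb P[Z_{k+1}=1\mid Z_k=1]=0$, and put $\overline T_x=\sum_{L^\nu\le k\le L-L^\nu}Z_k$. If $L'\ge1$, define for real $t$ $$\phi_2(t)=\frac1{\pi(x)}\sum_{p\le x}e^{it(T_x(p)-L'\mu)/(L'\sigma^2)^{1/2}},\qquad \phi_3(t)=\mathbb E\,e^{it(\overline T_x-L'\mu)/(L'\sigma^2)^{1/2}},$$ where the sum is over the primes $p\le x$ and $\pi(x)$ is their number. Proposition. Let $\tau,\kappa$ be real numbers with $0<2\tau<\kappa$. There is a constant $c_1>0$, depending only on $\tau$ and $\kappa$, such that for every $\nu$ with $\kappa<\frac13\nu$ and $\nu<\frac12$ there is a constant $C>0$ (depending on $\tau,\kappa,\nu$) with $$\bigl|\phi_2(t)-\phi_3(t)\bigr|\le C\,|t|\,e^{-c_1L^\kappa}$$ for all real $x\ge2$ with $L'\ge1$ and all real $t$ with $|t|\le L^\tau$. -/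

import Mathlib

open MeasureTheory

noncomputable section

namespace ZeckendorfPrimes

/-- The digit `δ_k(n) ∈ {0, 1}` of the Fibonacci number `F_k` in the Zeckendorf expansion of `n`
(`Nat.zeckendorf n` is the list of all indices `k ≥ 2` that occur in this expansion). -/
def digit (k n : ℕ) : ℕ := if k ∈ Nat.zeckendorf n then 1 else 0

/-- The length of the Zeckendorf expansion of `n`, i.e. the index of its leading digit
(and `0` for `n = 0`); the list `Nat.zeckendorf n` is strictly decreasing. -/
def zLength (n : ℕ) : ℕ := (Nat.zeckendorf n).headD 0

theorem zLength_eq (n : ℕ) : zLength n = Nat.greatestFib n := by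
  rcases Nat.eq_zero_or_pos n with rfl | h
  · simp [zLength, Nat.greatestFib_eq_zero.2 rfl]
  · simp [zLength, h]

/-- `L = L(x)`: the maximal length of the Zeckendorf expansion of an integer `0 ≤ n ≤ x`. -/
def maxLength (x : ℝ) : ℕ := (Finset.range (⌊x⌋₊ + 1)).sup zLength

theorem maxLength_eq (x : ℝ) : maxLength x = Nat.greatestFib ⌊x⌋₊ := by
  refine le_antisymm (Finset.sup_le fun n hn => ?_) ?_
  · rw [zLength_eq]
    exact Nat.greatestFib_mono (Nat.lt_succ_iff.1 (Finset.mem_range.1 hn))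
  · rw [← zLength_eq]
    exact Finset.le_sup (f := zLength) (Finset.mem_range.2 (Nat.lt_succ_self _))

/-- The index window `{k : L ^ ν ≤ k ≤ L - L ^ ν}` (all its elements lie in `[0, L]`). -/
def window (ν x : ℝ) : Finset ℕ := by
  classical
  exact (Finset.range (maxLength x + 1)).filter fun k =>
    (maxLength x : ℝ) ^ ν ≤ k ∧ (k : ℝ) ≤ maxLength x - (maxLength x : ℝ) ^ ν

/-- `L'`: the number of indices in the window. -/
def windowCard (ν x : ℝ) : ℕ := (window ν x).card

/-- The truncated Zeckendorf sum of digits `T_x(n) = ∑ δ_k(n)` over the window. -/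
def truncDigitSum (ν x : ℝ) (n : ℕ) : ℕ := ∑ k ∈ window ν x, digit k n

/-- The constant `μ = 1 / (γ ^ 2 + 1)`, where `γ` is the golden ratio. -/
def mean : ℝ := 1 / (Real.goldenRatio ^ 2 + 1)

/-- The constant `σ ^ 2 = γ ^ 3 / (γ ^ 2 + 1) ^ 3`. -/
def variance : ℝ := Real.goldenRatio ^ 3 / (Real.goldenRatio ^ 2 + 1) ^ 3

/-- The normalization `s ↦ (s - L' μ) / (L' σ ^ 2) ^ (1 / 2)`. -/
def normalize (ν x s : ℝ) : ℝ :=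
  (s - windowCard ν x * mean) / √(windowCard ν x * variance)

/-- The finite set of primes `p ≤ x`. -/
def primesUpTo (x : ℝ) : Finset ℕ := (Finset.range (⌊x⌋₊ + 1)).filter Nat.Prime

/-- `φ₂(t)`: the characteristic function of the normalized truncated sum of digits `T_x(p)`,
where `p` is uniformly distributed on the set of primes `p ≤ x`. -/
def phi₂ (ν x t : ℝ) : ℂ :=
  (1 / ((primesUpTo x).card : ℂ)) *
    ∑ p ∈ primesUpTo x, Complex.exp (Complex.I * t * normalize ν x (truncDigitSum ν x p))

/-- The stationary distribution `(p₀, p₁) = (γ² / (γ² + 1), 1 / (γ² + 1))`. -/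
def initialLaw : Fin 2 → ℝ :=
  ![Real.goldenRatio ^ 2 / (Real.goldenRatio ^ 2 + 1), 1 / (Real.goldenRatio ^ 2 + 1)]

/-- The transition matrix of the Markov chain; the entry `a b` is the probability of a step
from the state `a` to the state `b`. -/
def transition : Matrix (Fin 2) (Fin 2) ℝ :=
  !![1 / Real.goldenRatio, 1 / Real.goldenRatio ^ 2; 1, 0]

/-- `(Z_k)_{k ≥ 0}` is, on the probability space `(Ω, P)`, a Markov chain on `{0, 1}` with the
initial distribution `initialLaw` and the transition matrix `transition`:
`P[Z_0 = a_0, …, Z_{k+1} = a_{k+1}] = P[Z_0 = a_0, …, Z_k = a_k] * transition a_k a_{k+1}`. -/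
structure IsDigitChain {Ω : Type*} [MeasurableSpace Ω] (P : Measure Ω)
    (Z : ℕ → Ω → Fin 2) : Prop where
  measurable : ∀ k, Measurable (Z k)
  initial : ∀ a : Fin 2, P.real {ω | Z 0 ω = a} = initialLaw a
  step : ∀ (k : ℕ) (a : ℕ → Fin 2),
    P.real {ω | ∀ i ≤ k + 1, Z i ω = a i} =
      P.real {ω | ∀ i ≤ k, Z i ω = a i} * transition (a k) (a (k + 1))

/-- The sum of the chain over the window. -/
def truncChainSum {Ω : Type*} (Z : ℕ → Ω → Fin 2) (ν x : ℝ) (ω : Ω) : ℕ :=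
  ∑ k ∈ window ν x, (Z k ω : ℕ)

/-- `φ₃(t)`: the characteristic function of the normalized sum of the chain over the window. -/
def phi₃ {Ω : Type*} [MeasurableSpace Ω] (P : Measure Ω) (Z : ℕ → Ω → Fin 2)
    (ν x t : ℝ) : ℂ :=
  ∫ ω, Complex.exp (Complex.I * t * normalize ν x (truncChainSum Z ν x ω)) ∂P

/-- The law on `{0, 1}` with weights `1 - q` and `q`. -/
def bern (q : ℝ) : Measure (Fin 2) :=
  ENNReal.ofReal (1 - q) • Measure.dirac 0 + ENNReal.ofReal q • Measure.dirac 1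

theorem isProbabilityMeasure_bern {q : ℝ} (h0 : 0 ≤ q) (h1 : q ≤ 1) :
    IsProbabilityMeasure (bern q) := by
  constructor
  simp only [bern, Measure.add_apply, Measure.smul_apply, measure_univ, smul_eq_mul, mul_one]
  rw [← ENNReal.ofReal_add (by linarith) h0]
  simp

theorem bern_real_singleton {q : ℝ} (h0 : 0 ≤ q) (h1 : q ≤ 1) (a : Fin 2) :
    (bern q).real {a} = ![1 - q, q] a := by
  have h1' : 0 ≤ 1 - q := by linarith
  fin_cases a <;> simp [Measure.real, bern, h0, h1']

/-- A realization of the chain driven by a sequence of independent choices. -/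
def chain : ℕ → (ℕ → Fin 2) → Fin 2
  | 0, b => b 0
  | k + 1, b => if chain k b = 1 then 0 else b (k + 1)

/-- The choices that lead from `a k` to `a (k + 1)`. -/
def choices (a : ℕ → Fin 2) : ℕ → Set (Fin 2)
  | 0 => {a 0}
  | k + 1 => if a k = 1 then (if a (k + 1) = 0 then Set.univ else ∅) else {a (k + 1)}

theorem chain_event (a : ℕ → Fin 2) (k : ℕ) :
    {b | ∀ i ≤ k, chain i b = a i} = Set.pi (Finset.range (k + 1)) (choices a) := by
  induction k with
  | zero => ext b; simp [chain, choices]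
  | succ k ih =>
    have h1 : {b | ∀ i ≤ k + 1, chain i b = a i} =
        {b | ∀ i ≤ k, chain i b = a i} ∩ {b | chain (k + 1) b = a (k + 1)} := by
      ext b
      simp only [Set.mem_ofPred_eq, Set.mem_inter_iff]
      constructor
      · exact fun h => ⟨fun i hi => h i (by omega), h _ le_rfl⟩
      · rintro ⟨h, h'⟩ i hi
        rcases Nat.lt_or_ge k i with hk | hk
        · obtain rfl : i = k + 1 := by omega
          exact h'
        · exact h i hk
    have h2 : Set.pi (Finset.range (k + 1 + 1) : Finset ℕ) (choices a) =
        Set.pi (Finset.range (k + 1)) (choices a) ∩ {b | b (k + 1) ∈ choices a (k + 1)} := by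
      rw [Finset.range_add_one, Finset.coe_insert, Set.insert_pi, Set.inter_comm]
      rfl
    rw [h2, ← ih, h1]
    ext b
    simp only [Set.mem_inter_iff, Set.mem_ofPred_eq]
    refine and_congr_right fun h => ?_
    have hk := h k le_rfl
    simp only [chain, choices, hk]
    by_cases ha : a k = 1
    · by_cases hb : a (k + 1) = 0
      · simp [ha, hb]
      · simp [ha, hb, eq_comm]
    · simp [ha]

/-- A Markov chain as in `IsDigitChain` exists. -/
theorem exists_isDigitChain :
    ∃ (P : Measure (ℕ → Fin 2)) (_ : IsProbabilityMeasure P) (Z : ℕ → (ℕ → Fin 2) → Fin 2),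
      IsDigitChain P Z := by
  have hg := Real.goldenRatio_sq
  have hg1 := Real.one_lt_goldenRatio
  have hpos : 0 < Real.goldenRatio ^ 2 + 1 := by positivity
  let q : ℕ → ℝ := fun k =>
    if k = 0 then 1 / (Real.goldenRatio ^ 2 + 1) else 1 / Real.goldenRatio ^ 2
  have hq0 : ∀ k, 0 ≤ q k := by
    intro k
    simp only [q]
    split_ifs <;> positivity
  have hq1 : ∀ k, q k ≤ 1 := by
    intro k
    simp only [q]
    split_ifs
    · rw [div_le_one hpos]; nlinarith
    · rw [div_le_one (by positivity)]; nlinarith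
  have : ∀ k, IsProbabilityMeasure (bern (q k)) :=
    fun k => isProbabilityMeasure_bern (hq0 k) (hq1 k)
  have key : ∀ (a : ℕ → Fin 2) (k : ℕ),
      (Measure.infinitePi fun k => bern (q k)).real {b | ∀ i ≤ k, chain i b = a i} =
        ∏ i ∈ Finset.range (k + 1), (bern (q i)).real (choices a i) := by
    intro a k
    rw [chain_event, Measure.real, Measure.infinitePi_pi _ (fun i _ => .of_discrete),
      ENNReal.toReal_prod]
    rfl
  refine ⟨Measure.infinitePi fun k => bern (q k), inferInstance, chain, ?_, ?_, ?_⟩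
  · intro k
    induction k with
    | zero => exact measurable_pi_apply 0
    | succ k ih =>
      exact Measurable.ite (ih (measurableSet_singleton 1)) measurable_const
        (measurable_pi_apply (k + 1))
  · intro a
    have h := key (fun _ => a) 0
    simp only [Nat.le_zero, forall_eq, zero_add, Finset.range_one, Finset.prod_singleton,
      choices] at h
    rw [h, bern_real_singleton (hq0 0) (hq1 0)]
    fin_cases a
    · simp [q, initialLaw]
      field_simp
      ring
    · simp [q, initialLaw]
  · intro k a
    rw [key, key, Finset.prod_range_succ]
    congr 1
    simp only [choices]
    have hcase : ∀ c : Fin 2, c = 0 ∨ c = 1 := by decide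
    have hq : q (k + 1) = 1 / Real.goldenRatio ^ 2 := by simp [q]
    rcases hcase (a k) with h | h
    · have hne : ¬ (a k = 1) := by simp [h]
      rw [if_neg hne, bern_real_singleton (hq0 _) (hq1 _), hq, h]
      rcases hcase (a (k + 1)) with h' | h'
      · rw [h']
        change 1 - 1 / Real.goldenRatio ^ 2 = 1 / Real.goldenRatio
        field_simp
        nlinarith [Real.sq_sqrt (show (0 : ℝ) ≤ 5 by norm_num)]
      · rw [h']
        rfl
    · rcases hcase (a (k + 1)) with h' | h'
      · simp [h, h', transition]
      · simp [h, h', transition]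

end ZeckendorfPrimes

end

/-! The characteristic functions are compared through joint moments. Digits are 0-1 variables, so a
power of the truncated digit sum expands into products of digits over subsets S of the window. If,
for all |S| ≤ d, the average of the product over primes agrees with the chain's expectation up to δ,
then the centred moments of order j ≤ d agree up to (2L')^j δ, and Taylor's formula for exp(iy)
carries this over to φ₂ - φ₃ (`norm_sum_sub_mul_exp_le`). The remainder needs only the d-th central
moment of the chain, which exponential moments control (`IsDigitChain.integral_exp_le`). Zeroth
moments agree exactly, which is why a factor |t| survives.

Digits become harmonic analysis as follows. Split the expansion of n at position k, scale the low
part to s in [0,1), and let B be the algebraic conjugate of the high part. The pair (s, B) lies in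
an L-shaped region made of two rectangles, one for each value of the digit. Its area √5 equals the
covolume of a lattice isomorphic to Z[φ], φ the golden ratio. Modulo this lattice and up to
O(φ^(-k)), the pair is determined by nφ^(-k) and nφ^(1-k) modulo 1. Hence, away from the boundary,
two phases determine the digit (`Typical.digit_eq`). As F_j φ ≡ ±φ^(-j) modulo 1, these phases are
integer multiples of φn up to sign. Fejér smoothing replaces the digit by a trigonometric sum with
frequencies hφ (`exists_approximant`), and few integers lie near the boundary
(`card_not_typical_le`).

A product of approximants is again such a sum. For h ≠ 0 the sum of e(hφp) over primes is small by
Vaughan's identity and the bad approximability of φ (`norm_sum_primesUpTo_ex_le`), and the sum over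
integers is geometric. The zero frequency contributes equally to both averages, so primes and
integers below F_(2L+2) have nearly the same joint digit moments
(`norm_avg_primesUpTo_digit_sub_le`). For integers, weighted digit counts obey the same recursion as
the rescaled chain, so only boundary effects decaying exponentially in the distance to both ends
remain (`IsDigitChain.digitWeight_bounds`, `IsDigitChain.abs_avg_digit_sub_le`).

Put r = L^(κ/4) and let d be about 2r^4 = 2L^κ. The moment error is exp(2 - r^6), while expanding
d-th powers costs only exp(O(r^5)). Reaching that error needs positions at distance at least r^12 =
L^(3κ) from both ends, which is κ < ν/3. The Taylor remainder is at most exp(-L^κ) because t² is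
small against L^κ, which is 2τ < κ. So c₁ = 1 works for large L; bounded L is handled by |exp(iy) -
1| ≤ |y|. -/

noncomputable section

namespace ZeckendorfPrimes

/-! ### Additive characters and geometric sums -/

/-- The additive character `t ↦ exp (2 π i t)`. -/
def ex (t : ℝ) : ℂ := Complex.exp ((2 * Real.pi * t : ℝ) * Complex.I)

/-- The distance to the nearest integer. -/
def nd (t : ℝ) : ℝ := |t - round t|

theorem ex_zero : ex 0 = 1 := by simp [ex]

theorem ex_add (s t : ℝ) : ex (s + t) = ex s * ex t := by
  rw [ex, ex, ex, ← Complex.exp_add]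
  congr 1
  push_cast
  ring

theorem norm_ex (t : ℝ) : ‖ex t‖ = 1 := Complex.norm_exp_ofReal_mul_I _

theorem ex_int (n : ℤ) : ex n = 1 := by
  rw [ex, Complex.exp_eq_one_iff]
  exact ⟨n, by push_cast; ring⟩

theorem ex_add_int (t : ℝ) (n : ℤ) : ex (t + n) = ex t := by
  rw [ex_add, ex_int, mul_one]

theorem conj_ex (t : ℝ) : (starRingEnd ℂ) (ex t) = ex (-t) := by
  rw [ex, ex, ← Complex.exp_conj, map_mul, Complex.conj_ofReal, Complex.conj_I]
  congr 1
  push_cast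
  ring

theorem nd_nonneg (t : ℝ) : 0 ≤ nd t := abs_nonneg _

theorem nd_le (t : ℝ) (n : ℤ) : nd t ≤ |t - n| := round_le t n

theorem nd_le_half (t : ℝ) : nd t ≤ 1 / 2 := abs_sub_round t

theorem nd_neg (t : ℝ) : nd (-t) = nd t := by
  have key : ∀ s : ℝ, nd (-s) ≤ nd s := fun s => by
    refine (nd_le (-s) (-round s)).trans_eq ?_
    rw [nd, ← abs_neg]
    congr 1
    push_cast
    ring
  exact le_antisymm (key t) (by simpa using key (-t))

theorem nd_add_int (t : ℝ) (n : ℤ) : nd (t + n) = nd t := by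
  rw [nd, nd, round_add_intCast]
  push_cast
  congr 1
  ring

/-- Turns separation modulo 1 into separation on the line of the signed fractional parts. -/
theorem nd_sub_le (s t : ℝ) : nd (s - t) ≤ |(s - round s) - (t - round t)| := by
  refine (nd_le (s - t) (round s - round t)).trans_eq ?_
  congr 1
  push_cast
  ring

theorem nd_add_le (s t : ℝ) : nd (s + t) ≤ nd s + nd t := by
  refine (nd_le (s + t) (round s + round t)).trans ?_
  rw [nd, nd]
  refine le_trans (le_of_eq ?_) (abs_add_le _ _)
  congr 1
  push_cast
  ring

/-- After reduction to |t| ≤ 1/2 the norm is 2 sin(π|t|), and Jordan's inequality sin x ≥ 2x/π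
applies. -/
theorem four_mul_nd_le_norm_ex_sub_one (t : ℝ) : 4 * nd t ≤ ‖ex t - 1‖ := by
  have h1 : ex t = ex (t - round t) := by
    have := ex_add_int (t - round t) (round t)
    rwa [sub_add_cancel] at this
  have h2 : |t - round t| ≤ 1 / 2 := abs_sub_round t
  rw [h1, nd]
  set s : ℝ := t - round t
  have h3 : ‖ex s - 1‖ = ‖2 * Real.sin (Real.pi * s)‖ := by
    have := Complex.norm_exp_I_mul_ofReal_sub_one (2 * Real.pi * s)
    rw [ex, mul_comm, this]
    congr 3
    ring
  rw [h3, norm_mul, Real.norm_eq_abs, Real.norm_eq_abs, abs_two]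
  have h4 : 2 * |s| ≤ |Real.sin (Real.pi * s)| := by
    have hpi := Real.pi_pos
    have h5 : |Real.sin (Real.pi * s)| = Real.sin (Real.pi * |s|) := by
      rcases le_total 0 s with hs | hs
      · rw [abs_of_nonneg hs, abs_of_nonneg]
        rw [abs_of_nonneg hs] at h2
        exact Real.sin_nonneg_of_nonneg_of_le_pi (by positivity) (by nlinarith)
      · rw [abs_of_nonpos hs, mul_neg, Real.sin_neg, abs_of_nonpos]
        rw [abs_of_nonpos hs] at h2
        exact Real.sin_nonpos_of_nonpos_of_neg_pi_le (by nlinarith) (by nlinarith)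
    rw [h5]
    have := Real.mul_le_sin (x := Real.pi * |s|) (by positivity) (by nlinarith)
    refine le_trans (le_of_eq ?_) this
    field_simp
  linarith

/-- The geometric sum telescopes after multiplication by e(t) - 1. The product form avoids dividing
by `nd t`, which may vanish. -/
theorem norm_sum_ex_mul_nd_le (t : ℝ) (U N : ℕ) :
    ‖∑ m ∈ Finset.Ioc U N, ex (m * t)‖ * (2 * nd t) ≤ 1 := by
  rcases lt_or_ge N U with h | h
  · rw [Finset.Ioc_eq_empty_of_le h.le]
    simp
  have key : (ex t - 1) * ∑ m ∈ Finset.Ioc U N, ex (m * t) =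
      ex ((N + 1 : ℕ) * t) - ex ((U + 1 : ℕ) * t) := by
    induction N, h using Nat.le_induction with
    | base => simp
    | succ n hn ih =>
      rw [Finset.sum_Ioc_succ_top (by omega), mul_add, ih, sub_mul, one_mul, ← ex_add]
      have : t + ((n + 1 : ℕ) : ℝ) * t = ((n + 1 + 1 : ℕ) : ℝ) * t := by push_cast; ring
      rw [this]
      ring
  have h1 : ‖ex t - 1‖ * ‖∑ m ∈ Finset.Ioc U N, ex (m * t)‖ ≤ 2 := by
    rw [← norm_mul, key]
    refine (norm_sub_le _ _).trans ?_
    rw [norm_ex, norm_ex]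
    norm_num
  have h2 := mul_le_mul_of_nonneg_right (four_mul_nd_le_norm_ex_sub_one t)
    (norm_nonneg (∑ m ∈ Finset.Ioc U N, ex (m * t)))
  linarith

/-! ### Partial summation -/

theorem sum_Ioc_mul_eq_by_parts (f a : ℕ → ℂ) (N : ℕ) :
    ∑ n ∈ Finset.Ioc 0 N, f n * a n = f N * ∑ n ∈ Finset.Ioc 0 N, a n +
      ∑ n ∈ Finset.range N, (f n - f (n + 1)) * ∑ m ∈ Finset.Ioc 0 n, a m := by
  induction N with
  | zero => simp
  | succ N ih =>
    rw [Finset.sum_Ioc_succ_top (Nat.zero_le _), ih, Finset.sum_range_succ,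
      Finset.sum_Ioc_succ_top (Nat.zero_le _)]
    ring

/-- Abel summation: the increments of f have one sign, so they telescope to f N - f 0. -/
theorem norm_sum_mul_le_of_monotone {f : ℕ → ℝ} (hf : Monotone f) (h0 : 0 ≤ f 0) (a : ℕ → ℂ)
    (N : ℕ) {P : ℝ} (hP : ∀ k ≤ N, ‖∑ n ∈ Finset.Ioc 0 k, a n‖ ≤ P) :
    ‖∑ n ∈ Finset.Ioc 0 N, (f n : ℂ) * a n‖ ≤ 2 * f N * P := by
  have hP0 : 0 ≤ P := (norm_nonneg _).trans (hP 0 (Nat.zero_le _))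
  rw [sum_Ioc_mul_eq_by_parts]
  refine (norm_add_le _ _).trans ?_
  have h1 : ‖(f N : ℂ) * ∑ n ∈ Finset.Ioc 0 N, a n‖ ≤ f N * P := by
    rw [norm_mul, Complex.norm_real, Real.norm_of_nonneg (h0.trans (hf (Nat.zero_le _)))]
    exact mul_le_mul_of_nonneg_left (hP N le_rfl) (h0.trans (hf (Nat.zero_le _)))
  have h2 : ‖∑ n ∈ Finset.range N, ((f n : ℂ) - f (n + 1 : ℕ)) * ∑ m ∈ Finset.Ioc 0 n, a m‖ ≤
      ∑ n ∈ Finset.range N, (f (n + 1) - f n) * P := by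
    refine norm_sum_le_of_le _ fun n hn => ?_
    rw [norm_mul, ← Complex.ofReal_sub, Complex.norm_real, norm_sub_rev,
      Real.norm_of_nonneg (sub_nonneg.2 (hf (Nat.le_succ _)))]
    exact mul_le_mul_of_nonneg_left (hP n (Finset.mem_range.1 hn).le)
      (sub_nonneg.2 (hf (Nat.le_succ _)))
  rw [← Finset.sum_mul, Finset.sum_range_sub] at h2
  nlinarith

theorem norm_sum_mul_le_of_antitone {f : ℕ → ℝ} (hf : Antitone f) (h0 : ∀ n, 0 ≤ f n)
    (a : ℕ → ℂ) (N : ℕ) {P : ℝ} (hP : ∀ k ≤ N, ‖∑ n ∈ Finset.Ioc 0 k, a n‖ ≤ P) :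
    ‖∑ n ∈ Finset.Ioc 0 N, (f n : ℂ) * a n‖ ≤ f 0 * P := by
  have hP0 : 0 ≤ P := (norm_nonneg _).trans (hP 0 (Nat.zero_le _))
  rw [sum_Ioc_mul_eq_by_parts]
  refine (norm_add_le _ _).trans ?_
  have h1 : ‖(f N : ℂ) * ∑ n ∈ Finset.Ioc 0 N, a n‖ ≤ f N * P := by
    rw [norm_mul, Complex.norm_real, Real.norm_of_nonneg (h0 N)]
    exact mul_le_mul_of_nonneg_left (hP N le_rfl) (h0 N)
  have h2 : ‖∑ n ∈ Finset.range N, ((f n : ℂ) - f (n + 1 : ℕ)) * ∑ m ∈ Finset.Ioc 0 n, a m‖ ≤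
      ∑ n ∈ Finset.range N, (f n - f (n + 1)) * P := by
    refine norm_sum_le_of_le _ fun n hn => ?_
    rw [norm_mul, ← Complex.ofReal_sub, Complex.norm_real,
      Real.norm_of_nonneg (sub_nonneg.2 (hf (Nat.le_succ _)))]
    exact mul_le_mul_of_nonneg_left (hP n (Finset.mem_range.1 hn).le)
      (sub_nonneg.2 (hf (Nat.le_succ _)))
  rw [← Finset.sum_mul, Finset.sum_range_sub'] at h2
  nlinarith

theorem norm_sum_nat_mul_ex_le (t : ℝ) (U N : ℕ) :
    ‖∑ m ∈ Finset.Ioc U N, (m : ℂ) * ex (m * t)‖ ≤ (N : ℝ) * N := by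
  refine (norm_sum_le_of_le (n := fun _ => (N : ℝ)) _ fun m hm => ?_).trans ?_
  · rw [norm_mul, norm_ex, mul_one, Complex.norm_natCast]
    exact_mod_cast (Finset.mem_Ioc.1 hm).2
  · rw [Finset.sum_const, Nat.card_Ioc, nsmul_eq_mul]
    exact mul_le_mul_of_nonneg_right (by exact_mod_cast Nat.sub_le _ _) (Nat.cast_nonneg _)

theorem sum_Ioc_ite (f : ℕ → ℂ) (U N : ℕ) :
    ∑ m ∈ Finset.Ioc 0 N, (if U < m then f m else 0) = ∑ m ∈ Finset.Ioc U N, f m := by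
  rw [← Finset.sum_filter]
  congr 1
  ext m
  simp only [Finset.mem_filter, Finset.mem_Ioc]
  omega

/-- Partial summation against the weight m; the lower cut-off U is moved into the sequence as an
indicator, so that the partial sums remain geometric. -/
theorem norm_sum_nat_mul_ex_mul_nd_le (t : ℝ) (U N : ℕ) :
    ‖∑ m ∈ Finset.Ioc U N, (m : ℂ) * ex (m * t)‖ * nd t ≤ N := by
  rcases (nd_nonneg t).eq_or_lt with h | h
  · rw [← h, mul_zero]
    exact Nat.cast_nonneg _
  have h1 := norm_sum_mul_le_of_monotone (f := fun n => (n : ℝ)) (fun m n h => Nat.cast_le.2 h)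
    (by simp) (fun m => if U < m then ex (m * t) else 0) N (P := 1 / (2 * nd t)) (fun k _ => by
      rw [sum_Ioc_ite (fun m => ex (m * t)), le_div_iff₀ (by positivity)]
      exact norm_sum_ex_mul_nd_le t U k)
  have h2 : ∑ n ∈ Finset.Ioc 0 N, (((n : ℝ)) : ℂ) * (if U < n then ex (n * t) else 0) =
      ∑ m ∈ Finset.Ioc U N, (m : ℂ) * ex (m * t) := by
    rw [← sum_Ioc_ite (fun m => (m : ℂ) * ex (m * t))]
    refine Finset.sum_congr rfl fun n _ => ?_
    split_ifs <;> simp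
  rw [h2] at h1
  calc _ ≤ 2 * (N : ℝ) * (1 / (2 * nd t)) * nd t := mul_le_mul_of_nonneg_right h1 h.le
    _ = N := by field_simp

/-! ### Sums over well-spaced points -/

/-- Separation makes i ↦ ⌊2q z i⌋ injective with values in {0, …, q}. Cell 0 contributes at most Y
and cell j ≥ 1 at most 2q/j; the harmonic sum gives the logarithm. -/
theorem sum_le_of_separated {ι : Type*} (s : Finset ι) (z w : ι → ℝ) {q : ℕ} (hq : 0 < q) {Y : ℝ}
    (hY : 0 ≤ Y) (hz : ∀ i ∈ s, 0 ≤ z i ∧ z i ≤ 1 / 2)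
    (hsep : ∀ i ∈ s, ∀ j ∈ s, i ≠ j → 1 / (2 * q : ℝ) ≤ |z i - z j|)
    (hwY : ∀ i ∈ s, w i ≤ Y) (hw : ∀ i ∈ s, w i * z i ≤ 1) :
    ∑ i ∈ s, w i ≤ Y + 2 * q * (1 + Real.log q) := by
  have hq' : (0 : ℝ) < q := by exact_mod_cast hq
  let φ : ℕ → ℝ := fun j => if j = 0 then Y else 2 * q * (j : ℝ)⁻¹
  have hφ0 : ∀ j, 0 ≤ φ j := fun j => by
    simp only [φ]
    split_ifs
    · exact hY
    · positivity
  let J : ι → ℕ := fun i => ⌊2 * q * z i⌋₊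
  have hinj : Set.InjOn J s := by
    intro i hi j hj hij
    by_contra hne
    have h1 := hsep i hi j hj hne
    have a1 := Nat.floor_le (show 0 ≤ 2 * q * z i from mul_nonneg (by positivity) (hz i hi).1)
    have a2 := Nat.lt_floor_add_one (2 * q * z i)
    have b1 := Nat.floor_le (show 0 ≤ 2 * q * z j from mul_nonneg (by positivity) (hz j hj).1)
    have b2 := Nat.lt_floor_add_one (2 * q * z j)
    have hij' : ⌊2 * q * z i⌋₊ = ⌊2 * q * z j⌋₊ := hij
    rw [hij'] at a1 a2
    rw [div_le_iff₀ (by positivity)] at h1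
    rcases abs_cases (z i - z j) with ⟨h, _⟩ | ⟨h, _⟩ <;> rw [h] at h1 <;> nlinarith
  have hJ : ∀ i ∈ s, J i ∈ Finset.range (q + 1) := fun i hi => by
    rw [Finset.mem_range]
    refine Nat.lt_succ_of_le (Nat.floor_le_of_le ?_)
    have := (hz i hi).2
    nlinarith
  have hle : ∀ i ∈ s, w i ≤ φ (J i) := fun i hi => by
    simp only [φ]
    split_ifs with h
    · exact hwY i hi
    · have hpos : (0 : ℝ) < J i := by exact_mod_cast Nat.pos_of_ne_zero h
      have a1 : (J i : ℝ) ≤ 2 * q * z i :=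
        Nat.floor_le (show 0 ≤ 2 * q * z i from mul_nonneg (by positivity) (hz i hi).1)
      rw [← div_eq_mul_inv, le_div_iff₀ hpos]
      rcases le_or_gt 0 (w i) with hw0 | hw0
      · calc w i * J i ≤ w i * (2 * q * z i) := mul_le_mul_of_nonneg_left a1 hw0
          _ = 2 * q * (w i * z i) := by ring
          _ ≤ 2 * q * 1 := mul_le_mul_of_nonneg_left (hw i hi) (by positivity)
          _ = 2 * q := mul_one _
      · nlinarith
  calc ∑ i ∈ s, w i ≤ ∑ i ∈ s, φ (J i) := Finset.sum_le_sum hle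
    _ = ∑ j ∈ s.image J, φ j := (Finset.sum_image hinj).symm
    _ ≤ ∑ j ∈ Finset.range (q + 1), φ j :=
        Finset.sum_le_sum_of_subset_of_nonneg (Finset.image_subset_iff.2 hJ) fun j _ _ => hφ0 j
    _ = Y + 2 * q * ∑ j ∈ Finset.range q, ((j + 1 : ℕ) : ℝ)⁻¹ := by
        rw [Finset.sum_range_succ', add_comm, Finset.mul_sum]
        simp [φ]
    _ ≤ Y + 2 * q * (1 + Real.log q) := by
        have h := harmonic_le_one_add_log q
        rw [harmonic] at h
        push_cast at h ⊢
        gcongr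

/-- `a / q` is a rational approximation in lowest terms of `α`, as in Dirichlet's theorem. -/
structure IsApprox (α : ℝ) (a : ℤ) (q : ℕ) : Prop where
  two_le : 2 ≤ q
  coprime : IsCoprime a q
  abs_sub_le : |α - a / q| ≤ 1 / (q : ℝ) ^ 2

/-- By coprimality al/q is not an integer, hence at distance at least 1/q from every integer;
replacing a/q by α moves it by at most (1/q²)(q/2) = 1/(2q). -/
theorem IsApprox.le_nd {α : ℝ} {a : ℤ} {q : ℕ} (h : IsApprox α a q) {l : ℤ} (hl : l ≠ 0)
    (hlq : 2 * |l| ≤ q) : 1 / (2 * q : ℝ) ≤ nd (α * l) := by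
  have hq : (0 : ℝ) < q := by exact_mod_cast lt_of_lt_of_le zero_lt_two h.two_le
  set r := round (α * l) with hr
  have hne : a * l - r * q ≠ 0 := by
    intro h0
    have hd : (q : ℤ) ∣ a * l := ⟨r, by linarith⟩
    have hd' : (q : ℤ) ∣ l := h.coprime.symm.dvd_of_dvd_mul_left hd
    have := Int.le_of_dvd (abs_pos.2 hl) ((dvd_abs _ _).2 hd')
    have h2 := abs_pos.2 hl
    omega
  have h1 : (1 : ℝ) ≤ |(a : ℝ) * l - r * q| := by
    have : (1 : ℤ) ≤ |a * l - r * q| := Int.one_le_abs hne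
    exact_mod_cast this
  have h2 : |(l : ℝ)| ≤ q / 2 := by
    have : (2 : ℝ) * |(l : ℝ)| ≤ q := by exact_mod_cast hlq
    linarith
  have h3 : |(α - a / q) * l| ≤ 1 / (2 * q) := by
    rw [abs_mul]
    calc |α - a / q| * |(l : ℝ)| ≤ 1 / (q : ℝ) ^ 2 * (q / 2) :=
          mul_le_mul h.abs_sub_le h2 (abs_nonneg _) (by positivity)
      _ = 1 / (2 * q) := by field_simp
  have h4 : 1 / (q : ℝ) ≤ |(a : ℝ) * l / q - r| := by
    have : (a : ℝ) * l / q - r = (a * l - r * q) / q := by field_simp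
    rw [this, abs_div, abs_of_pos hq]
    exact div_le_div_of_nonneg_right h1 hq.le
  have h5 : (a : ℝ) * l / q - r = (α * l - r) - (α - a / q) * l := by ring
  have h6 : |(a : ℝ) * l / q - r| ≤ |α * l - r| + |(α - a / q) * l| := by
    rw [h5]
    exact abs_sub _ _
  have h7 : 1 / (q : ℝ) - 1 / (2 * q) = 1 / (2 * q) := by field_simp; norm_num
  rw [nd, ← hr]
  linarith

/-- In a block of length ⌊q/2⌋ all differences fall under `IsApprox.le_nd`. Splitting by the sign of
the signed fractional part gives two separated families in [0, 1/2], hence the doubled bound. -/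
theorem IsApprox.sum_block_le {α : ℝ} {a : ℤ} {q : ℕ} (h : IsApprox α a q) (w : ℕ → ℝ) {Y : ℝ}
    (hY : 0 ≤ Y) (A : Finset ℕ) {s : ℕ} (hA : A ⊆ Finset.Ico s (s + q / 2))
    (hwY : ∀ i ∈ A, w i ≤ Y) (hw : ∀ i ∈ A, w i * nd (α * i) ≤ 1) :
    ∑ l ∈ A, w l ≤ 2 * Y + 4 * q * (1 + Real.log q) := by
  have hq0 : 0 < q := lt_of_lt_of_le zero_lt_two h.two_le
  have hsep : ∀ i ∈ A, ∀ j ∈ A, i ≠ j →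
      1 / (2 * q : ℝ) ≤ |(α * i - round (α * i)) - (α * j - round (α * j))| := by
    intro i hi j hj hij
    have hi' := Finset.mem_Ico.1 (hA hi)
    have hj' := Finset.mem_Ico.1 (hA hj)
    have := h.le_nd (l := (i : ℤ) - j) (by omega) (by
      rcases abs_cases ((i : ℤ) - j) with ⟨e, _⟩ | ⟨e, _⟩ <;> rw [e] <;> omega)
    refine this.trans ?_
    have e : α * ((i : ℤ) - j : ℤ) = α * i - α * j := by push_cast; ring
    rw [e]
    exact nd_sub_le _ _
  classical
  have h1 := sum_le_of_separated (A.filter fun l : ℕ => 0 ≤ α * l - round (α * l))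
    (fun l : ℕ => α * l - round (α * l)) w hq0 hY
    (fun i hi => ⟨(Finset.mem_filter.1 hi).2, (le_abs_self _).trans (nd_le_half _)⟩)
    (fun i hi j hj => hsep i (Finset.mem_filter.1 hi).1 j (Finset.mem_filter.1 hj).1)
    (fun i hi => hwY i (Finset.mem_filter.1 hi).1)
    (fun i hi => by
      have := hw i (Finset.mem_filter.1 hi).1
      rwa [nd, abs_of_nonneg (Finset.mem_filter.1 hi).2] at this)
  have h2 := sum_le_of_separated (A.filter fun l : ℕ => ¬ 0 ≤ α * l - round (α * l))
    (fun l : ℕ => -(α * l - round (α * l))) w hq0 hY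
    (fun i hi => ⟨by linarith [not_le.1 (Finset.mem_filter.1 hi).2],
      (neg_le_abs _).trans (nd_le_half _)⟩)
    (fun i hi j hj hij => by
      have := hsep i (Finset.mem_filter.1 hi).1 j (Finset.mem_filter.1 hj).1 hij
      rwa [neg_sub_neg, abs_sub_comm])
    (fun i hi => hwY i (Finset.mem_filter.1 hi).1)
    (fun i hi => by
      have := hw i (Finset.mem_filter.1 hi).1
      rwa [nd, abs_of_neg (not_le.1 (Finset.mem_filter.1 hi).2)] at this)
  rw [← Finset.sum_filter_add_sum_filter_not A (fun l : ℕ => 0 ≤ α * l - round (α * l))]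
  linarith

theorem IsApprox.sum_range_le {α : ℝ} {a : ℤ} {q : ℕ} (h : IsApprox α a q) (w : ℕ → ℝ) {Y : ℝ}
    (hY : 0 ≤ Y) (n : ℕ) (hwY : ∀ i < n, w i ≤ Y) (hw : ∀ i < n, w i * nd (α * i) ≤ 1) :
    ∑ l ∈ Finset.range n, w l ≤
      (3 * n / q + 1) * (2 * Y + 4 * q * (1 + Real.log q)) := by
  have hq2 := h.two_le
  have hq : (0 : ℝ) < q := by exact_mod_cast lt_of_lt_of_le zero_lt_two hq2
  have hlog : 0 ≤ Real.log q := Real.log_natCast_nonneg q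
  set D := 2 * Y + 4 * q * (1 + Real.log q) with hD
  have hD0 : 0 ≤ D := by positivity
  have key : ∀ k m : ℕ, m ≤ n → m ≤ k * (q / 2) → ∑ l ∈ Finset.range m, w l ≤ k * D := by
    intro k
    induction k with
    | zero =>
      intro m _ hm
      obtain rfl : m = 0 := by omega
      simp
    | succ k ih =>
      intro m hmn hm
      rcases le_or_gt m (k * (q / 2)) with hmk | hmk
      · refine (ih m hmn hmk).trans ?_
        push_cast
        nlinarith
      · rw [← Finset.sum_range_add_sum_Ico _ hmk.le]
        have h1 := ih (k * (q / 2)) (by omega) le_rfl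
        have h2 := h.sum_block_le w hY (Finset.Ico (k * (q / 2)) m) (s := k * (q / 2))
          (Finset.Ico_subset_Ico_right (by rw [add_mul, one_mul] at hm; exact hm))
          (fun i hi => hwY i (by have := Finset.mem_Ico.1 hi; omega))
          (fun i hi => hw i (by have := Finset.mem_Ico.1 hi; omega))
        push_cast
        linarith
  have hB : 0 < q / 2 := by omega
  have h1 := key (n / (q / 2) + 1) n le_rfl (by
    have := Nat.div_add_mod n (q / 2)
    have := Nat.mod_lt n hB
    rw [add_mul, one_mul, mul_comm]
    omega)
  refine h1.trans (mul_le_mul_of_nonneg_right ?_ hD0)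
  push_cast
  have h2 : ((n / (q / 2) : ℕ) : ℝ) ≤ n / (q / 2 : ℕ) := Nat.cast_div_le
  -- The worst case of the floor is q = 3; this is the source of the 3 in 3n/q.
  have h3 : (q : ℝ) ≤ 3 * (q / 2 : ℕ) := by exact_mod_cast (by omega : q ≤ 3 * (q / 2))
  have h4 : (n : ℝ) / (q / 2 : ℕ) ≤ 3 * n / q := by
    rw [div_le_div_iff₀ (by exact_mod_cast hB) hq]
    have : (0 : ℝ) ≤ n := Nat.cast_nonneg _
    nlinarith
  linarith

/-! ### Bilinear sums -/

theorem sum_inv_Ioc_le (U N X : ℕ) (hN : N ≤ X) :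
    ∑ n ∈ Finset.Ioc U N, (n : ℝ)⁻¹ ≤ 1 + Real.log X := by
  have h := harmonic_le_one_add_log X
  rw [harmonic_eq_sum_Icc] at h
  push_cast at h
  refine le_trans (Finset.sum_le_sum_of_subset_of_nonneg ?_ fun i _ _ => by positivity) h
  intro n hn
  rw [Finset.mem_Ioc] at hn
  rw [Finset.mem_Icc]
  omega

theorem sum_inv_sq_Ioc_le {U : ℕ} (hU : 0 < U) (N : ℕ) :
    ∑ n ∈ Finset.Ioc U N, ((n : ℝ) ^ 2)⁻¹ ≤ (U : ℝ)⁻¹ := by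
  have hU' : (0 : ℝ) < U := by exact_mod_cast hU
  rcases lt_or_ge N U with h | h
  · rw [Finset.Ioc_eq_empty_of_le h.le]
    simp
  suffices ∑ n ∈ Finset.Ioc U N, ((n : ℝ) ^ 2)⁻¹ ≤ (U : ℝ)⁻¹ - (N : ℝ)⁻¹ from
    this.trans (by simp)
  induction N, h using Nat.le_induction with
  | base => simp
  | succ n hn ih =>
    rw [Finset.sum_Ioc_succ_top (by omega)]
    have hn' : (0 : ℝ) < n := hU'.trans_le (by exact_mod_cast hn)
    have : (((n + 1 : ℕ) : ℝ) ^ 2)⁻¹ ≤ (n : ℝ)⁻¹ - ((n + 1 : ℕ) : ℝ)⁻¹ := by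
      push_cast
      rw [inv_sub_inv hn'.ne' (by positivity), inv_eq_one_div, div_le_div_iff₀ (by positivity)
        (by positivity)]
      nlinarith
    linarith

/-- The sum `∑ m * exp (2 π i m β)` over `U < m ≤ N`. -/
def linSum (U N : ℕ) (β : ℝ) : ℂ := ∑ m ∈ Finset.Ioc U N, (m : ℂ) * ex (m * β)

theorem norm_linSum_neg (U N : ℕ) (β : ℝ) : ‖linSum U N (-β)‖ = ‖linSum U N β‖ := by
  have : linSum U N (-β) = (starRingEnd ℂ) (linSum U N β) := by
    rw [linSum, linSum, map_sum]
    refine Finset.sum_congr rfl fun m _ => ?_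
    rw [map_mul, conj_ex, Complex.conj_natCast, mul_neg]
  rw [this, RCLike.norm_conj]

/-- With Y = X/n the linear sums are at most min(Y², Y/‖β‖). Dividing by Y leaves weights bounded by
min(Y, 1/‖β‖), as the block estimate requires, with l = n - n' as summation variable. -/
theorem IsApprox.sum_norm_linSum_le {α : ℝ} {a : ℤ} {q : ℕ} (h : IsApprox α a q) {U X y n : ℕ}
    (hy : y ≤ X) (hn : 0 < n) :
    ∑ n' ∈ Finset.Ioc U n, ‖linSum U (y / n) (α * ((n : ℝ) - n'))‖ ≤
      (X / n : ℝ) * ((3 * n / q + 1) * (2 * (X / n : ℝ) + 4 * q * (1 + Real.log q))) := by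
  rcases Nat.eq_zero_or_pos X with rfl | hX
  · obtain rfl : y = 0 := by omega
    simp [linSum]
  have hn' : (0 : ℝ) < n := by exact_mod_cast hn
  have hX' : (0 : ℝ) < X := by exact_mod_cast hX
  set Y : ℝ := X / n with hYdef
  have hY : 0 < Y := by positivity
  have hyY : ((y / n : ℕ) : ℝ) ≤ Y :=
    Nat.cast_div_le.trans (div_le_div_of_nonneg_right (by exact_mod_cast hy) hn'.le)
  have h1 := h.sum_range_le (fun l => ‖linSum U (y / n) (α * l)‖ / Y) hY.le n
    (fun l _ => by
      rw [div_le_iff₀ hY]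
      exact (norm_sum_nat_mul_ex_le _ _ _).trans (by gcongr))
    (fun l _ => by
      rw [div_mul_eq_mul_div, div_le_one hY]
      exact (norm_sum_nat_mul_ex_mul_nd_le _ _ _).trans hyY)
  rw [← Finset.sum_div, div_le_iff₀ hY, mul_comm _ Y] at h1
  refine le_trans ?_ h1
  have h2 : ∀ n' ∈ Finset.Ioc U n, ‖linSum U (y / n) (α * ((n : ℝ) - n'))‖ =
      ‖linSum U (y / n) (α * ((n - n' : ℕ) : ℝ))‖ := fun n' hn'' => by
    rw [Nat.cast_sub (Finset.mem_Ioc.1 hn'').2]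
  rw [Finset.sum_congr rfl h2]
  have h3 : Set.InjOn (fun n' => n - n') (Finset.Ioc U n : Finset ℕ) := by
    intro i hi j hj hij
    simp only [Finset.coe_Ioc, Set.mem_Ioc] at hi hj hij
    omega
  rw [← Finset.sum_image (f := fun l : ℕ => ‖linSum U (y / n) (α * l)‖) h3]
  refine Finset.sum_le_sum_of_subset_of_nonneg ?_ fun _ _ _ => norm_nonneg _
  intro l hl
  obtain ⟨i, hi, rfl⟩ := Finset.mem_image.1 hl
  rw [Finset.mem_Ioc] at hi
  rw [Finset.mem_range]
  omega

/-- Expanding the bound for fixed n gives four terms; U ≤ q and qU ≤ X make each of them O(X²ℓ²/U),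
with constants 6 + 12 + 2 + 4 = 24. -/
theorem IsApprox.sum_sum_norm_linSum_le {α : ℝ} {a : ℤ} {q : ℕ} (h : IsApprox α a q)
    {U X y : ℕ} (hU : 0 < U) (hUq : U ≤ q) (hqX : q * U ≤ X) (hy : y ≤ X) :
    ∑ n ∈ Finset.Ioc U y, ∑ n' ∈ Finset.Ioc U n, ‖linSum U (y / n) (α * ((n : ℝ) - n'))‖ ≤
      24 * (X : ℝ) ^ 2 * (1 + Real.log X) ^ 2 / U := by
  have hU' : (0 : ℝ) < U := by exact_mod_cast hU
  have hq' : (0 : ℝ) < q := by exact_mod_cast lt_of_lt_of_le hU hUq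
  have hqX' : q ≤ X := le_trans (Nat.le_mul_of_pos_right _ hU) hqX
  have hX' : (0 : ℝ) < X := hq'.trans_le (by exact_mod_cast hqX')
  have hX1 : 1 ≤ X := by exact_mod_cast hX'
  set ℓ : ℝ := 1 + Real.log X with hl
  have hl1 : 1 ≤ ℓ := by
    have := Real.log_natCast_nonneg X
    linarith
  have hlq : 1 + Real.log q ≤ ℓ := by
    have := Real.log_le_log hq' (by exact_mod_cast hqX' : (q : ℝ) ≤ X)
    linarith
  have h1 : ∑ n ∈ Finset.Ioc U y, ∑ n' ∈ Finset.Ioc U n,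
      ‖linSum U (y / n) (α * ((n : ℝ) - n'))‖ ≤
      ∑ n ∈ Finset.Ioc U (y / U), (6 * X ^ 2 / q * (n : ℝ)⁻¹ + 12 * X * ℓ +
        2 * X ^ 2 * ((n : ℝ) ^ 2)⁻¹ + 4 * X * q * ℓ * (n : ℝ)⁻¹) := by
    have hsub : Finset.Ioc U (y / U) ⊆ Finset.Ioc U y :=
      Finset.Ioc_subset_Ioc_right (Nat.div_le_self _ _)
    rw [← Finset.sum_subset hsub]
    · refine Finset.sum_le_sum fun n hn => ?_
      have hn0 : 0 < n := by
        have := (Finset.mem_Ioc.1 hn).1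
        omega
      have hn' : (0 : ℝ) < n := by exact_mod_cast hn0
      refine (h.sum_norm_linSum_le hy hn0).trans ?_
      calc (X / n : ℝ) * ((3 * n / q + 1) * (2 * (X / n : ℝ) + 4 * q * (1 + Real.log q)))
          ≤ (X / n : ℝ) * ((3 * n / q + 1) * (2 * (X / n : ℝ) + 4 * q * ℓ)) := by gcongr
        _ = _ := by field_simp; ring
    -- For n > y/U the condition mn ≤ y leaves no m > U, so only n ≤ y/U contribute.
    · intro n hn hn'
      refine Finset.sum_eq_zero fun n' _ => ?_
      rw [Finset.mem_Ioc] at hn hn'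
      have : y / n ≤ U := by
        have h3 : y / U < n := by omega
        rw [Nat.div_lt_iff_lt_mul hU] at h3
        refine Nat.lt_succ_iff.1 ((Nat.div_lt_iff_lt_mul (by omega)).2 ?_)
        nlinarith
      rw [linSum, Finset.Ioc_eq_empty_of_le this]
      simp
  refine h1.trans ?_
  have hyU : y / U ≤ X := (Nat.div_le_self _ _).trans hy
  have e1 := sum_inv_Ioc_le U (y / U) X hyU
  have e2 := sum_inv_sq_Ioc_le hU (y / U)
  have e3 : ((Finset.Ioc U (y / U)).card : ℝ) ≤ X / U := by
    rw [Nat.card_Ioc]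
    calc ((y / U - U : ℕ) : ℝ) ≤ (y / U : ℕ) := by exact_mod_cast Nat.sub_le _ _
      _ ≤ y / U := Nat.cast_div_le
      _ ≤ X / U := by gcongr
  rw [Finset.sum_add_distrib, Finset.sum_add_distrib, Finset.sum_add_distrib, Finset.sum_const,
    nsmul_eq_mul, ← Finset.mul_sum, ← Finset.mul_sum, ← Finset.mul_sum]
  have t1 : 6 * (X : ℝ) ^ 2 / q * ∑ n ∈ Finset.Ioc U (y / U), (n : ℝ)⁻¹ ≤
      6 * X ^ 2 / U * ℓ ^ 2 := by
    have : 6 * (X : ℝ) ^ 2 / q ≤ 6 * X ^ 2 / U := by gcongr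
    calc _ ≤ 6 * (X : ℝ) ^ 2 / U * ℓ := by gcongr
      _ ≤ _ := by gcongr; nlinarith
  have t2 : ((Finset.Ioc U (y / U)).card : ℝ) * (12 * X * ℓ) ≤ 12 * X ^ 2 / U * ℓ ^ 2 := by
    calc _ ≤ (X / U : ℝ) * (12 * X * ℓ) := by gcongr
      _ = 12 * X ^ 2 / U * ℓ := by ring
      _ ≤ _ := by gcongr; nlinarith
  have t3 : 2 * (X : ℝ) ^ 2 * ∑ n ∈ Finset.Ioc U (y / U), ((n : ℝ) ^ 2)⁻¹ ≤
      2 * X ^ 2 / U * ℓ ^ 2 := by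
    calc _ ≤ 2 * (X : ℝ) ^ 2 * (U : ℝ)⁻¹ := by gcongr
      _ = 2 * X ^ 2 / U * 1 := by ring
      _ ≤ _ := by gcongr; nlinarith
  have t4 : 4 * (X : ℝ) * q * ℓ * ∑ n ∈ Finset.Ioc U (y / U), (n : ℝ)⁻¹ ≤
      4 * X ^ 2 / U * ℓ ^ 2 := by
    have hq2 : (q : ℝ) ≤ X / U := by
      rw [le_div_iff₀ hU']
      exact_mod_cast hqX
    calc _ ≤ 4 * (X : ℝ) * (X / U) * ℓ * ℓ := by gcongr
      _ = _ := by ring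
  calc _ ≤ 6 * (X : ℝ) ^ 2 / U * ℓ ^ 2 + 12 * X ^ 2 / U * ℓ ^ 2 + 2 * X ^ 2 / U * ℓ ^ 2 +
        4 * X ^ 2 / U * ℓ ^ 2 := add_le_add (add_le_add (add_le_add t1 t2) t3) t4
    _ = _ := by ring

/-- The inner sum of a bilinear form. -/
def innerSum (α : ℝ) (b : ℕ → ℝ) (U y m : ℕ) : ℂ :=
  ∑ n ∈ Finset.Ioc U (y / m), (b n : ℂ) * ex (α * (m * n : ℕ))

/-- Opening the square and summing over m first: mn ≤ y and mn' ≤ y together mean m ≤ y / max(n,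
n'). -/
theorem sum_mul_innerSum_sq (α : ℝ) (b : ℕ → ℝ) (U y : ℕ) :
    ∑ m ∈ Finset.Ioc U y, (m : ℂ) * (innerSum α b U y m * (starRingEnd ℂ) (innerSum α b U y m)) =
      ∑ n ∈ Finset.Ioc U y, ∑ n' ∈ Finset.Ioc U y, (b n : ℂ) * b n' *
        linSum U (y / max n n') (α * ((n : ℝ) - n')) := by
  have h1 : ∀ m ∈ Finset.Ioc U y, innerSum α b U y m =
      ∑ n ∈ Finset.Ioc U y, if m * n ≤ y then (b n : ℂ) * ex (α * (m * n : ℕ)) else 0 := by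
    intro m hm
    rw [← Finset.sum_filter, innerSum]
    congr 1
    ext n
    simp only [Finset.mem_filter, Finset.mem_Ioc] at hm ⊢
    rw [Nat.le_div_iff_mul_le (by omega)]
    constructor
    · rintro ⟨h1, h2⟩
      exact ⟨⟨h1, by nlinarith⟩, by linarith⟩
    · rintro ⟨⟨h1, _⟩, h2⟩
      exact ⟨h1, by linarith⟩
  have h2 : ∀ m ∈ Finset.Ioc U y,
      (m : ℂ) * (innerSum α b U y m * (starRingEnd ℂ) (innerSum α b U y m)) =
      ∑ n ∈ Finset.Ioc U y, ∑ n' ∈ Finset.Ioc U y, if m * max n n' ≤ y then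
        (b n : ℂ) * b n' * (m * ex (m * (α * ((n : ℝ) - n')))) else 0 := by
    intro m hm
    rw [h1 m hm, map_sum, Finset.sum_mul_sum, Finset.mul_sum]
    refine Finset.sum_congr rfl fun n _ => ?_
    rw [Finset.mul_sum]
    refine Finset.sum_congr rfl fun n' _ => ?_
    simp only [← Nat.mul_max_mul_left, max_le_iff]
    by_cases c1 : m * n ≤ y <;> by_cases c2 : m * n' ≤ y <;> simp only [c1, c2, if_true, if_false,
      map_zero, mul_zero, zero_mul, and_true, and_self, and_false]
    rw [map_mul, conj_ex, Complex.conj_ofReal]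
    have : (m : ℝ) * (α * ((n : ℝ) - n')) = α * (m * n : ℕ) + -(α * (m * n' : ℕ)) := by
      push_cast
      ring
    rw [this, ex_add]
    ring
  rw [Finset.sum_congr rfl h2, Finset.sum_comm]
  refine Finset.sum_congr rfl fun n hn => ?_
  rw [Finset.sum_comm]
  refine Finset.sum_congr rfl fun n' hn' => ?_
  rw [← Finset.sum_filter, linSum, Finset.mul_sum]
  refine Finset.sum_congr ?_ fun _ _ => rfl
  ext m
  simp only [Finset.mem_filter, Finset.mem_Ioc] at hn ⊢
  have hmax : 0 < max n n' := lt_of_lt_of_le (by omega) (le_max_left n n')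
  rw [Nat.le_div_iff_mul_le hmax]
  constructor
  · rintro ⟨⟨h1, _⟩, h2⟩
    exact ⟨h1, h2⟩
  · rintro ⟨h1, h2⟩
    exact ⟨⟨h1, by nlinarith⟩, h2⟩

theorem IsApprox.sum_mul_norm_innerSum_sq_le {α : ℝ} {a : ℤ} {q : ℕ} (h : IsApprox α a q)
    {U X y : ℕ} (hU : 0 < U) (hUq : U ≤ q) (hqX : q * U ≤ X) (hy : y ≤ X) (b : ℕ → ℝ)
    (hb : ∀ n ≤ X, |b n| ≤ 1 + Real.log X) :
    ∑ m ∈ Finset.Ioc U y, (m : ℝ) * ‖innerSum α b U y m‖ ^ 2 ≤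
      48 * (X : ℝ) ^ 2 * (1 + Real.log X) ^ 4 / U := by
  set ℓ : ℝ := 1 + Real.log X with hl
  have hl0 : 0 ≤ ℓ := by
    have := Real.log_natCast_nonneg X
    linarith
  have h1 : ((∑ m ∈ Finset.Ioc U y, (m : ℝ) * ‖innerSum α b U y m‖ ^ 2 : ℝ) : ℂ) =
      ∑ n ∈ Finset.Ioc U y, ∑ n' ∈ Finset.Ioc U y, (b n : ℂ) * b n' *
        linSum U (y / max n n') (α * ((n : ℝ) - n')) := by
    rw [← sum_mul_innerSum_sq]
    push_cast
    refine Finset.sum_congr rfl fun m _ => ?_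
    rw [Complex.mul_conj']
  have h2 : ∑ m ∈ Finset.Ioc U y, (m : ℝ) * ‖innerSum α b U y m‖ ^ 2 ≤
      ∑ n ∈ Finset.Ioc U y, ∑ n' ∈ Finset.Ioc U y,
        ℓ ^ 2 * ‖linSum U (y / max n n') (α * ((n : ℝ) - n'))‖ := by
    have h3 : ∑ m ∈ Finset.Ioc U y, (m : ℝ) * ‖innerSum α b U y m‖ ^ 2 ≤
        ‖((∑ m ∈ Finset.Ioc U y, (m : ℝ) * ‖innerSum α b U y m‖ ^ 2 : ℝ) : ℂ)‖ := by
      rw [Complex.norm_real]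
      exact le_abs_self _
    refine h3.trans ?_
    rw [h1]
    refine norm_sum_le_of_le _ fun n hn => norm_sum_le_of_le _ fun n' hn' => ?_
    rw [Finset.mem_Ioc] at hn hn'
    rw [norm_mul, norm_mul, Complex.norm_real, Complex.norm_real, Real.norm_eq_abs,
      Real.norm_eq_abs, sq]
    have := hb n (by omega)
    have := hb n' (by omega)
    gcongr
  refine h2.trans ?_
  simp_rw [← Finset.mul_sum]
  -- The summand is symmetric in n and n', so the part n' ≤ n suffices at the cost of a factor 2.
  have h4 : ∑ n ∈ Finset.Ioc U y, ∑ n' ∈ Finset.Ioc U y,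
      ‖linSum U (y / max n n') (α * ((n : ℝ) - n'))‖ ≤
      2 * ∑ n ∈ Finset.Ioc U y, ∑ n' ∈ Finset.Ioc U n,
        ‖linSum U (y / n) (α * ((n : ℝ) - n'))‖ := by
    set G : ℕ → ℕ → ℝ := fun n n' => if n' ≤ n then
      ‖linSum U (y / n) (α * ((n : ℝ) - n'))‖ else 0 with hG
    have e1 : ∀ n ∈ Finset.Ioc U y, ∑ n' ∈ Finset.Ioc U n,
        ‖linSum U (y / n) (α * ((n : ℝ) - n'))‖ = ∑ n' ∈ Finset.Ioc U y, G n n' := by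
      intro n hn
      rw [hG, ← Finset.sum_filter]
      congr 1
      ext n'
      simp only [Finset.mem_filter, Finset.mem_Ioc] at hn ⊢
      omega
    rw [Finset.sum_congr rfl e1, two_mul]
    nth_rw 2 [Finset.sum_comm]
    rw [← Finset.sum_add_distrib]
    refine Finset.sum_le_sum fun n _ => ?_
    rw [← Finset.sum_add_distrib]
    refine Finset.sum_le_sum fun n' _ => ?_
    have hG0 : ∀ i j, 0 ≤ G i j := fun i j => by
      simp only [hG]
      split_ifs
      · exact norm_nonneg _
      · exact le_rfl
    rcases le_total n' n with hle | hle
    · have : ‖linSum U (y / max n n') (α * ((n : ℝ) - n'))‖ = G n n' := by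
        rw [max_eq_left hle, hG]
        simp [hle]
      have := hG0 n' n
      linarith
    · have : ‖linSum U (y / max n n') (α * ((n : ℝ) - n'))‖ = G n' n := by
        rw [max_eq_right hle, hG, ← norm_linSum_neg, ← mul_neg, neg_sub]
        simp [hle]
      have := hG0 n n'
      linarith
  have h5 := h.sum_sum_norm_linSum_le hU hUq hqX hy
  calc ℓ ^ 2 * _ ≤ ℓ ^ 2 * (2 * (24 * (X : ℝ) ^ 2 * ℓ ^ 2 / U)) := by gcongr; linarith
    _ = _ := by ring

/-- Cauchy–Schwarz with weights 1/m and m. The weight m makes all ranges of m contribute evenly, so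
no dyadic decomposition is needed. -/
theorem IsApprox.norm_bilinear_le {α : ℝ} {a : ℤ} {q : ℕ} (h : IsApprox α a q)
    {U X y : ℕ} (hU : 0 < U) (hUq : U ≤ q) (hqX : q * U ≤ X) (hy : y ≤ X) (c b : ℕ → ℝ)
    (hc : ∀ n, |c n| ≤ 1) (hb : ∀ n ≤ X, |b n| ≤ 1 + Real.log X) :
    ‖∑ m ∈ Finset.Ioc U y, (c m : ℂ) * innerSum α b U y m‖ ≤
      7 * (X : ℝ) * (1 + Real.log X) ^ 3 / √U := by
  set ℓ : ℝ := 1 + Real.log X with hl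
  have hl1 : 1 ≤ ℓ := by
    have := Real.log_natCast_nonneg X
    linarith
  have hU' : (0 : ℝ) < U := by exact_mod_cast hU
  have h1 : ‖∑ m ∈ Finset.Ioc U y, (c m : ℂ) * innerSum α b U y m‖ ≤
      ∑ m ∈ Finset.Ioc U y, ‖innerSum α b U y m‖ := by
    refine norm_sum_le_of_le _ fun m _ => ?_
    rw [norm_mul, Complex.norm_real, Real.norm_eq_abs]
    exact mul_le_of_le_one_left (norm_nonneg _) (hc m)
  have h2 : (∑ m ∈ Finset.Ioc U y, ‖innerSum α b U y m‖) ^ 2 ≤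
      (∑ m ∈ Finset.Ioc U y, (m : ℝ)⁻¹) *
        ∑ m ∈ Finset.Ioc U y, (m : ℝ) * ‖innerSum α b U y m‖ ^ 2 := by
    refine Finset.sum_sq_le_sum_mul_sum_of_sq_le_mul _ (fun _ _ => by positivity)
      (fun _ _ => by positivity) fun m hm => ?_
    have : (m : ℝ) ≠ 0 := by
      have := (Finset.mem_Ioc.1 hm).1
      exact_mod_cast (by omega : m ≠ 0)
    refine le_of_eq ?_
    field_simp
  have h3 := h.sum_mul_norm_innerSum_sq_le hU hUq hqX hy b hb
  have h4 := sum_inv_Ioc_le U y X hy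
  refine h1.trans (abs_le_of_sq_le_sq' ?_ (by positivity)).2
  calc _ ≤ _ := h2
    _ ≤ ℓ * (48 * (X : ℝ) ^ 2 * ℓ ^ 4 / U) := by gcongr
    _ = 48 * (X : ℝ) ^ 2 * ℓ ^ 5 / U := by ring
    -- Enlarged to a perfect square, so that the root can be taken.
    _ ≤ 49 * (X : ℝ) ^ 2 * ℓ ^ 6 / U := by
      have : ℓ ^ 5 ≤ ℓ ^ 6 := pow_le_pow_right₀ hl1 (by norm_num)
      gcongr
      norm_num
    _ = (7 * (X : ℝ) * ℓ ^ 3 / √U) ^ 2 := by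
      rw [div_pow, Real.sq_sqrt hU'.le]
      ring

/-! ### Vaughan's identity -/

open ArithmeticFunction in
/-- The restriction of an arithmetic function to arguments `≤ U`. -/
def lowPart (f : ArithmeticFunction ℝ) (U : ℕ) : ArithmeticFunction ℝ :=
  ⟨fun n => if n ≤ U then f n else 0, by simp⟩

open ArithmeticFunction in
-- A formal consequence of Λ * 1 = log, μ * 1 = δ and μ * log = Λ in the ring of arithmetic
-- functions, with the same cut-off U for μ and Λ.
theorem vaughan_identity (U : ℕ) :
    (vonMangoldt : ArithmeticFunction ℝ) = lowPart vonMangoldt U +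
      lowPart (moebius : ArithmeticFunction ℝ) U * log -
      lowPart (moebius : ArithmeticFunction ℝ) U * lowPart vonMangoldt U * (zeta : ArithmeticFunction ℝ) +
      ((moebius : ArithmeticFunction ℝ) - lowPart (moebius : ArithmeticFunction ℝ) U) *
        ((vonMangoldt - lowPart vonMangoldt U) * (zeta : ArithmeticFunction ℝ)) := by
  have h1 := vonMangoldt_mul_zeta
  have h2 : (moebius : ArithmeticFunction ℝ) * (zeta : ArithmeticFunction ℝ) = 1 :=
    coe_moebius_mul_coe_zeta
  linear_combination (lowPart (moebius : ArithmeticFunction ℝ) U -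
      (moebius : ArithmeticFunction ℝ)) * h1 +
    lowPart vonMangoldt U * h2 - moebius_mul_log_eq_vonMangoldt

open ArithmeticFunction in
/-- The sum `∑ f n * exp (2 π i α n)` over `1 ≤ n ≤ y`. -/
def twist (α : ℝ) (f : ArithmeticFunction ℝ) (y : ℕ) : ℂ :=
  ∑ n ∈ Finset.Ioc 0 y, (f n : ℂ) * ex (α * n)

theorem twist_add (α : ℝ) (f g : ArithmeticFunction ℝ) (y : ℕ) :
    twist α (f + g) y = twist α f y + twist α g y := by
  simp only [twist, ArithmeticFunction.add_apply, Complex.ofReal_add, add_mul,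
    Finset.sum_add_distrib]

theorem twist_sub (α : ℝ) (f g : ArithmeticFunction ℝ) (y : ℕ) :
    twist α (f - g) y = twist α f y - twist α g y := by
  rw [eq_sub_iff_add_eq, ← twist_add, sub_add_cancel]

theorem sum_Ioc_sum_divisorsAntidiagonal (F : ℕ → ℕ → ℂ) (N : ℕ) :
    ∑ k ∈ Finset.Ioc 0 N, ∑ p ∈ k.divisorsAntidiagonal, F p.1 p.2 =
      ∑ m ∈ Finset.Ioc 0 N, ∑ n ∈ Finset.Ioc 0 (N / m), F m n := by
  rw [Finset.sum_sigma', Finset.sum_sigma']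
  refine Finset.sum_bij' (fun x _ => ⟨x.2.1, x.2.2⟩) (fun x _ => ⟨x.1 * x.2, (x.1, x.2)⟩) ?_ ?_ ?_
    ?_ ?_
  · rintro ⟨k, m, n⟩ h
    simp only [Finset.mem_sigma, Finset.mem_Ioc, Nat.mem_divisorsAntidiagonal] at h ⊢
    obtain ⟨⟨h1, h2⟩, rfl, h3⟩ := h
    have hm : 0 < m := Nat.pos_of_ne_zero fun h => by simp [h] at h3
    have hn : 0 < n := Nat.pos_of_ne_zero fun h => by simp [h] at h3
    refine ⟨⟨hm, by nlinarith⟩, hn, ?_⟩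
    rw [Nat.le_div_iff_mul_le hm]
    linarith
  · rintro ⟨m, n⟩ h
    simp only [Finset.mem_sigma, Finset.mem_Ioc, Nat.mem_divisorsAntidiagonal] at h ⊢
    obtain ⟨⟨hm, h2⟩, hn, h4⟩ := h
    rw [Nat.le_div_iff_mul_le hm] at h4
    have := Nat.mul_pos hm hn
    exact ⟨⟨this, by linarith⟩, trivial, this.ne'⟩
  · rintro ⟨k, m, n⟩ h
    simp only [Finset.mem_sigma, Nat.mem_divisorsAntidiagonal] at h
    obtain ⟨_, rfl, _⟩ := h
    rfl
  · rintro ⟨m, n⟩ _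
    rfl
  · rintro ⟨k, m, n⟩ _
    rfl

theorem twist_mul (α : ℝ) (f g : ArithmeticFunction ℝ) (y : ℕ) :
    twist α (f * g) y = ∑ m ∈ Finset.Ioc 0 y,
      (f m : ℂ) * ∑ n ∈ Finset.Ioc 0 (y / m), (g n : ℂ) * ex (α * (m * n : ℕ)) := by
  have h := sum_Ioc_sum_divisorsAntidiagonal
    (fun m n => (f m : ℂ) * ((g n : ℂ) * ex (α * (m * n : ℕ)))) y
  simp_rw [Finset.mul_sum]
  rw [← h, twist]
  refine Finset.sum_congr rfl fun k hk => ?_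
  rw [ArithmeticFunction.mul_apply, Complex.ofReal_sum, Finset.sum_mul]
  refine Finset.sum_congr rfl fun p hp => ?_
  rw [(Nat.mem_divisorsAntidiagonal.1 hp).1]
  push_cast
  ring

/-- The type I estimate: f is supported on m ≤ M and the inner sums are bounded uniformly in their
length. -/
theorem norm_twist_mul_le (α : ℝ) (f g : ArithmeticFunction ℝ) (y M : ℕ) {A P : ℝ}
    (hA : 0 ≤ A) (hP : 0 ≤ P) (hf : ∀ m, M < m → f m = 0) (hfA : ∀ m ≤ M, |f m| ≤ A)
    (hg : ∀ m, 0 < m → m ≤ M → ∀ z ≤ y, 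
      ‖∑ n ∈ Finset.Ioc 0 z, (g n : ℂ) * ex (α * (m * n : ℕ))‖ ≤ P) :
    ‖twist α (f * g) y‖ ≤ M * (A * P) := by
  rw [twist_mul]
  have h1 : ∀ m ∈ Finset.Ioc 0 y,
      ‖(f m : ℂ) * ∑ n ∈ Finset.Ioc 0 (y / m), (g n : ℂ) * ex (α * (m * n : ℕ))‖ ≤
        if m ≤ M then A * P else 0 := by
    intro m hm
    split_ifs with h
    · rw [norm_mul, Complex.norm_real, Real.norm_eq_abs]
      exact mul_le_mul (hfA m h) (hg m (Finset.mem_Ioc.1 hm).1 h _ (Nat.div_le_self _ _))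
        (norm_nonneg _) hA
    · rw [hf m (not_le.1 h)]
      simp
  refine (norm_sum_le_of_le _ h1).trans ?_
  rw [← Finset.sum_filter, Finset.sum_const, nsmul_eq_mul]
  refine mul_le_mul_of_nonneg_right ?_ (by positivity)
  have : (Finset.Ioc 0 y).filter (· ≤ M) ⊆ Finset.Ioc 0 M := by
    intro m hm
    simp only [Finset.mem_filter, Finset.mem_Ioc] at hm ⊢
    omega
  simpa using Finset.card_le_card this

/-- For m ≤ q/2 the phase mα stays at distance 1/(2q) from the integers, so the geometric sum is at
most q. -/
theorem IsApprox.norm_sum_ex_le {α : ℝ} {a : ℤ} {q : ℕ} (h : IsApprox α a q) {m : ℕ} (hm : 0 < m)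
    (hmq : 2 * m ≤ q) (z : ℕ) : ‖∑ n ∈ Finset.Ioc 0 z, ex (α * (m * n : ℕ))‖ ≤ q := by
  have hq : (0 : ℝ) < q := by exact_mod_cast lt_of_lt_of_le zero_lt_two h.two_le
  have h1 := h.le_nd (l := m) (by omega) (by rw [Nat.abs_cast]; exact_mod_cast hmq)
  have h2 := norm_sum_ex_mul_nd_le (α * (m : ℤ)) 0 z
  have h3 : ∑ n ∈ Finset.Ioc 0 z, ex (α * (m * n : ℕ)) =
      ∑ n ∈ Finset.Ioc 0 z, ex (n * (α * (m : ℤ))) := by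
    refine Finset.sum_congr rfl fun n _ => ?_
    congr 1
    push_cast
    ring
  rw [h3]
  set S := ‖∑ n ∈ Finset.Ioc 0 z, ex (n * (α * (m : ℤ)))‖
  have h4 : S * (1 / q) ≤ 1 := by
    refine le_trans (mul_le_mul_of_nonneg_left ?_ (norm_nonneg _)) h2
    have : 1 / (q : ℝ) = 2 * (1 / (2 * q)) := by field_simp
    linarith
  rw [mul_one_div, div_le_one hq] at h4
  exact h4

open ArithmeticFunction in
-- The type I variables are at most U² ≤ q/2, so each type I inner sum is controlled by q alone. The
-- first three pieces total at most 4qU²ℓ ≤ 4Xℓ³/√U because qU⁴ ≤ X; the bilinear piece adds 7.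
theorem IsApprox.norm_twist_vonMangoldt_le {α : ℝ} {a : ℤ} {q : ℕ} (h : IsApprox α a q)
    {U X y : ℕ} (hU : 0 < U) (hUq : 2 * U ^ 4 ≤ q) (hqX : q * U ^ 4 ≤ X) (hy : y ≤ X) :
    ‖twist α vonMangoldt y‖ ≤ 11 * (X : ℝ) * (1 + Real.log X) ^ 3 / √U := by
  have hU1 : (1 : ℝ) ≤ U := by exact_mod_cast hU
  have hU' : (0 : ℝ) < U := by linarith
  have hUU4 : U ≤ U ^ 4 := Nat.le_self_pow (by norm_num) U
  have hUU2 : U ^ 2 ≤ U ^ 4 := Nat.pow_le_pow_right hU (by norm_num)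
  have hqX1 : q ≤ X := le_trans (Nat.le_mul_of_pos_right _ (by positivity)) hqX
  have hqU : q * U ≤ X := le_trans (Nat.mul_le_mul_left _ hUU4) hqX
  set ℓ : ℝ := 1 + Real.log X with hl
  have hlog : ∀ n ≤ X, Real.log n ≤ ℓ := fun n hn => by
    rcases Nat.eq_zero_or_pos n with rfl | hn0
    · have := Real.log_natCast_nonneg X
      simp only [Nat.cast_zero, Real.log_zero]
      linarith
    · have := Real.log_le_log (by exact_mod_cast hn0) (by exact_mod_cast hn : (n : ℝ) ≤ X)
      linarith
  have hl1 : 1 ≤ ℓ := by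
    have := Real.log_natCast_nonneg X
    linarith
  have hμ : ∀ n, |((moebius : ArithmeticFunction ℝ) n : ℝ)| ≤ 1 := fun n => by
    rw [intCoe_apply]
    have := abs_moebius_le_one (n := n)
    exact_mod_cast this
  have hμU : ∀ n, |lowPart (moebius : ArithmeticFunction ℝ) U n| ≤ 1 := fun n => by
    simp only [lowPart, coe_mk]
    split_ifs
    · exact hμ n
    · simp
  have hΛU0 : ∀ n, 0 ≤ lowPart vonMangoldt U n := fun n => by
    simp only [lowPart, coe_mk]
    split_ifs
    · exact vonMangoldt_nonneg
    · exact le_rfl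
  have hΛU1 : ∀ n, lowPart vonMangoldt U n ≤ vonMangoldt n := fun n => by
    simp only [lowPart, coe_mk]
    split_ifs
    · exact le_rfl
    · exact vonMangoldt_nonneg
  have p1 : ‖twist α (lowPart vonMangoldt U) y‖ ≤ U * ℓ := by
    have h1 : ∀ n ∈ Finset.Ioc 0 y, ‖((lowPart vonMangoldt U n : ℝ) : ℂ) * ex (α * n)‖ ≤
        if n ≤ U then ℓ else 0 := by
      intro n hn
      rw [norm_mul, norm_ex, mul_one, Complex.norm_real, Real.norm_of_nonneg (hΛU0 n)]
      simp only [lowPart, coe_mk]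
      split_ifs
      · exact vonMangoldt_le_log.trans (hlog n ((Finset.mem_Ioc.1 hn).2.trans hy))
      · exact le_rfl
    refine (norm_sum_le_of_le _ h1).trans ?_
    rw [← Finset.sum_filter, Finset.sum_const, nsmul_eq_mul]
    refine mul_le_mul_of_nonneg_right ?_ (by linarith)
    have : (Finset.Ioc 0 y).filter (· ≤ U) ⊆ Finset.Ioc 0 U := by
      intro m hm
      simp only [Finset.mem_filter, Finset.mem_Ioc] at hm ⊢
      omega
    simpa using Finset.card_le_card this
  have p2 : ‖twist α (lowPart (moebius : ArithmeticFunction ℝ) U * log) y‖ ≤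
      U * (1 * (2 * ℓ * q)) := by
    refine norm_twist_mul_le α _ _ y U zero_le_one (by positivity) ?_ (fun m _ => hμU m) ?_
    · intro m hm
      simp [lowPart, not_le.2 hm]
    · intro m hm hmU z hz
      have h1 := norm_sum_mul_le_of_monotone (f := fun n => Real.log n) (fun i j hij => by
          rcases Nat.eq_zero_or_pos i with rfl | hi
          · simpa using Real.log_natCast_nonneg j
          · exact Real.log_le_log (by exact_mod_cast hi) (by exact_mod_cast hij)) (by simp)
        (fun n => ex (α * (m * n : ℕ))) z (P := q)
        (fun k _ => h.norm_sum_ex_le hm (by omega) k)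
      refine (h1.trans ?_)
      have := hlog z (hz.trans hy)
      gcongr
  have p3 : ‖twist α (lowPart (moebius : ArithmeticFunction ℝ) U * lowPart vonMangoldt U *
      (zeta : ArithmeticFunction ℝ)) y‖ ≤ (U ^ 2 : ℕ) * (ℓ * q) := by
    refine norm_twist_mul_le α _ _ y (U ^ 2) (by linarith) (by positivity) ?_ ?_ ?_
    · intro m hm
      rw [mul_apply]
      refine Finset.sum_eq_zero fun p hp => ?_
      obtain ⟨hp1, _⟩ := Nat.mem_divisorsAntidiagonal.1 hp
      simp only [lowPart, coe_mk]
      by_cases c1 : p.1 ≤ U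
      · by_cases c2 : p.2 ≤ U
        · have := Nat.mul_le_mul c1 c2
          rw [hp1, ← sq] at this
          omega
        · simp [c2]
      · simp [c1]
    · intro m hm
      rw [mul_apply]
      refine (Finset.abs_sum_le_sum_abs _ _).trans ?_
      have h1 : ∀ p ∈ m.divisorsAntidiagonal,
          |lowPart (moebius : ArithmeticFunction ℝ) U p.1 * lowPart vonMangoldt U p.2| ≤
            vonMangoldt p.2 * (zeta : ArithmeticFunction ℝ) p.1 := by
        intro p hp
        have hp0 := Nat.mem_divisorsAntidiagonal.1 hp
        have : p.1 ≠ 0 := fun h => by simp [h] at hp0; omega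
        rw [abs_mul, abs_of_nonneg (hΛU0 _), natCoe_apply, zeta_apply, if_neg this, Nat.cast_one,
          mul_one]
        exact (mul_le_of_le_one_left (hΛU0 _) (hμU _)).trans (hΛU1 _)
      refine (Finset.sum_le_sum h1).trans ?_
      have h2 : ∑ p ∈ m.divisorsAntidiagonal, vonMangoldt p.2 * (zeta : ArithmeticFunction ℝ) p.1 =
          Real.log m := by
        rw [← log_apply, ← zeta_mul_vonMangoldt, mul_apply]
        exact Finset.sum_congr rfl fun _ _ => mul_comm _ _
      rw [h2]
      exact hlog m (by omega)
    · intro m hm hmU z hz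
      have h1 : ∑ n ∈ Finset.Ioc 0 z, (((zeta : ArithmeticFunction ℝ) n : ℝ) : ℂ) *
          ex (α * (m * n : ℕ)) = ∑ n ∈ Finset.Ioc 0 z, ex (α * (m * n : ℕ)) := by
        refine Finset.sum_congr rfl fun n hn => ?_
        have : n ≠ 0 := by
          have := (Finset.mem_Ioc.1 hn).1
          omega
        simp [natCoe_apply, zeta_apply, this]
      rw [h1]
      exact h.norm_sum_ex_le hm (by omega) z
  -- The type II piece: both factors vanish up to U. The second is bounded by the logarithm since 0
  -- ≤ Λ - Λ_U ≤ Λ and Λ * 1 = log.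
  have p4 : ‖twist α (((moebius : ArithmeticFunction ℝ) -
      lowPart (moebius : ArithmeticFunction ℝ) U) *
        ((vonMangoldt - lowPart vonMangoldt U) * (zeta : ArithmeticFunction ℝ))) y‖ ≤
      7 * (X : ℝ) * ℓ ^ 3 / √U := by
    set c := (moebius : ArithmeticFunction ℝ) - lowPart (moebius : ArithmeticFunction ℝ) U with hc
    set b := (vonMangoldt - lowPart vonMangoldt U) * (zeta : ArithmeticFunction ℝ) with hb
    have hc0 : ∀ m ≤ U, c m = 0 := fun m hm => by
      rw [hc, sub_eq_add_neg, ArithmeticFunction.add_apply, ArithmeticFunction.neg_apply]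
      simp [lowPart, hm]
    have hc1 : ∀ m, |c m| ≤ 1 := fun m => by
      rw [hc, sub_eq_add_neg, ArithmeticFunction.add_apply, ArithmeticFunction.neg_apply]
      simp only [lowPart, coe_mk]
      split_ifs
      · simp
      · simpa using hμ m
    have hd0 : ∀ n, 0 ≤ (vonMangoldt - lowPart vonMangoldt U) n := fun n => by
      rw [sub_eq_add_neg, ArithmeticFunction.add_apply, ArithmeticFunction.neg_apply]
      linarith [hΛU1 n]
    have hd1 : ∀ n, (vonMangoldt - lowPart vonMangoldt U) n ≤ vonMangoldt n := fun n => by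
      rw [sub_eq_add_neg, ArithmeticFunction.add_apply, ArithmeticFunction.neg_apply]
      linarith [hΛU0 n]
    have hd2 : ∀ n ≤ U, (vonMangoldt - lowPart vonMangoldt U) n = 0 := fun n hn => by
      rw [sub_eq_add_neg, ArithmeticFunction.add_apply, ArithmeticFunction.neg_apply]
      simp [lowPart, hn]
    have hζ : ∀ n, 0 ≤ (zeta : ArithmeticFunction ℝ) n := fun n => by
      rw [natCoe_apply]
      positivity
    have hb0 : ∀ n, 0 ≤ b n := fun n => by
      rw [hb, mul_apply]
      exact Finset.sum_nonneg fun p _ => mul_nonneg (hd0 _) (hζ _)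
    have hb1 : ∀ n, b n ≤ Real.log n := fun n => by
      rw [← log_apply, ← vonMangoldt_mul_zeta, hb, mul_apply, mul_apply]
      exact Finset.sum_le_sum fun p _ => mul_le_mul_of_nonneg_right (hd1 _) (hζ _)
    have hb2 : ∀ n ≤ U, b n = 0 := fun n hn => by
      rw [hb, mul_apply]
      refine Finset.sum_eq_zero fun p hp => ?_
      obtain ⟨hp1, hp2⟩ := Nat.mem_divisorsAntidiagonal.1 hp
      rw [hd2, zero_mul]
      refine le_trans (Nat.le_of_dvd (Nat.pos_of_ne_zero hp2) ⟨p.2, hp1.symm⟩) hn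
    have h1 : twist α (c * b) y = ∑ m ∈ Finset.Ioc U y, (c m : ℂ) * innerSum α b U y m := by
      have h2 : ∀ m, ∑ n ∈ Finset.Ioc 0 (y / m), (b n : ℂ) * ex (α * (m * n : ℕ)) =
          innerSum α b U y m := by
        intro m
        rw [innerSum, ← sum_Ioc_ite (fun n => (b n : ℂ) * ex (α * (m * n : ℕ))) U]
        refine Finset.sum_congr rfl fun n _ => ?_
        split_ifs with hn
        · rfl
        · rw [hb2 n (not_lt.1 hn)]
          simp
      rw [twist_mul, ← sum_Ioc_ite (fun m => (c m : ℂ) * innerSum α b U y m) U]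
      refine Finset.sum_congr rfl fun m _ => ?_
      split_ifs with hm
      · rw [h2]
      · rw [hc0 m (not_lt.1 hm)]
        simp
    rw [h1]
    refine h.norm_bilinear_le hU (by omega) hqU hy _ _ hc1 fun n hn => ?_
    rw [abs_of_nonneg (hb0 n)]
    exact (hb1 n).trans (hlog n hn)
  have key : twist α vonMangoldt y = twist α (lowPart vonMangoldt U) y +
      twist α (lowPart (moebius : ArithmeticFunction ℝ) U * log) y -
      twist α (lowPart (moebius : ArithmeticFunction ℝ) U * lowPart vonMangoldt U *
        (zeta : ArithmeticFunction ℝ)) y +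
      twist α (((moebius : ArithmeticFunction ℝ) - lowPart (moebius : ArithmeticFunction ℝ) U) *
        ((vonMangoldt - lowPart vonMangoldt U) * (zeta : ArithmeticFunction ℝ))) y := by
    rw [← twist_add, ← twist_sub, ← twist_add, ← vaughan_identity]
  rw [key]
  have hsq : √(U : ℝ) ≤ U := Real.sqrt_le_iff.2 ⟨hU'.le, by nlinarith⟩
  have hsq0 : 0 < √(U : ℝ) := Real.sqrt_pos.2 hU'
  have hmain : (q : ℝ) * U ^ 2 ≤ X / √U := by
    rw [le_div_iff₀ hsq0]
    calc (q : ℝ) * U ^ 2 * √U ≤ (q : ℝ) * U ^ 2 * U := by gcongr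
      _ = (q : ℝ) * U ^ 3 := by ring
      _ ≤ (q : ℝ) * U ^ 4 := by gcongr; norm_num
      _ ≤ X := by exact_mod_cast hqX
  have hq1 : (1 : ℝ) ≤ q := by
    have := h.two_le
    exact_mod_cast (by omega : 1 ≤ q)
  have hl3 : ℓ ≤ ℓ ^ 3 := le_self_pow₀ hl1 (by norm_num)
  have b0 : (q : ℝ) * U ^ 2 * ℓ ≤ X / √U * ℓ ^ 3 := by gcongr
  have b1 : U * ℓ ≤ (q : ℝ) * U ^ 2 * ℓ := by
    have : (U : ℝ) ≤ q * U ^ 2 := by nlinarith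
    gcongr
  have b2 : U * (1 * (2 * ℓ * q)) ≤ 2 * ((q : ℝ) * U ^ 2 * ℓ) := by
    have : (U : ℝ) ≤ U ^ 2 := by nlinarith
    calc U * (1 * (2 * ℓ * q)) = 2 * (q * U * ℓ) := by ring
      _ ≤ _ := by gcongr
  have b3 : ((U ^ 2 : ℕ) : ℝ) * (ℓ * q) = (q : ℝ) * U ^ 2 * ℓ := by push_cast; ring
  have b4 : 11 * (X : ℝ) * ℓ ^ 3 / √U = 4 * (X / √U * ℓ ^ 3) + 7 * (X : ℝ) * ℓ ^ 3 / √U := by ring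
  rw [b4]
  refine (norm_add_le _ _).trans (add_le_add ?_ p4)
  refine (norm_sub_le _ _).trans ?_
  have := norm_add_le (twist α (lowPart vonMangoldt U) y)
    (twist α (lowPart (moebius : ArithmeticFunction ℝ) U * log) y)
  linarith

/-! ### Exponential sums with multiples of the golden ratio -/

open Real in
-- The product is the norm of a nonzero element of Z[φ], hence a nonzero integer.
theorem one_le_abs_norm_form {m a : ℤ} (h : m ≠ 0 ∨ a ≠ 0) :
    1 ≤ |(m * goldenRatio + a) * (m * goldenConj + a)| := by
  have h1 : (m * goldenRatio + a) * (m * goldenConj + a) = ((a ^ 2 + m * a - m ^ 2 : ℤ) : ℝ) := by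
    have e1 := goldenRatio_mul_goldenConj
    have e2 := goldenRatio_add_goldenConj
    push_cast
    linear_combination (m : ℝ) ^ 2 * e1 + m * a * e2
  have h2 : (m * goldenRatio + a) * (m * goldenConj + a) ≠ 0 := by
    by_cases hm : m = 0
    · have ha : a ≠ 0 := by tauto
      simp [hm, ha]
    · refine mul_ne_zero (fun h0 => ?_) (fun h0 => ?_)
      · refine (goldenRatio_irrational.intCast_mul hm).ne_int (-a) ?_
        push_cast
        linarith
      · refine (goldenConj_irrational.intCast_mul hm).ne_int (-a) ?_
        push_cast
        linarith
  rw [h1] at h2 ⊢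
  have : (1 : ℤ) ≤ |a ^ 2 + m * a - m ^ 2| := Int.one_le_abs (by exact_mod_cast h2)
  exact_mod_cast this

theorem sqrt_five_lt : √(5 : ℝ) < 9 / 4 := by
  rw [Real.sqrt_lt' (by norm_num)]
  norm_num

theorem lt_sqrt_five : 22 / 10 < √(5 : ℝ) := by
  rw [Real.lt_sqrt (by norm_num)]
  norm_num

open Real in
-- Bad approximability of φ: if mφ is near an integer a, then |mφ - a| times the conjugate factor is
-- at least 1, and the conjugate factor is at most 1/2 + √5|m| ≤ 4|m|.
theorem one_div_le_nd_mul_goldenRatio {m : ℤ} (hm : m ≠ 0) :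
    1 / (4 * |(m : ℝ)|) ≤ nd (m * goldenRatio) := by
  have hm1 : (1 : ℝ) ≤ |(m : ℝ)| := by exact_mod_cast Int.one_le_abs hm
  have h1 := one_le_abs_norm_form (m := m) (a := -round (m * goldenRatio)) (Or.inl hm)
  rw [abs_mul] at h1
  push_cast at h1
  rw [← sub_eq_add_neg, ← sub_eq_add_neg] at h1
  have h2 : |m * goldenConj - round (m * goldenRatio)| ≤
      nd (m * goldenRatio) + √5 * |(m : ℝ)| := by
    have e : m * goldenConj - round (m * goldenRatio) =
        (m * goldenRatio - round (m * goldenRatio)) - √5 * m := by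
      rw [← goldenRatio_sub_goldenConj]
      ring
    rw [e, nd, ← abs_of_nonneg (Real.sqrt_nonneg 5), ← abs_mul, abs_of_nonneg (Real.sqrt_nonneg 5)]
    exact abs_sub _ _
  have h3 := nd_le_half (m * goldenRatio)
  have h4 := sqrt_five_lt
  change 1 ≤ nd (m * goldenRatio) * _ at h1
  rw [div_le_iff₀ (by positivity)]
  have h5 : |m * goldenConj - round (m * goldenRatio)| ≤ 4 * |(m : ℝ)| := by nlinarith
  exact h1.trans (mul_le_mul_of_nonneg_left h5 (nd_nonneg _))

open Real in
-- Dirichlet's theorem with denominators up to X/U⁴ gives qU⁴ ≤ X. Bad approximability of φ, applied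
-- to the multiple qh, forces 4q|h| > X/U⁴ ≥ 8|h|U⁴ and hence the lower bound for q.
theorem exists_isApprox_mul_goldenRatio {h : ℤ} (hh : h ≠ 0) {U X : ℕ} (hU : 0 < U)
    (hX : 8 * |h| * U ^ 8 ≤ X) :
    ∃ (a : ℤ) (q : ℕ), IsApprox (h * goldenRatio) a q ∧ 2 * U ^ 4 ≤ q ∧ q * U ^ 4 ≤ X := by
  have hh1 : (1 : ℝ) ≤ |(h : ℝ)| := by exact_mod_cast Int.one_le_abs hh
  have hU1 : (1 : ℝ) ≤ U := by exact_mod_cast hU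
  have hXr : 8 * |(h : ℝ)| * (U : ℝ) ^ 8 ≤ X := by exact_mod_cast hX
  have hU4 : 0 < U ^ 4 := by positivity
  have hQ : 0 < X / U ^ 4 := by
    refine Nat.div_pos ?_ hU4
    have h8 : (U : ℝ) ^ 4 ≤ (U : ℝ) ^ 8 := pow_le_pow_right₀ hU1 (by norm_num)
    have h9 : (0 : ℝ) ≤ (U : ℝ) ^ 8 := by positivity
    have : (U : ℝ) ^ 4 ≤ X := by nlinarith
    exact_mod_cast this
  obtain ⟨r, hr1, hr2⟩ := Real.exists_rat_abs_sub_le_and_den_le (h * goldenRatio) hQ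
  have hq0 : (0 : ℝ) < r.den := by exact_mod_cast r.den_pos
  have hQr : (r.den : ℝ) ≤ (X / U ^ 4 : ℕ) := by exact_mod_cast hr2
  have hlt : (X : ℝ) < ((X / U ^ 4 : ℕ) + 1) * (U : ℝ) ^ 4 := by
    have := Nat.lt_mul_div_succ X hU4
    rw [mul_comm] at this
    exact_mod_cast this
  have hrdef : (r : ℝ) = r.num / r.den := by exact_mod_cast (Rat.num_div_den r).symm
  rw [hrdef] at hr1
  have hm : (r.den : ℤ) * h ≠ 0 := mul_ne_zero (by exact_mod_cast r.den_nz) hh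
  have h1 := one_div_le_nd_mul_goldenRatio hm
  have h2 : nd (((r.den : ℤ) * h : ℤ) * goldenRatio) ≤ 1 / ((X / U ^ 4 : ℕ) + 1) := by
    refine (nd_le _ r.num).trans ?_
    have e : (((r.den : ℤ) * h : ℤ) : ℝ) * goldenRatio - r.num =
        r.den * (h * goldenRatio - r.num / r.den) := by
      push_cast
      field_simp
    rw [e, abs_mul, abs_of_pos hq0]
    calc (r.den : ℝ) * |h * goldenRatio - r.num / r.den|
        ≤ r.den * (1 / (((X / U ^ 4 : ℕ) + 1) * r.den)) := by gcongr
      _ = _ := by field_simp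
  have h3 : 2 * (U : ℝ) ^ 4 ≤ r.den := by
    have h4 := h1.trans h2
    push_cast at h4
    rw [abs_mul, abs_of_pos hq0, div_le_div_iff₀ (by positivity) (by positivity)] at h4
    by_contra hcon
    rw [not_le] at hcon
    have h5 : ((X / U ^ 4 : ℕ) + 1 : ℝ) * (U : ℝ) ^ 4 ≤ 4 * (r.den * |(h : ℝ)|) * (U : ℝ) ^ 4 := by
      have := mul_le_mul_of_nonneg_right h4 (show 0 ≤ (U : ℝ) ^ 4 by positivity)
      linarith
    have h6 : 4 * (r.den * |(h : ℝ)|) * (U : ℝ) ^ 4 ≤ 4 * (2 * (U : ℝ) ^ 4 * |(h : ℝ)|) * (U : ℝ) ^ 4 := by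
      gcongr
    nlinarith
  have h3' : 2 * U ^ 4 ≤ r.den := by exact_mod_cast h3
  refine ⟨r.num, r.den, ⟨?_, ?_, ?_⟩, h3', ?_⟩
  · have : 0 < U ^ 4 := hU4
    omega
  · exact Int.isCoprime_iff_gcd_eq_one.2 (by
      rw [Int.gcd, Int.natAbs_natCast]
      exact r.reduced)
  · refine hr1.trans ?_
    rw [sq]
    gcongr
    linarith
  · exact (Nat.mul_le_mul_right _ hr2).trans (Nat.div_mul_le_self _ _)

open ArithmeticFunction in
-- Proper prime powers cost at most ψ(k) - θ(k).
theorem norm_sum_log_prime_mul_ex_le (α : ℝ) (k : ℕ) :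
    ‖∑ n ∈ Finset.Ioc 0 k, (if n.Prime then (Real.log n : ℂ) * ex (α * n) else 0)‖ ≤
      ‖twist α vonMangoldt k‖ + 2 * √k * Real.log k := by
  rcases Nat.eq_zero_or_pos k with rfl | hk
  · simp
  have h1 : ‖twist α vonMangoldt k -
      ∑ n ∈ Finset.Ioc 0 k, (if n.Prime then (Real.log n : ℂ) * ex (α * n) else 0)‖ ≤
      2 * √k * Real.log k := by
    have h2 := Chebyshev.psi_sub_theta_le (x := k) (by exact_mod_cast hk)
    refine le_trans ?_ h2
    rw [Chebyshev.psi, Chebyshev.theta, Nat.floor_natCast, Finset.sum_filter,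
      ← Finset.sum_sub_distrib, twist, ← Finset.sum_sub_distrib]
    refine norm_sum_le_of_le _ fun n _ => ?_
    split_ifs with hn
    · rw [vonMangoldt_apply_prime hn]
      simp
    · rw [sub_zero, sub_zero, norm_mul, norm_ex, mul_one, Complex.norm_real,
        Real.norm_of_nonneg vonMangoldt_nonneg]
  have h3 := norm_sub_norm_le (∑ n ∈ Finset.Ioc 0 k,
    (if n.Prime then (Real.log n : ℂ) * ex (α * n) else 0)) (twist α vonMangoldt k)
  rw [norm_sub_rev] at h3
  linarith

open Real in
-- The von Mangoldt bound (11) plus prime powers (2) gives 13; removing the logarithmic weight by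
-- partial summation costs 1/log 2 ≤ 2.
theorem norm_sum_primesUpTo_ex_le {h : ℤ} (hh : h ≠ 0) {U : ℕ} {x : ℝ} (hU : 0 < U)
    (hX : 8 * |h| * U ^ 8 ≤ ⌊x⌋₊) :
    ‖∑ p ∈ primesUpTo x, ex (h * goldenRatio * p)‖ ≤
      26 * (⌊x⌋₊ : ℝ) * (1 + Real.log ⌊x⌋₊) ^ 3 / √U := by
  obtain ⟨a, q, hα, hq1, hq2⟩ := exists_isApprox_mul_goldenRatio hh hU hX
  set X := ⌊x⌋₊
  set α : ℝ := h * goldenRatio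
  have hU1 : (1 : ℝ) ≤ U := by exact_mod_cast hU
  have hUX : (U : ℝ) ≤ X := by
    have h1 : U ≤ U ^ 4 := Nat.le_self_pow (by norm_num) U
    have h2 : 1 ≤ q := by have := hα.two_le; omega
    have : U ≤ X := by nlinarith
    exact_mod_cast this
  have hsU : 0 < √(U : ℝ) := Real.sqrt_pos.2 (by linarith)
  set ℓ : ℝ := 1 + Real.log X with hl
  have hl0 : 1 ≤ ℓ := by
    have := Real.log_natCast_nonneg X
    linarith
  have hP : ∀ k ≤ X, ‖∑ n ∈ Finset.Ioc 0 k,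
      (if n.Prime then (Real.log n : ℂ) * ex (α * n) else 0)‖ ≤ 13 * (X : ℝ) * ℓ ^ 3 / √U := by
    intro k hk
    refine (norm_sum_log_prime_mul_ex_le α k).trans ?_
    have h1 := hα.norm_twist_vonMangoldt_le hU hq1 hq2 hk
    have h2 : 2 * √(k : ℝ) * Real.log k ≤ 2 * (X : ℝ) * ℓ ^ 3 / √U := by
      rw [le_div_iff₀ hsU]
      have h3 : Real.log k ≤ ℓ ^ 3 := by
        refine le_trans ?_ (le_self_pow₀ hl0 (by norm_num))
        rcases Nat.eq_zero_or_pos k with rfl | hk0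
        · simp only [Nat.cast_zero, Real.log_zero]
          linarith
        · have := Real.log_le_log (by exact_mod_cast hk0) (by exact_mod_cast hk : (k : ℝ) ≤ X)
          linarith
      have h4 : √(k : ℝ) * √U ≤ X := by
        calc √(k : ℝ) * √U ≤ √X * √X := by gcongr
          _ = X := Real.mul_self_sqrt (Nat.cast_nonneg _)
      have h5 := Real.log_natCast_nonneg k
      calc 2 * √(k : ℝ) * Real.log k * √U = 2 * (√(k : ℝ) * √U) * Real.log k := by ring
        _ ≤ 2 * X * ℓ ^ 3 := by gcongr
    have e : 13 * (X : ℝ) * ℓ ^ 3 / √U = 11 * (X : ℝ) * ℓ ^ 3 / √U + 2 * (X : ℝ) * ℓ ^ 3 / √U := by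
      ring
    rw [e]
    exact add_le_add h1 h2
  -- The maximum with 2 keeps the weight positive and antitone at n = 0, 1 without changing it at
  -- primes.
  have h1 := norm_sum_mul_le_of_antitone (f := fun n : ℕ => 1 / Real.log (max n 2 : ℕ))
    (fun i j hij => by
      have h2 : Real.log ((max i 2 : ℕ) : ℝ) ≤ Real.log ((max j 2 : ℕ) : ℝ) :=
        Real.log_le_log (by positivity) (by exact_mod_cast max_le_max_right 2 hij)
      exact one_div_le_one_div_of_le (Real.log_pos (by
        exact_mod_cast lt_of_lt_of_le one_lt_two (le_max_right i 2))) h2)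
    (fun n => by
      have := Real.log_natCast_nonneg (max n 2)
      positivity) _ X hP
  have h2 : ∑ p ∈ primesUpTo x, ex (α * p) = ∑ n ∈ Finset.Ioc 0 X,
      ((1 / Real.log (max n 2 : ℕ) : ℝ) : ℂ) *
        (if n.Prime then (Real.log n : ℂ) * ex (α * n) else 0) := by
    have e1 : primesUpTo x = (Finset.Ioc 0 X).filter Nat.Prime := by
      ext n
      simp only [primesUpTo, Finset.mem_filter, Finset.mem_range, Finset.mem_Ioc]
      constructor
      · rintro ⟨h1, h2⟩
        exact ⟨⟨h2.pos, by omega⟩, h2⟩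
      · rintro ⟨⟨_, h1⟩, h2⟩
        exact ⟨by omega, h2⟩
    rw [e1, Finset.sum_filter]
    refine Finset.sum_congr rfl fun n _ => ?_
    split_ifs with hn
    · rw [max_eq_left hn.two_le, ← mul_assoc]
      have : Real.log n ≠ 0 := (Real.log_pos (by exact_mod_cast hn.one_lt)).ne'
      push_cast
      rw [one_div, inv_mul_cancel₀ (by exact_mod_cast this), one_mul]
    · simp
  rw [h2]
  refine h1.trans ?_
  have h3 : 1 / Real.log ((max 0 2 : ℕ) : ℝ) ≤ 2 := by
    have := Real.log_two_gt_d9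
    rw [div_le_iff₀ (by simpa using Real.log_pos (one_lt_two))]
    norm_num
    linarith
  calc 1 / Real.log ((max 0 2 : ℕ) : ℝ) * (13 * (X : ℝ) * ℓ ^ 3 / √U)
      ≤ 2 * (13 * (X : ℝ) * ℓ ^ 3 / √U) := by gcongr
    _ = _ := by ring

open Real in
theorem norm_sum_range_ex_le {h : ℤ} (hh : h ≠ 0) (M : ℕ) :
    ‖∑ n ∈ Finset.range M, ex (h * goldenRatio * n)‖ ≤ 2 * |(h : ℝ)| := by
  have h0 : (0 : ℝ) < |(h : ℝ)| := abs_pos.2 (by exact_mod_cast hh)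
  have h1 := norm_sum_ex_mul_nd_le (h * goldenRatio) 0 M
  have h2 := one_div_le_nd_mul_goldenRatio hh
  have h3 : ‖∑ n ∈ Finset.range M, ex (h * goldenRatio * n)‖ =
      ‖∑ m ∈ Finset.Ioc 0 M, ex (m * (h * goldenRatio))‖ := by
    have e : ∑ m ∈ Finset.Ioc 0 M, ex (m * (h * goldenRatio)) =
        ex (h * goldenRatio) * ∑ n ∈ Finset.range M, ex (h * goldenRatio * n) := by
      rw [Finset.mul_sum, Finset.range_eq_Ico, ← Finset.Ico_add_one_add_one_eq_Ioc,
        ← Finset.sum_Ico_add']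
      refine Finset.sum_congr rfl fun n _ => ?_
      rw [← ex_add]
      congr 1
      push_cast
      ring
    rw [e, norm_mul, norm_ex, one_mul]
  rw [h3]
  set S := ‖∑ m ∈ Finset.Ioc 0 M, ex (m * (h * goldenRatio))‖
  have h4 : S * (2 * (1 / (4 * |(h : ℝ)|))) ≤ 1 :=
    le_trans (mul_le_mul_of_nonneg_left (by linarith) (norm_nonneg _)) h1
  have h5 : S * (2 * (1 / (4 * |(h : ℝ)|))) = S / (2 * |(h : ℝ)|) := by field_simp; norm_num
  rw [h5, div_le_one (by positivity)] at h4
  exact h4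

/-! ### Zeckendorf digits -/

/-- The bound by F_J, not F_(J+1), is the gap condition: no index J can follow the leading index J +
1. -/
theorem zeckendorf_fib_add {J n : ℕ} (h : n < Nat.fib J) :
    Nat.zeckendorf (Nat.fib (J + 1) + n) = (J + 1) :: Nat.zeckendorf n := by
  have hJ : 0 < Nat.fib (J + 1) := Nat.fib_pos.2 (Nat.succ_pos _)
  have h1 : Nat.greatestFib (Nat.fib (J + 1) + n) = J + 1 := by
    refine le_antisymm (Nat.lt_succ_iff.1 (Nat.greatestFib_lt.2 ?_))
      (Nat.le_greatestFib.2 (Nat.le_add_right _ _))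
    have : Nat.fib (J + 2) = Nat.fib J + Nat.fib (J + 1) := Nat.fib_add_two
    change _ < Nat.fib (J + 2)
    omega
  rw [Nat.zeckendorf_of_pos (by omega), h1, Nat.add_sub_cancel_left]

theorem digit_zero_right (k : ℕ) : digit k 0 = 0 := by simp [digit]

theorem digit_eq_zero_or_one (k n : ℕ) : digit k n = 0 ∨ digit k n = 1 := by
  rw [digit]
  split_ifs <;> simp

theorem digit_fib_add_self {J n : ℕ} (h : n < Nat.fib J) : digit (J + 1) (Nat.fib (J + 1) + n) = 1 := by
  rw [digit, zeckendorf_fib_add h]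
  simp

theorem digit_fib_add_of_ne {J n k : ℕ} (h : n < Nat.fib J) (hk : k ≠ J + 1) :
    digit k (Nat.fib (J + 1) + n) = digit k n := by
  rw [digit, digit, zeckendorf_fib_add h]
  simp [hk]

theorem lt_fib_add_two {J n : ℕ} (h : n < Nat.fib (J + 2)) :
    n < Nat.fib (J + 1) ∨ ∃ m < Nat.fib J, n = Nat.fib (J + 1) + m := by
  rcases lt_or_ge n (Nat.fib (J + 1)) with h1 | h1
  · exact Or.inl h1
  · refine Or.inr ⟨n - Nat.fib (J + 1), ?_, by omega⟩
    have : Nat.fib (J + 2) = Nat.fib J + Nat.fib (J + 1) := Nat.fib_add_two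
    omega

/-- Induction along the leading Fibonacci numbers. -/
theorem fib_induction {Q : ℕ → ℕ → Prop} (h0 : ∀ J, Q J 0)
    (h1 : ∀ J n, n < Nat.fib (J + 1) → Q (J + 1) n → Q (J + 2) n)
    (h2 : ∀ J m, m < Nat.fib J → Q J m → Q (J + 2) (Nat.fib (J + 1) + m)) :
    ∀ J n, n < Nat.fib J → Q J n := by
  intro J
  induction J using Nat.strong_induction_on with
  | _ J ih =>
    intro n hn
    match J, ih, hn with
    | 0, _, hn => simp at hn
    | 1, _, hn =>
      obtain rfl : n = 0 := by simpa using hn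
      exact h0 1
    | J + 2, ih, hn =>
      rcases lt_fib_add_two hn with h | ⟨m, hm, rfl⟩
      · exact h1 J n h (ih (J + 1) (by omega) n h)
      · exact h2 J m hm (ih J (by omega) m hm)

theorem digit_eq_zero_of_lt {J n : ℕ} (h : n < Nat.fib J) {k : ℕ} (hk : J ≤ k) : digit k n = 0 := by
  revert k
  refine fib_induction (Q := fun J n => ∀ {k : ℕ}, J ≤ k → digit k n = 0) ?_ ?_ ?_ J n h
  · intro J k _
    exact digit_zero_right k
  · intro J n _ ih k hk
    exact ih (by omega)
  · intro J m hm ih k hk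
    rw [digit_fib_add_of_ne hm (by omega)]
    exact ih (by omega)

theorem sum_digit_mul_fib {J n : ℕ} (h : n < Nat.fib J) :
    ∑ k ∈ Finset.range J, digit k n * Nat.fib k = n := by
  refine fib_induction (Q := fun J n => ∑ k ∈ Finset.range J, digit k n * Nat.fib k = n)
    ?_ ?_ ?_ J n h
  · intro J
    simp [digit_zero_right]
  · intro J n hn ih
    rw [Finset.sum_range_succ, ih, digit_eq_zero_of_lt hn le_rfl]
    simp
  · intro J m hm ih
    rw [Finset.sum_range_succ, Finset.sum_range_succ, digit_fib_add_self hm,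
      digit_fib_add_of_ne hm (by omega), digit_eq_zero_of_lt hm le_rfl, zero_mul, add_zero, one_mul,
      add_comm]
    congr 1
    refine (Finset.sum_congr rfl fun k hk => ?_).trans ih
    rw [digit_fib_add_of_ne hm]
    have := Finset.mem_range.1 hk
    omega

theorem lt_fib_self_add_two (n : ℕ) : n < Nat.fib (n + 2) := by
  have := Nat.le_fib_add_one (n + 2)
  omega

theorem digit_eq_zero_of_succ {k n : ℕ} (h : digit (k + 1) n = 1) : digit k n = 0 := by
  revert k
  refine fib_induction (Q := fun _ n => ∀ {k : ℕ}, digit (k + 1) n = 1 → digit k n = 0)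
    ?_ ?_ ?_ (n + 2) n (lt_fib_self_add_two n)
  · intro J k _
    exact digit_zero_right k
  · intro J n _ ih k
    exact ih
  · intro J m hm ih k hk
    by_cases h1 : k = J + 1
    · subst h1
      rw [digit_fib_add_of_ne hm (by omega), digit_eq_zero_of_lt hm (by omega)] at hk
      omega
    · rw [digit_fib_add_of_ne hm h1]
      by_cases h2 : k + 1 = J + 1
      · exact digit_eq_zero_of_lt hm (by omega)
      · rw [digit_fib_add_of_ne hm h2] at hk
        exact ih hk

theorem digit_eq_zero_succ {k n : ℕ} (h : digit k n = 1) : digit (k + 1) n = 0 := by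
  rcases digit_eq_zero_or_one (k + 1) n with h1 | h1
  · exact h1
  · rw [digit_eq_zero_of_succ h1] at h
    omega

/-! ### Low and high parts of an expansion, and the planar region that encodes a digit -/

open Real

theorem goldenRatio_bounds : 1618 / 1000 < goldenRatio ∧ goldenRatio < 16181 / 10000 := by
  rw [goldenRatio]
  constructor
  · have : 2236 / 1000 < √(5 : ℝ) := by
      rw [Real.lt_sqrt (by norm_num)]
      norm_num
    linarith
  · have : √(5 : ℝ) < 22362 / 10000 := by
      rw [Real.sqrt_lt' (by norm_num)]
      norm_num
    linarith

theorem goldenConj_eq : goldenConj = 1 - goldenRatio := by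
  rw [← goldenRatio_add_goldenConj]
  ring

theorem sqrt_five_eq : √(5 : ℝ) = 2 * goldenRatio - 1 := by
  rw [← goldenRatio_sub_goldenConj, goldenConj_eq]
  ring

/-- The part below the position `k`, scaled to `[0, 1)`. -/
def lowFrac (n : ℕ) : ℕ → ℝ
  | 0 => 0
  | k + 1 => (lowFrac n k + digit k n) / goldenRatio

/-- The sum `∑ δ_{k + j}(n) β ^ j`. -/
def highSum (β : ℝ) (n k : ℕ) : ℝ := ∑ j ∈ Finset.range (n + 2), (digit (k + j) n : ℝ) * β ^ j

theorem lowFrac_nonneg (n k : ℕ) : 0 ≤ lowFrac n k := by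
  induction k with
  | zero => exact le_rfl
  | succ k ih =>
    have := goldenRatio_pos
    rw [lowFrac]
    positivity

/-- A digit 1 at position k forces a 0 just below it, which shortens the range of the low part from
1 to 1/φ = -φ̄. The two claims are proved together because each feeds the other. -/
theorem lowFrac_lt (n k : ℕ) : lowFrac n k < 1 ∧ (digit k n = 1 → lowFrac n k < -goldenConj) := by
  obtain ⟨g1, g2⟩ := goldenRatio_bounds
  have hg := goldenConj_eq
  have hsq := goldenRatio_sq
  have hpos := goldenRatio_pos
  induction k with
  | zero =>
    rw [lowFrac]
    exact ⟨one_pos, fun _ => by linarith⟩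
  | succ k ih =>
    have h0 := ih.1
    rw [lowFrac, div_lt_one hpos, div_lt_iff₀ hpos, hg]
    rcases digit_eq_zero_or_one k n with h | h
    · rw [h]
      push_cast
      refine ⟨by linarith, fun _ => by nlinarith⟩
    · have h1 := ih.2 h
      rw [h]
      push_cast
      refine ⟨by linarith, fun h2 => ?_⟩
      rw [digit_eq_zero_of_succ h2] at h
      omega

theorem lowFrac_congr {n m k : ℕ} (h : ∀ j < k, digit j n = digit j m) :
    lowFrac n k = lowFrac m k := by
  induction k with
  | zero => rfl
  | succ k ih =>
    rw [lowFrac, lowFrac, ih fun j hj => h j (by omega), h k (by omega)]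

theorem highSum_eq (β : ℝ) (n k : ℕ) : highSum β n k = digit k n + β * highSum β n (k + 1) := by
  have h1 : highSum β n k = ∑ j ∈ Finset.range (n + 2 + 1), (digit (k + j) n : ℝ) * β ^ j := by
    rw [Finset.sum_range_succ, digit_eq_zero_of_lt (lt_fib_self_add_two n) (by omega : n + 2 ≤ k + (n + 2))]
    simp [highSum]
  rw [h1, Finset.sum_range_succ', highSum, Finset.mul_sum, add_comm]
  congr 1
  · simp
  · refine Finset.sum_congr rfl fun j _ => ?_
    rw [add_assoc, add_comm 1 j, pow_succ]
    ring

theorem highSum_eq_zero {J n k : ℕ} (β : ℝ) (h : n < Nat.fib J) (hk : J ≤ k) : highSum β n k = 0 :=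
  Finset.sum_eq_zero fun j _ => by
    rw [digit_eq_zero_of_lt h (by omega)]
    simp

/-- One half of the L-shape: the digit is 0 below the height 1/φ and 1 above it. The map b ↦ δ_k +
φ̄b sends the admissible intervals for position k + 1 into those for k. -/
theorem highSum_conj_bounds (n k : ℕ) :
    -1 ≤ highSum goldenConj n k ∧ highSum goldenConj n k ≤ goldenRatio ∧
      (digit k n = 0 → highSum goldenConj n k ≤ -goldenConj) ∧
      (digit k n = 1 → -goldenConj ≤ highSum goldenConj n k) := by
  obtain ⟨g1, g2⟩ := goldenRatio_bounds
  have hg := goldenConj_eq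
  have hsq := goldenRatio_sq
  have hpos := goldenRatio_pos
  -- Downward induction on k, starting beyond n + 2 where all digits vanish.
  suffices ∀ i k, n + 2 ≤ k + i → -1 ≤ highSum goldenConj n k ∧
      highSum goldenConj n k ≤ goldenRatio ∧
      (digit k n = 0 → highSum goldenConj n k ≤ -goldenConj) ∧
      (digit k n = 1 → -goldenConj ≤ highSum goldenConj n k) from this (n + 2) k (by omega)
  intro i
  induction i with
  | zero =>
    intro k hk
    rw [highSum_eq_zero _ (lt_fib_self_add_two n) (by omega)]
    refine ⟨by linarith, by linarith, fun _ => by linarith, fun h => ?_⟩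
    rw [digit_eq_zero_of_lt (lt_fib_self_add_two n) (by omega)] at h
    omega
  | succ i ih =>
    intro k hk
    obtain ⟨i1, i2, i3, i4⟩ := ih (k + 1) (by omega)
    rw [highSum_eq]
    set b := highSum goldenConj n (k + 1)
    rcases digit_eq_zero_or_one k n with h | h
    · rw [h, hg]
      push_cast
      refine ⟨by nlinarith, by nlinarith, fun _ => by nlinarith, fun h => absurd h (by simp)⟩
    · have i3' := i3 (digit_eq_zero_succ h)
      rw [h, hg]
      rw [hg] at i3'
      push_cast
      refine ⟨by nlinarith, by nlinarith, fun h => absurd h (by simp), fun _ => by nlinarith⟩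

theorem highSum_goldenRatio_zero (n k : ℕ) :
    highSum goldenRatio n 0 = goldenRatio ^ k * (lowFrac n k + highSum goldenRatio n k) := by
  induction k with
  | zero => simp [lowFrac]
  | succ k ih =>
    rw [ih, highSum_eq goldenRatio n k, lowFrac, pow_succ]
    have := goldenRatio_ne_zero
    field_simp
    ring

/-- The high part lies in Z[φ], and its two evaluations are conjugate with the same integer
coordinates; this produces the lattice. -/
theorem exists_highSum_eq (n k : ℕ) : ∃ p q : ℤ,
    highSum goldenRatio n k = q * goldenRatio + p ∧ highSum goldenConj n k = q * goldenConj + p := by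
  refine ⟨∑ j ∈ Finset.range (n + 2), (digit (k + j) n : ℤ) * ((Nat.fib (j + 1) : ℤ) - Nat.fib j),
    ∑ j ∈ Finset.range (n + 2), (digit (k + j) n : ℤ) * Nat.fib j, ?_, ?_⟩
  · push_cast
    rw [highSum, Finset.sum_mul, ← Finset.sum_add_distrib]
    refine Finset.sum_congr rfl fun j _ => ?_
    have h1 := fib_succ_sub_goldenConj_mul_fib j
    rw [← h1, goldenConj_eq]
    ring
  · push_cast
    rw [highSum, Finset.sum_mul, ← Finset.sum_add_distrib]
    refine Finset.sum_congr rfl fun j _ => ?_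
    have h1 := fib_succ_sub_goldenRatio_mul_fib j
    rw [← h1, goldenConj_eq]
    ring

/-- Binet's formula summed over the digits; the conjugate sum at position 0 is bounded, so it is a
negligible error after division by φ^k. -/
theorem sqrt_five_mul_eq (n k : ℕ) :
    √5 * (n : ℝ) = goldenRatio ^ k * (lowFrac n k + highSum goldenRatio n k) -
      highSum goldenConj n 0 := by
  rw [← highSum_goldenRatio_zero]
  have h := sum_digit_mul_fib (lt_fib_self_add_two n)
  have h' : (n : ℝ) = ∑ k ∈ Finset.range (n + 2), (digit k n : ℝ) * Nat.fib k := by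
    exact_mod_cast h.symm
  have h5 : √(5 : ℝ) ≠ 0 := by positivity
  rw [highSum, highSum, ← Finset.sum_sub_distrib]
  nth_rw 1 [h']
  rw [Finset.mul_sum]
  refine Finset.sum_congr rfl fun j _ => ?_
  rw [zero_add, coe_fib_eq]
  field_simp

/-- `n` is at distance at least `η` from the boundary of the regions which determine its digit
at the position `k`. -/
def Typical (η : ℝ) (k n : ℕ) : Prop :=
  lowFrac n k ≤ 1 - η ∧ (digit k n = 1 → lowFrac n k ≤ -goldenConj - η) ∧
    -1 + η ≤ highSum goldenConj n k ∧ highSum goldenConj n k ≤ goldenRatio - η ∧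
    (digit k n = 0 → highSum goldenConj n k ≤ -goldenConj - η) ∧
    (digit k n = 1 → -goldenConj + η ≤ highSum goldenConj n k)

/-- Close phases make the points (s, B) of n and m differ, up to 8ε, by a lattice vector (t + (φ -
1)r, φr - t) with integers r, t. The L-shaped region is a fundamental domain, and both points are
10ε inside it. So the vector is zero and the points lie in the same rectangle. -/
theorem Typical.digit_eq {ε : ℝ} (hε0 : 0 < ε) (hε : ε ≤ 1 / 100) {k n m : ℕ}
    (hk : goldenRatio * (goldenRatio ^ k)⁻¹ ≤ ε) (hn : Typical (10 * ε) k n)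
    (hm : Typical (10 * ε) k m) {i₁ i₂ : ℤ}
    (h1 : |(goldenRatio ^ k)⁻¹ * ((n : ℝ) - m) - i₁| ≤ ε)
    (h2 : |goldenRatio * (goldenRatio ^ k)⁻¹ * ((n : ℝ) - m) - i₂| ≤ ε) :
    digit k n = digit k m := by
  obtain ⟨g1, g2⟩ := goldenRatio_bounds
  have hg := goldenConj_eq
  have hsq := goldenRatio_sq
  have h5 := sqrt_five_eq
  have hpos := goldenRatio_pos
  have hpk : 0 < goldenRatio ^ k := by positivity
  have En := sqrt_five_mul_eq n k
  have Em := sqrt_five_mul_eq m k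
  obtain ⟨pn, qn, an, bn⟩ := exists_highSum_eq n k
  obtain ⟨pm, qm, am, bm⟩ := exists_highSum_eq m k
  obtain ⟨n1, n2, _, _⟩ := highSum_conj_bounds n 0
  obtain ⟨m1, m2, _, _⟩ := highSum_conj_bounds m 0
  obtain ⟨tn1, tn2, tn3, tn4, tn5, tn6⟩ := hn
  obtain ⟨tm1, tm2, tm3, tm4, tm5, tm6⟩ := hm
  have sn0 := lowFrac_nonneg n k
  have sm0 := lowFrac_nonneg m k
  set sn := lowFrac n k
  set sm := lowFrac m k
  set Bn := highSum goldenConj n k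
  set Bm := highSum goldenConj m k
  set An := highSum goldenRatio n k
  set Am := highSum goldenRatio m k
  set cn := highSum goldenConj n 0
  set cm := highSum goldenConj m 0
  set θ := (goldenRatio ^ k)⁻¹ with hθ
  have hθ0 : 0 < θ := inv_pos.2 hpk
  have hθε : θ ≤ 619 / 1000 * ε := by nlinarith
  have F : √5 * (θ * ((n : ℝ) - m)) = (sn - sm) + (An - Am) - θ * (cn - cm) := by
    have : √5 * (θ * ((n : ℝ) - m)) = θ * (√5 * n - √5 * m) := by ring
    rw [this, En, Em, hθ]
    field_simp
    ring
  set D := θ * ((n : ℝ) - m) with hD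
  have hD2 : goldenRatio * θ * ((n : ℝ) - m) = goldenRatio * D := by rw [hD]; ring
  rw [hD2] at h2
  set e := θ * (cn - cm) with he
  have he1 : |e| ≤ 1624 / 1000 * ε := by
    rw [he, abs_mul, abs_of_pos hθ0]
    have : |cn - cm| ≤ 2619 / 1000 := by
      rw [abs_le]
      constructor <;> linarith
    calc θ * |cn - cm| ≤ (619 / 1000 * ε) * (2619 / 1000) := by gcongr
      _ ≤ _ := by linarith
  -- the integers of the lattice vector
  obtain ⟨r, hr⟩ : ∃ r : ℤ, r = i₁ - (qn - qm) := ⟨_, rfl⟩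
  obtain ⟨t, ht⟩ : ∃ t : ℤ, t = i₂ - (qn - qm) - (pn - pm) := ⟨_, rfl⟩
  have hr' : (r : ℝ) = i₁ - (qn - qm) := by rw [hr]; push_cast; ring
  have ht' : (t : ℝ) = i₂ - (qn - qm) - (pn - pm) := by rw [ht]; push_cast; ring
  set d1 := D - i₁ with hd1
  set d2 := goldenRatio * D - i₂ with hd2
  have S1 : (sn - sm) + (Bn - Bm) = √5 * r + √5 * d1 + e := by
    rw [bn, bm, hr', hd1, hg]
    rw [an, am] at F
    rw [h5] at F ⊢
    linear_combination (-1 : ℝ) * F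
  have S2 : goldenRatio * (sn - sm) + (1 - goldenRatio) * (Bn - Bm) =
      √5 * t + √5 * d2 + goldenRatio * e := by
    rw [bn, bm, ht', hd2, hg]
    rw [an, am] at F
    rw [h5] at F ⊢
    linear_combination (-goldenRatio) * F
  have hs : √5 * (sn - sm - (t + (goldenRatio - 1) * r)) =
      √5 * d2 + goldenRatio * e + (goldenRatio - 1) * (√5 * d1 + e) := by
    have : √5 * (sn - sm) = (goldenRatio * (sn - sm) + (1 - goldenRatio) * (Bn - Bm)) +
        (goldenRatio - 1) * ((sn - sm) + (Bn - Bm)) := by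
      rw [h5]
      ring
    rw [mul_sub, this, S1, S2]
    ring
  have h51 := sqrt_five_lt
  have h52 := lt_sqrt_five
  have h50 : 0 < √(5 : ℝ) := by linarith
  have A1 : |√5 * d1| ≤ 9 / 4 * ε := by
    rw [abs_mul, abs_of_pos h50]
    exact mul_le_mul h51.le h1 (abs_nonneg _) (by norm_num)
  have A2 : |√5 * d2| ≤ 9 / 4 * ε := by
    rw [abs_mul, abs_of_pos h50]
    exact mul_le_mul h51.le h2 (abs_nonneg _) (by norm_num)
  have A3 : |goldenRatio * e| ≤ 16181 / 10000 * (1624 / 1000 * ε) := by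
    rw [abs_mul, abs_of_pos hpos]
    exact mul_le_mul g2.le he1 (abs_nonneg _) (by norm_num)
  have A4 : |√5 * d1 + e| ≤ 3874 / 1000 * ε := (abs_add_le _ _).trans (by linarith)
  have A5 : |(goldenRatio - 1) * (√5 * d1 + e)| ≤ 6181 / 10000 * (3874 / 1000 * ε) := by
    rw [abs_mul, abs_of_pos (by linarith : 0 < goldenRatio - 1)]
    exact mul_le_mul (by linarith) A4 (abs_nonneg _) (by norm_num)
  have A6 : |sn - sm - (t + (goldenRatio - 1) * r)| ≤ 4 * ε := by
    have B1 : √5 * |sn - sm - (t + (goldenRatio - 1) * r)| ≤ 73 / 10 * ε := by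
      have B0 : √5 * |sn - sm - (t + (goldenRatio - 1) * r)| =
          |√5 * (sn - sm - (t + (goldenRatio - 1) * r))| := by rw [abs_mul, abs_of_pos h50]
      rw [B0, hs]
      have B2 := abs_add_le (√5 * d2 + goldenRatio * e) ((goldenRatio - 1) * (√5 * d1 + e))
      have B3 := abs_add_le (√5 * d2) (goldenRatio * e)
      linarith
    have B4 := mul_le_mul_of_nonneg_right h52.le
      (abs_nonneg (sn - sm - (t + (goldenRatio - 1) * r)))
    linarith
  have hb : Bn - Bm - (goldenRatio * r - t) =
      √5 * d1 + e - (sn - sm - (t + (goldenRatio - 1) * r)) := by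
    have : √5 * (r : ℝ) = (2 * goldenRatio - 1) * r := by rw [h5]
    linarith
  have A7 : |Bn - Bm - (goldenRatio * r - t)| ≤ 8 * ε := by
    rw [hb]
    exact (abs_sub _ _).trans (by linarith)
  -- The domain has width 1 and height φ + 1, while √5·2 > φ + 2, so r cannot reach 2.
  have hr3 : r < 2 := by
    by_contra hcon
    have : (2 : ℝ) ≤ r := by exact_mod_cast not_lt.1 hcon
    have := mul_le_mul h52.le this (by norm_num) h50.le
    have := (abs_le.1 A4).1
    linarith
  have hr4 : -2 < r := by
    by_contra hcon
    have : (2 : ℝ) ≤ -r := by exact_mod_cast (by omega : 2 ≤ -r)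
    have := mul_le_mul h52.le this (by norm_num) h50.le
    have := (abs_le.1 A4).2
    linarith
  obtain ⟨hs2, hs1⟩ := abs_le.1 A6
  obtain ⟨hb2, hb1⟩ := abs_le.1 A7
  clear S1 S2 hs F En Em hb A1 A2 A3 A4 A5 A6 A7 h1 h2 he1
  have hr5 : r = -1 ∨ r = 0 ∨ r = 1 := by omega
  have ht5 : t = -1 ∨ t = 0 ∨ t = 1 := by
    have ht1 : (t : ℝ) < 2 := by
      rcases hr5 with hr5 | hr5 | hr5 <;> rw [hr5] at hs2 <;> push_cast at hs2 <;> linarith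
    have ht2 : (-2 : ℝ) < t := by
      rcases hr5 with hr5 | hr5 | hr5 <;> rw [hr5] at hs1 <;> push_cast at hs1 <;> linarith
    have ht3 : t < 2 := by exact_mod_cast ht1
    have ht4 : -2 < t := by exact_mod_cast ht2
    omega
  -- Nine vectors remain. Most exceed the width or height of the region; (r, t) = ±(1, 0) is
  -- excluded only by the missing corner of the L; for (0, 0) a change of digit would need a jump of
  -- 20ε in B.
  rcases hr5 with hr5 | hr5 | hr5 <;> rcases ht5 with ht5 | ht5 | ht5 <;>
    rw [hr5, ht5] at hs1 hs2 hb1 hb2 <;> push_cast at hs1 hs2 hb1 hb2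
  · exfalso; linarith
  · exfalso
    rcases digit_eq_zero_or_one k m with h | h
    · have := tm5 h
      linarith
    · have := tm2 h
      linarith
  · exfalso; linarith
  · exfalso; linarith
  · rcases digit_eq_zero_or_one k n with h | h <;> rcases digit_eq_zero_or_one k m with h' | h' <;>
      rw [h, h'] <;> exfalso
    · have := tn5 h
      have := tm6 h'
      linarith
    · have := tn6 h
      have := tm5 h'
      linarith
  · exfalso; linarith
  · exfalso; linarith
  · exfalso
    rcases digit_eq_zero_or_one k n with h | h
    · have := tn5 h
      linarith
    · have := tn2 h
      linarith
  · exfalso; linarith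

/-! ### Counting integers close to a boundary -/

/-- Separated points occupy different cells of length δ. -/
theorem card_le_of_separated {ι : Type*} (s : Finset ι) (f : ι → ℝ) {a η δ : ℝ} (hδ : 0 < δ)
    (hf : ∀ i ∈ s, a ≤ f i ∧ f i ≤ a + η)
    (hη : 0 ≤ η) (hsep : ∀ i ∈ s, ∀ j ∈ s, i ≠ j → δ ≤ |f i - f j|) :
    (s.card : ℝ) ≤ η / δ + 1 := by
  have h1 : ∀ i ∈ s, 0 ≤ (f i - a) / δ := fun i hi =>
    div_nonneg (by linarith [(hf i hi).1]) hδ.le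
  have hmap : ∀ i ∈ s, ⌊(f i - a) / δ⌋₊ ∈ Finset.range (⌊η / δ⌋₊ + 1) := fun i hi => by
    rw [Finset.mem_range, Nat.lt_succ_iff]
    exact Nat.floor_le_floor (div_le_div_of_nonneg_right (by linarith [(hf i hi).2]) hδ.le)
  have hinj : Set.InjOn (fun i => ⌊(f i - a) / δ⌋₊) s := by
    intro i hi j hj hij
    by_contra hne
    have h2 := hsep i hi j hj hne
    have a1 := Nat.floor_le (h1 i hi)
    have a2 := Nat.lt_floor_add_one ((f i - a) / δ)
    have b1 := Nat.floor_le (h1 j hj)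
    have b2 := Nat.lt_floor_add_one ((f j - a) / δ)
    have hij' : ⌊(f i - a) / δ⌋₊ = ⌊(f j - a) / δ⌋₊ := hij
    rw [hij'] at a1 a2
    have h3 : |(f i - a) / δ - (f j - a) / δ| < 1 := by
      rw [abs_lt]
      constructor <;> linarith
    have h4 : (f i - a) / δ - (f j - a) / δ = (f i - f j) / δ := by ring
    rw [h4, abs_div, abs_of_pos hδ, div_lt_one hδ] at h3
    linarith
  have h5 : s.card ≤ ⌊η / δ⌋₊ + 1 := by
    simpa using Finset.card_le_card_of_injOn _ hmap hinj
  have h6 : (s.card : ℝ) ≤ ⌊η / δ⌋₊ + 1 := by exact_mod_cast h5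
  have := Nat.floor_le (div_nonneg hη hδ.le)
  linarith

theorem card_le_of_mem_interval (s : Finset ℕ) {a ℓ : ℝ} (hℓ : 0 ≤ ℓ)
    (hs : ∀ n ∈ s, a ≤ √5 * n ∧ √5 * n ≤ a + ℓ) : (s.card : ℝ) ≤ ℓ / 2 + 1 := by
  have h5 := lt_sqrt_five
  refine card_le_of_separated s (fun n => √5 * (n : ℝ)) two_pos hs hℓ fun i _ j _ hij => ?_
  rw [← mul_sub, abs_mul, abs_of_pos (by linarith : 0 < √(5 : ℝ))]
  have h1 : (1 : ℝ) ≤ |(i : ℝ) - j| := by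
    have : (1 : ℤ) ≤ |(i : ℤ) - j| := Int.one_le_abs (by omega)
    exact_mod_cast this
  nlinarith

theorem goldenRatio_pow_le_fib (n : ℕ) : goldenRatio ^ n ≤ Nat.fib (n + 2) := by
  have hsq := goldenRatio_sq
  induction n using Nat.twoStepInduction with
  | zero => simp
  | one =>
    have := goldenRatio_bounds
    norm_num
    linarith
  | more n h1 h2 =>
    have : goldenRatio ^ (n + 2) = goldenRatio ^ n + goldenRatio ^ (n + 1) := by
      rw [pow_add, hsq]
      ring
    rw [this, Nat.fib_add_two (n := n + 2)]
    push_cast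
    exact add_le_add h1 h2

theorem fib_succ_le_goldenRatio_pow (n : ℕ) : (Nat.fib (n + 1) : ℝ) ≤ goldenRatio ^ n := by
  have hsq := goldenRatio_sq
  induction n using Nat.twoStepInduction with
  | zero => simp
  | one =>
    have := goldenRatio_bounds
    norm_num
    linarith
  | more n h1 h2 =>
    have : goldenRatio ^ (n + 2) = goldenRatio ^ n + goldenRatio ^ (n + 1) := by
      rw [pow_add, hsq]
      ring
    rw [this, Nat.fib_add_two (n := n + 1)]
    push_cast
    exact add_le_add h1 h2

/-- With no digits at or above k the low part is √5·n/φ^k up to a bounded shift, so the condition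
confines √5·n to one interval. -/
theorem card_lowFrac_base {J k : ℕ} (hJ : J ≤ k) {a η : ℝ} (hη : 0 ≤ η) :
    (((Finset.range (Nat.fib J)).filter fun n => a ≤ lowFrac n k ∧ lowFrac n k ≤ a + η).card : ℝ) ≤
      η * goldenRatio ^ k + 3 := by
  obtain ⟨g1, g2⟩ := goldenRatio_bounds
  have hpos : 0 < goldenRatio ^ k := pow_pos goldenRatio_pos _
  refine (card_le_of_mem_interval (a := goldenRatio ^ k * a - goldenRatio)
    (ℓ := η * goldenRatio ^ k + goldenRatio + 1) _ (by positivity) fun n hn => ?_).trans ?_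
  · simp only [Finset.mem_filter, Finset.mem_range] at hn
    obtain ⟨h1, h2, h3⟩ := hn
    rw [sqrt_five_mul_eq n k, highSum_eq_zero _ h1 hJ, add_zero]
    obtain ⟨b1, b2, _, _⟩ := highSum_conj_bounds n 0
    have e1 := mul_le_mul_of_nonneg_left h2 hpos.le
    have e2 := mul_le_mul_of_nonneg_left h3 hpos.le
    constructor <;> linarith
  · have : 0 ≤ η * goldenRatio ^ k := by positivity
    linarith

theorem card_lowFrac_succ {J k : ℕ} (hJ : k ≤ J + 1) (a η : ℝ) :
    ((Finset.range (Nat.fib (J + 2))).filter fun n => a ≤ lowFrac n k ∧ lowFrac n k ≤ a + η).card ≤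
      ((Finset.range (Nat.fib (J + 1))).filter
        fun n => a ≤ lowFrac n k ∧ lowFrac n k ≤ a + η).card +
      ((Finset.range (Nat.fib J)).filter fun n => a ≤ lowFrac n k ∧ lowFrac n k ≤ a + η).card := by
  have hsub : ((Finset.range (Nat.fib (J + 2))).filter
      fun n => a ≤ lowFrac n k ∧ lowFrac n k ≤ a + η) ⊆
      ((Finset.range (Nat.fib (J + 1))).filter
        fun n => a ≤ lowFrac n k ∧ lowFrac n k ≤ a + η) ∪
      ((Finset.range (Nat.fib J)).filter
        fun n => a ≤ lowFrac n k ∧ lowFrac n k ≤ a + η).image (Nat.fib (J + 1) + ·) := by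
    intro n hn
    simp only [Finset.mem_filter, Finset.mem_range, Finset.mem_union, Finset.mem_image] at hn ⊢
    rcases lt_fib_add_two hn.1 with h | ⟨m, hm, rfl⟩
    · exact Or.inl ⟨h, hn.2⟩
    · have : lowFrac (Nat.fib (J + 1) + m) k = lowFrac m k :=
        lowFrac_congr fun j hj => digit_fib_add_of_ne hm (by omega)
      rw [this] at hn
      exact Or.inr ⟨m, ⟨hm, hn.2⟩, rfl⟩
  exact (Finset.card_le_card hsub).trans ((Finset.card_union_le _ _).trans
    (Nat.add_le_add_left Finset.card_image_le _))

/-- Removing a leading Fibonacci number above position k leaves the low part unchanged, so the count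
obeys the Fibonacci recursion in J; the base cases are J = k and J = k + 1. The factor 5 bounds φ³.
-/
theorem card_lowFrac_le {J k : ℕ} (hk : 0 < k) (hJ : k ≤ J) {a η : ℝ} (hη : 0 ≤ η) :
    (((Finset.range (Nat.fib J)).filter fun n => a ≤ lowFrac n k ∧ lowFrac n k ≤ a + η).card : ℝ) ≤
      Nat.fib J * (5 * η + 15 * (goldenRatio ^ k)⁻¹) := by
  obtain ⟨g1, g2⟩ := goldenRatio_bounds
  have hpos : 0 < goldenRatio ^ k := pow_pos goldenRatio_pos _
  set B := η * goldenRatio ^ k + 3 with hB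
  have hB0 : 0 ≤ B := by positivity
  have key : ∀ i, (((Finset.range (Nat.fib (k + i))).filter
      fun n => a ≤ lowFrac n k ∧ lowFrac n k ≤ a + η).card : ℝ) ≤ Nat.fib (i + 2) * B := by
    intro i
    induction i using Nat.twoStepInduction with
    | zero =>
      simpa using card_lowFrac_base (J := k) le_rfl hη
    | one =>
      obtain ⟨k', rfl⟩ : ∃ k', k = k' + 1 := ⟨k - 1, by omega⟩
      have h1 := card_lowFrac_succ (J := k') (k := k' + 1) le_rfl a η
      have h2 := card_lowFrac_base (J := k' + 1) (k := k' + 1) le_rfl (a := a) hη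
      have h3 := card_lowFrac_base (J := k') (k := k' + 1) (Nat.le_succ _) (a := a) hη
      have h4 : (((Finset.range (Nat.fib (k' + 2))).filter
        fun n => a ≤ lowFrac n (k' + 1) ∧ lowFrac n (k' + 1) ≤ a + η).card : ℝ) ≤ _ :=
        Nat.cast_le.2 h1
      push_cast at h4
      have h5 : (Nat.fib (1 + 2) : ℝ) = 2 := by norm_num [Nat.fib]
      rw [h5]
      change (((Finset.range (Nat.fib (k' + 2))).filter _).card : ℝ) ≤ _
      linarith
    | more i h1 h2 =>
      have h3 := card_lowFrac_succ (J := k + i) (k := k) (by omega) a η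
      have h4 : (((Finset.range (Nat.fib (k + i + 2))).filter
        fun n => a ≤ lowFrac n k ∧ lowFrac n k ≤ a + η).card : ℝ) ≤ _ :=
        Nat.cast_le.2 h3
      push_cast at h4
      rw [Nat.fib_add_two (n := i + 2)]
      push_cast
      rw [add_mul]
      rw [← add_assoc] at h2 ⊢
      linarith
  obtain ⟨i, rfl⟩ : ∃ i, J = k + i := ⟨J - k, by omega⟩
  refine (key i).trans ?_
  have e1 := fib_succ_le_goldenRatio_pow (i + 1)
  have e2 := goldenRatio_pow_le_fib (k + i - 2)
  have e3 : goldenRatio ^ (k + i) ≤ goldenRatio ^ 2 * Nat.fib (k + i) := by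
    rcases lt_or_ge (k + i) 2 with h | h
    · have : k + i = 1 := by omega
      rw [this]
      norm_num
    · obtain ⟨l, hl⟩ : ∃ l, k + i = l + 2 := ⟨k + i - 2, by omega⟩
      rw [hl, pow_add, mul_comm]
      exact mul_le_mul_of_nonneg_left (goldenRatio_pow_le_fib l) (by positivity)
  have e4 : goldenRatio ^ 3 ≤ 5 := by
    have hsq := goldenRatio_sq
    have : goldenRatio ^ 3 = goldenRatio * goldenRatio ^ 2 := by ring
    rw [this, hsq]
    nlinarith
  have e5 : (0 : ℝ) ≤ Nat.fib (k + i) := Nat.cast_nonneg _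
  calc (Nat.fib (i + 2) : ℝ) * B ≤ goldenRatio ^ (i + 1) * B := by gcongr
    _ = goldenRatio * goldenRatio ^ (k + i) * (η + 3 * (goldenRatio ^ k)⁻¹) := by
      rw [hB, pow_add, pow_add]
      field_simp
    _ ≤ goldenRatio * (goldenRatio ^ 2 * Nat.fib (k + i)) * (η + 3 * (goldenRatio ^ k)⁻¹) := by
      gcongr
    _ = Nat.fib (k + i) * (goldenRatio ^ 3 * (η + 3 * (goldenRatio ^ k)⁻¹)) := by ring
    _ ≤ Nat.fib (k + i) * (5 * (η + 3 * (goldenRatio ^ k)⁻¹)) := by gcongr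
    _ = _ := by ring

/-- High parts are elements of Z[φ] of size O(F_J/φ^k), so distinct conjugates are separated by
φ^k/(4F_J) through the norm form. Each conjugate determines the high part and therefore leaves
O(φ^k) integers. -/
theorem card_highSum_le (J k : ℕ) {a η : ℝ} (hη : 0 ≤ η) :
    (((Finset.range (Nat.fib J)).filter fun n => a ≤ highSum goldenConj n k ∧
      highSum goldenConj n k ≤ a + η).card : ℝ) ≤ 16 * η * Nat.fib J + 4 * goldenRatio ^ k := by
  classical
  obtain ⟨g1, g2⟩ := goldenRatio_bounds
  have h5 := sqrt_five_lt
  have hpk : 1 ≤ goldenRatio ^ k := one_le_pow₀ (by linarith)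
  have hpos : 0 < goldenRatio ^ k := by linarith
  rcases Nat.eq_zero_or_pos J with rfl | hJ
  · simpa using hpos.le
  have hF : (1 : ℝ) ≤ Nat.fib J := by exact_mod_cast Nat.fib_pos.2 hJ
  set S := (Finset.range (Nat.fib J)).filter fun n => a ≤ highSum goldenConj n k ∧
      highSum goldenConj n k ≤ a + η with hS
  have hA : ∀ n ∈ S, 0 ≤ highSum goldenRatio n k ∧
      goldenRatio ^ k * highSum goldenRatio n k ≤ 4 * Nat.fib J := by
    intro n hn
    have h1 : (n : ℝ) ≤ Nat.fib J := by
      have := Finset.mem_range.1 (Finset.mem_filter.1 hn).1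
      exact_mod_cast this.le
    have h2 := sqrt_five_mul_eq n k
    have h3 := (highSum_conj_bounds n 0).2.1
    have h4 : 0 ≤ goldenRatio ^ k * lowFrac n k := mul_nonneg hpos.le (lowFrac_nonneg n k)
    refine ⟨Finset.sum_nonneg fun j _ => ?_, ?_⟩
    · have := goldenRatio_pos
      positivity
    · have h6 : √5 * (n : ℝ) ≤ 9 / 4 * Nat.fib J := mul_le_mul h5.le h1 (by positivity) (by norm_num)
      linarith
  have hdiff : ∀ n ∈ S, ∀ m ∈ S, highSum goldenConj n k ≠ highSum goldenConj m k →
      goldenRatio ^ k / (4 * Nat.fib J) ≤ |highSum goldenConj n k - highSum goldenConj m k| := by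
    intro n hn m hm hne
    obtain ⟨pn, qn, an, bn⟩ := exists_highSum_eq n k
    obtain ⟨pm, qm, am, bm⟩ := exists_highSum_eq m k
    have h1 : qn - qm ≠ 0 ∨ pn - pm ≠ 0 := by
      by_contra hcon
      push Not at hcon
      refine hne ?_
      rw [bn, bm, sub_eq_zero.1 hcon.1, sub_eq_zero.1 hcon.2]
    have h2 := one_le_abs_norm_form h1
    have e1 : ((qn - qm : ℤ) : ℝ) * goldenRatio + (pn - pm : ℤ) =
        highSum goldenRatio n k - highSum goldenRatio m k := by
      rw [an, am]
      push_cast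
      ring
    have e2 : ((qn - qm : ℤ) : ℝ) * goldenConj + (pn - pm : ℤ) =
        highSum goldenConj n k - highSum goldenConj m k := by
      rw [bn, bm]
      push_cast
      ring
    rw [e1, e2, abs_mul] at h2
    obtain ⟨x1, x2⟩ := hA n hn
    obtain ⟨y1, y2⟩ := hA m hm
    have h3 : goldenRatio ^ k * |highSum goldenRatio n k - highSum goldenRatio m k| ≤
        4 * Nat.fib J := by
      rcases abs_cases (highSum goldenRatio n k - highSum goldenRatio m k) with ⟨h, _⟩ | ⟨h, _⟩ <;>
        rw [h] <;> nlinarith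
    rw [div_le_iff₀ (by positivity)]
    calc goldenRatio ^ k = goldenRatio ^ k * 1 := (mul_one _).symm
      _ ≤ goldenRatio ^ k * (|highSum goldenRatio n k - highSum goldenRatio m k| *
          |highSum goldenConj n k - highSum goldenConj m k|) := by gcongr
      _ = (goldenRatio ^ k * |highSum goldenRatio n k - highSum goldenRatio m k|) *
          |highSum goldenConj n k - highSum goldenConj m k| := by ring
      _ ≤ 4 * Nat.fib J * |highSum goldenConj n k - highSum goldenConj m k| := by gcongr
      _ = _ := by ring
  have himg : ((S.image fun n => highSum goldenConj n k).card : ℝ) ≤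
      η / (goldenRatio ^ k / (4 * Nat.fib J)) + 1 := by
    refine card_le_of_separated _ id (a := a) (by positivity) ?_ hη ?_
    · intro r hr
      obtain ⟨n, hn, rfl⟩ := Finset.mem_image.1 hr
      exact (Finset.mem_filter.1 hn).2
    · intro r hr r' hr' hne
      obtain ⟨n, hn, rfl⟩ := Finset.mem_image.1 hr
      obtain ⟨m, hm, rfl⟩ := Finset.mem_image.1 hr'
      exact hdiff n hn m hm hne
  -- Equal conjugates force equal high parts, and then only the low part of n varies.
  have hfib : ∀ b ∈ S.image fun n => highSum goldenConj n k,
      ((S.filter fun n => highSum goldenConj n k = b).card : ℝ) ≤ 4 * goldenRatio ^ k := by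
    intro b hb
    obtain ⟨m, hm, rfl⟩ := Finset.mem_image.1 hb
    refine (card_le_of_mem_interval (a := goldenRatio ^ k * highSum goldenRatio m k - goldenRatio)
      (ℓ := goldenRatio ^ k + goldenRatio + 1) _ (by linarith) fun n hn => ?_).trans (by linarith)
    obtain ⟨hn1, hn2⟩ := Finset.mem_filter.1 hn
    have hAA : highSum goldenRatio n k = highSum goldenRatio m k := by
      obtain ⟨pn, qn, an, bn⟩ := exists_highSum_eq n k
      obtain ⟨pm, qm, am, bm⟩ := exists_highSum_eq m k
      by_contra hne
      have h1 : qn - qm ≠ 0 ∨ pn - pm ≠ 0 := by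
        by_contra hcon
        push Not at hcon
        refine hne ?_
        rw [an, am, sub_eq_zero.1 hcon.1, sub_eq_zero.1 hcon.2]
      have h2 := one_le_abs_norm_form h1
      have e2 : ((qn - qm : ℤ) : ℝ) * goldenConj + (pn - pm : ℤ) = 0 := by
        rw [bn, bm] at hn2
        push_cast
        linarith
      rw [e2, mul_zero, abs_zero] at h2
      linarith
    have h3 := sqrt_five_mul_eq n k
    obtain ⟨b1, b2, _, _⟩ := highSum_conj_bounds n 0
    have b3 := lowFrac_nonneg n k
    have b4 := (lowFrac_lt n k).1
    rw [h3, hAA]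
    constructor <;> nlinarith
  have hcard := Finset.card_eq_sum_card_image (fun n => highSum goldenConj n k) S
  have h7 : (S.card : ℝ) ≤
      ∑ _b ∈ S.image fun n => highSum goldenConj n k, 4 * goldenRatio ^ k := by
    rw [hcard]
    push_cast
    exact Finset.sum_le_sum hfib
  rw [Finset.sum_const, nsmul_eq_mul] at h7
  refine h7.trans ?_
  calc _ ≤ (η / (goldenRatio ^ k / (4 * Nat.fib J)) + 1) * (4 * goldenRatio ^ k) := by gcongr
    _ = _ := by field_simp; ring

open Classical in
-- Five boundary strips: two in s (10η and 30φ^(-k)), and three in B of total width 4η (64η and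
-- 12φ^k). The common edge B = 1/φ has a strip on both sides.
theorem card_not_typical_le {J k : ℕ} (hk : 0 < k) (hJ : k ≤ J) {η : ℝ} (hη : 0 ≤ η) :
    (((Finset.range (Nat.fib J)).filter fun n => ¬ Typical η k n).card : ℝ) ≤
      Nat.fib J * (74 * η + 30 * (goldenRatio ^ k)⁻¹) + 12 * goldenRatio ^ k := by
  let P : ℝ → ℝ → Finset ℕ := fun a ℓ => (Finset.range (Nat.fib J)).filter
    fun n => a ≤ lowFrac n k ∧ lowFrac n k ≤ a + ℓ
  let Q : ℝ → ℝ → Finset ℕ := fun a ℓ => (Finset.range (Nat.fib J)).filter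
    fun n => a ≤ highSum goldenConj n k ∧ highSum goldenConj n k ≤ a + ℓ
  have hsub : ((Finset.range (Nat.fib J)).filter fun n => ¬ Typical η k n) ⊆
      P (1 - η) η ∪ P (-goldenConj - η) η ∪ Q (-1) η ∪ Q (goldenRatio - η) η ∪
        Q (-goldenConj - η) (2 * η) := by
    intro n hn
    obtain ⟨hn1, hn2⟩ := Finset.mem_filter.1 hn
    simp only [Finset.mem_union, P, Q, Finset.mem_filter, hn1, true_and]
    by_contra hcon
    simp only [not_or, not_and, not_le] at hcon
    obtain ⟨⟨⟨⟨c1, c2⟩, c3⟩, c4⟩, c5⟩ := hcon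
    obtain ⟨s1, s2⟩ := lowFrac_lt n k
    obtain ⟨b1, b2, b3, b4⟩ := highSum_conj_bounds n k
    refine hn2 ⟨?_, fun h => ?_, ?_, ?_, fun h => ?_, fun h => ?_⟩ <;> by_contra hc <;>
      rw [not_le] at hc
    · linarith [c1 hc.le]
    · linarith [c2 hc.le, s2 h]
    · linarith [c3 b1]
    · linarith [c4 hc.le]
    · linarith [c5 hc.le, b3 h]
    · linarith [c5 (by linarith [b4 h]), b4 h]
  have h1 := card_lowFrac_le hk hJ hη (a := 1 - η)
  have h2 := card_lowFrac_le hk hJ hη (a := -goldenConj - η)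
  have h3 := card_highSum_le J k hη (a := -1)
  have h4 := card_highSum_le J k hη (a := goldenRatio - η)
  have h5 := card_highSum_le J k (show 0 ≤ 2 * η by linarith) (a := -goldenConj - η)
  have h6 : (((Finset.range (Nat.fib J)).filter fun n => ¬ Typical η k n).card : ℝ) ≤
      (P (1 - η) η).card + (P (-goldenConj - η) η).card + (Q (-1) η).card +
        (Q (goldenRatio - η) η).card + (Q (-goldenConj - η) (2 * η)).card := by
    have h7 := (Finset.card_le_card hsub).trans ((Finset.card_union_le _ _).trans
      (Nat.add_le_add_right ((Finset.card_union_le _ _).trans (Nat.add_le_add_right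
      ((Finset.card_union_le _ _).trans (Nat.add_le_add_right (Finset.card_union_le _ _) _)) _)) _))
    exact_mod_cast h7
  refine h6.trans ?_
  calc _ ≤ _ := add_le_add (add_le_add (add_le_add (add_le_add h1 h2) h3) h4) h5
    _ = _ := by ring

/-! ### Trigonometric approximants of the digits -/

/-- `f` is a trigonometric sum with frequencies `h φ`, `|h| ≤ H`, whose coefficients have the
absolute sum at most `A`. -/
def TrigBdd (A H : ℝ) (f : ℕ → ℂ) : Prop :=
  ∃ (ι : Type) (_ : Fintype ι) (c : ι → ℂ) (h : ι → ℤ), ∑ i, ‖c i‖ ≤ A ∧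
    (∀ i, |(h i : ℝ)| ≤ H) ∧ ∀ n, f n = ∑ i, c i * ex (h i * goldenRatio * n)

theorem TrigBdd.mono {A A' H H' : ℝ} {f : ℕ → ℂ} (hf : TrigBdd A H f) (hA : A ≤ A')
    (hH : H ≤ H') : TrigBdd A' H' f := by
  obtain ⟨ι, _, c, h, h1, h2, h3⟩ := hf
  exact ⟨ι, _, c, h, h1.trans hA, fun i => (h2 i).trans hH, h3⟩

theorem trigBdd_char (c : ℂ) (h : ℤ) :
    TrigBdd ‖c‖ |(h : ℝ)| fun n => c * ex (h * goldenRatio * n) :=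
  ⟨Unit, inferInstance, fun _ => c, fun _ => h, by simp, fun _ => le_rfl, fun n => by simp⟩

theorem trigBdd_const (c : ℂ) : TrigBdd ‖c‖ 0 fun _ => c := by
  have := trigBdd_char c 0
  simpa [ex_zero] using this

theorem TrigBdd.add {A A' H : ℝ} {f g : ℕ → ℂ} (hf : TrigBdd A H f) (hg : TrigBdd A' H g) :
    TrigBdd (A + A') H fun n => f n + g n := by
  obtain ⟨ι, _, c, h, h1, h2, h3⟩ := hf
  obtain ⟨ι', _, c', h', h1', h2', h3'⟩ := hg
  refine ⟨ι ⊕ ι', inferInstance, Sum.elim c c', Sum.elim h h', ?_, ?_, fun n => ?_⟩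
  · rw [Fintype.sum_sum_type]
    exact add_le_add h1 h1'
  · rintro (i | i)
    · exact h2 i
    · exact h2' i
  · beta_reduce
    rw [Fintype.sum_sum_type, h3, h3']
    rfl

theorem TrigBdd.mul {A A' H H' : ℝ} {f g : ℕ → ℂ} (hf : TrigBdd A H f) (hg : TrigBdd A' H' g) :
    TrigBdd (A * A') (H + H') fun n => f n * g n := by
  obtain ⟨ι, _, c, h, h1, h2, h3⟩ := hf
  obtain ⟨ι', _, c', h', h1', h2', h3'⟩ := hg
  refine ⟨ι × ι', inferInstance, fun p => c p.1 * c' p.2, fun p => h p.1 + h' p.2, ?_, ?_,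
    fun n => ?_⟩
  · simp_rw [norm_mul]
    rw [Fintype.sum_prod_type]
    dsimp only
    rw [← Finset.sum_mul_sum]
    exact mul_le_mul h1 h1' (Finset.sum_nonneg fun _ _ => norm_nonneg _)
      ((Finset.sum_nonneg fun _ _ => norm_nonneg _).trans h1)
  · intro p
    push_cast
    exact (abs_add_le _ _).trans (add_le_add (h2 _) (h2' _))
  · beta_reduce
    rw [Fintype.sum_prod_type, h3, h3', Finset.sum_mul_sum]
    refine Finset.sum_congr rfl fun i _ => Finset.sum_congr rfl fun j _ => ?_
    have : ((h i + h' j : ℤ) : ℝ) * goldenRatio * n =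
        h i * goldenRatio * n + h' j * goldenRatio * n := by
      push_cast
      ring
    rw [this, ex_add]
    ring

theorem TrigBdd.conj {A H : ℝ} {f : ℕ → ℂ} (hf : TrigBdd A H f) :
    TrigBdd A H fun n => (starRingEnd ℂ) (f n) := by
  obtain ⟨ι, _, c, h, h1, h2, h3⟩ := hf
  refine ⟨ι, inferInstance, fun i => (starRingEnd ℂ) (c i), fun i => -h i, ?_, ?_, fun n => ?_⟩
  · simpa using h1
  · simpa using h2
  · beta_reduce
    rw [h3, map_sum]
    refine Finset.sum_congr rfl fun i _ => ?_
    rw [map_mul, conj_ex]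
    congr 2
    push_cast
    ring

theorem TrigBdd.sum {κ : Type*} (s : Finset κ) {A : κ → ℝ} {H : ℝ} (hH : 0 ≤ H) {f : κ → ℕ → ℂ}
    (hf : ∀ i ∈ s, TrigBdd (A i) H (f i)) : TrigBdd (∑ i ∈ s, A i) H fun n => ∑ i ∈ s, f i n := by
  classical
  induction s using Finset.induction_on with
  | empty => simpa using (trigBdd_const 0).mono (by simp) hH
  | insert a s ha ih =>
    simp_rw [Finset.sum_insert ha]
    exact (hf a (Finset.mem_insert_self _ _)).add
      (ih fun i hi => hf i (Finset.mem_insert_of_mem hi))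

theorem TrigBdd.prod {κ : Type*} (s : Finset κ) {A H : ℝ} {f : κ → ℕ → ℂ}
    (hf : ∀ i ∈ s, TrigBdd A H (f i)) :
    TrigBdd (A ^ s.card) (s.card * H) fun n => ∏ i ∈ s, f i n := by
  classical
  induction s using Finset.induction_on with
  | empty => simpa using trigBdd_const 1
  | insert a s ha ih =>
    simp_rw [Finset.prod_insert ha, Finset.card_insert_of_notMem ha]
    refine ((hf a (Finset.mem_insert_self _ _)).mul
      (ih fun i hi => hf i (Finset.mem_insert_of_mem hi))).mono ?_ ?_
    · rw [pow_succ, mul_comm]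
    · push_cast
      linarith

/-- The average of `f` over a finite set. -/
def avg (s : Finset ℕ) (f : ℕ → ℂ) : ℂ := (1 / (s.card : ℂ)) * ∑ n ∈ s, f n

theorem avg_sum {κ : Type*} (s : Finset ℕ) (t : Finset κ) (f : κ → ℕ → ℂ) :
    avg s (fun n => ∑ i ∈ t, f i n) = ∑ i ∈ t, avg s (f i) := by
  simp only [avg]
  rw [Finset.sum_comm, Finset.mul_sum]

theorem avg_mul_left (s : Finset ℕ) (c : ℂ) (f : ℕ → ℂ) :
    avg s (fun n => c * f n) = c * avg s f := by
  rw [avg, avg, ← Finset.mul_sum]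
  ring

theorem avg_sub (s : Finset ℕ) (f g : ℕ → ℂ) :
    avg s (fun n => f n - g n) = avg s f - avg s g := by
  rw [avg, avg, avg, Finset.sum_sub_distrib, mul_sub]

theorem norm_avg_le (s : Finset ℕ) {f : ℕ → ℂ} {g : ℕ → ℝ} (h : ∀ n ∈ s, ‖f n‖ ≤ g n) :
    ‖avg s f‖ ≤ (1 / (s.card : ℝ)) * ∑ n ∈ s, g n := by
  rw [avg, norm_mul, norm_div, norm_one, Complex.norm_natCast]
  exact mul_le_mul_of_nonneg_left (norm_sum_le_of_le _ h) (by positivity)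

theorem avg_const {s : Finset ℕ} (hs : s.Nonempty) (c : ℂ) : avg s (fun _ => c) = c := by
  have : (s.card : ℂ) ≠ 0 := by exact_mod_cast hs.card_pos.ne'
  rw [avg, Finset.sum_const, nsmul_eq_mul]
  field_simp

/-- Zero frequencies have the same average over both sets and cancel; only h ≠ 0 is left. -/
theorem TrigBdd.norm_avg_sub_le {A H : ℝ} {f : ℕ → ℂ} (hf : TrigBdd A H f) {s t : Finset ℕ}
    (hs : s.Nonempty) (ht : t.Nonempty) {δ : ℝ} (hδ : 0 ≤ δ)
    (h : ∀ h : ℤ, h ≠ 0 → |(h : ℝ)| ≤ H → ‖avg s fun n => ex (h * goldenRatio * n)‖ +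
      ‖avg t fun n => ex (h * goldenRatio * n)‖ ≤ δ) : ‖avg s f - avg t f‖ ≤ A * δ := by
  obtain ⟨ι, _, c, a, h1, h2, h3⟩ := hf
  have e : f = fun n : ℕ => ∑ i, c i * ex (a i * goldenRatio * n) := funext h3
  rw [e, avg_sum, avg_sum, ← Finset.sum_sub_distrib]
  refine (norm_sum_le_of_le (n := fun i => ‖c i‖ * δ) _ fun i _ => ?_).trans ?_
  · rw [avg_mul_left, avg_mul_left, ← mul_sub, norm_mul]
    refine mul_le_mul_of_nonneg_left ?_ (norm_nonneg _)
    by_cases h0 : a i = 0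
    · have : (fun n : ℕ => ex ((a i : ℝ) * goldenRatio * n)) = fun _ => 1 := by
        funext n
        rw [h0]
        simp [ex_zero]
      rw [this, avg_const hs, avg_const ht, sub_self, norm_zero]
      exact hδ
    · exact (norm_sub_le _ _).trans (h _ h0 (h2 i))
  · rw [← Finset.sum_mul]
    exact mul_le_mul_of_nonneg_right h1 hδ

/-- The Dirichlet kernel. -/
def dirichletKernel (N : ℕ) (t : ℝ) : ℂ := ∑ a ∈ Finset.range N, ex (a * t)

theorem norm_dirichletKernel_mul_nd_le (N : ℕ) (t : ℝ) :
    ‖dirichletKernel N t‖ * (2 * nd t) ≤ 1 := by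
  have h := norm_sum_ex_mul_nd_le t 0 N
  have e : ∑ m ∈ Finset.Ioc 0 N, ex (m * t) = ex t * dirichletKernel N t := by
    rw [dirichletKernel, Finset.mul_sum, Finset.range_eq_Ico, ← Finset.Ico_add_one_add_one_eq_Ioc,
      ← Finset.sum_Ico_add']
    refine Finset.sum_congr rfl fun n _ => ?_
    rw [← ex_add]
    congr 1
    push_cast
    ring
  rwa [e, norm_mul, norm_ex, one_mul] at h

theorem ex_nat_mul (n : ℕ) (t : ℝ) : ex (n * t) = ex t ^ n := by
  induction n with
  | zero => simp [ex_zero]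
  | succ n ih =>
    rw [pow_succ, ← ih, ← ex_add]
    congr 1
    push_cast
    ring

theorem sum_ex_mul_div {N : ℕ} (hN : 0 < N) (m : ℤ) (hm : |m| < N) :
    ∑ u ∈ Finset.range N, ex (-(m * (u / N : ℝ))) = if m = 0 then (N : ℂ) else 0 := by
  have hN' : (0 : ℝ) < N := by exact_mod_cast hN
  split_ifs with h
  · simp [h, ex_zero]
  · have h1 : ∀ u ∈ Finset.range N, ex (-(m * (u / N : ℝ))) = ex (-(m / N : ℝ)) ^ u := by
      intro u _
      rw [← ex_nat_mul]
      congr 1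
      ring
    rw [Finset.sum_congr rfl h1]
    have h2 : ex (-(m / N : ℝ)) ≠ 1 := by
      intro h3
      have h4 := four_mul_nd_le_norm_ex_sub_one (-(m / N : ℝ))
      rw [h3, sub_self, norm_zero, nd_neg, nd] at h4
      have h5 : |(m / N : ℝ) - round (m / N : ℝ)| = 0 :=
        le_antisymm (by linarith) (abs_nonneg _)
      rw [abs_eq_zero, sub_eq_zero, div_eq_iff hN'.ne'] at h5
      have h6 : m = round (m / N : ℝ) * N := by exact_mod_cast h5
      have h7 : (N : ℤ) ∣ m := ⟨_, by rw [mul_comm]; exact h6⟩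
      have := Int.le_of_dvd (abs_pos.2 h) ((dvd_abs _ _).2 h7)
      omega
    rw [geom_sum_eq h2, ← ex_nat_mul]
    have h3 : (N : ℝ) * -(m / N : ℝ) = ((-m : ℤ) : ℝ) := by
      push_cast
      field_simp
    rw [h3, ex_int, sub_self, zero_div]

/-- Orthogonality of characters on the grid of N points: only the diagonal survives, since frequency
differences are smaller than N. -/
theorem sum_norm_dirichletKernel_sq {N : ℕ} (hN : 0 < N) (t : ℝ) :
    ∑ u ∈ Finset.range N, ‖dirichletKernel N (t - u / N)‖ ^ 2 = (N : ℝ) ^ 2 := by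
  have h1 : ((∑ u ∈ Finset.range N, ‖dirichletKernel N (t - u / N)‖ ^ 2 : ℝ) : ℂ) =
      ((N : ℝ) ^ 2 : ℝ) := by
    push_cast
    have h2 : ∀ u ∈ Finset.range N, (‖dirichletKernel N (t - u / N)‖ : ℂ) ^ 2 =
        ∑ a ∈ Finset.range N, ∑ b ∈ Finset.range N,
          ex ((a - b : ℝ) * t) * ex (-(((a : ℤ) - b : ℤ) * (u / N : ℝ))) := by
      intro u _
      rw [← Complex.mul_conj', dirichletKernel, map_sum, Finset.sum_mul_sum]
      refine Finset.sum_congr rfl fun a _ => Finset.sum_congr rfl fun b _ => ?_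
      rw [conj_ex, ← ex_add, ← ex_add]
      congr 1
      push_cast
      ring
    rw [Finset.sum_congr rfl h2, Finset.sum_comm]
    have h3 : ∀ a ∈ Finset.range N, ∑ u ∈ Finset.range N, ∑ b ∈ Finset.range N,
        ex ((a - b : ℝ) * t) * ex (-(((a : ℤ) - b : ℤ) * (u / N : ℝ))) = N := by
      intro a ha
      rw [Finset.sum_comm]
      have h4 : ∀ b ∈ Finset.range N, ∑ u ∈ Finset.range N,
          ex ((a - b : ℝ) * t) * ex (-(((a : ℤ) - b : ℤ) * (u / N : ℝ))) =
          if b = a then (N : ℂ) else 0 := by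
        intro b hb
        rw [Finset.mem_range] at ha hb
        rw [← Finset.mul_sum, sum_ex_mul_div hN _ (by
          rcases abs_cases ((a : ℤ) - b) with ⟨e, _⟩ | ⟨e, _⟩ <;> rw [e] <;> omega)]
        by_cases hab : b = a
        · subst hab
          simp [ex_zero]
        · rw [if_neg (by omega), if_neg hab, mul_zero]
      rw [Finset.sum_congr rfl h4, Finset.sum_ite_eq', if_pos ha]
    rw [Finset.sum_congr rfl h3, Finset.sum_const, Finset.card_range, nsmul_eq_mul, sq]
  exact_mod_cast h1

/-- The normalized Fejér weight of the grid point `u / N` at `t`. -/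
def fejerWeight (N : ℕ) (t : ℝ) (u : ℕ) : ℝ := ‖dirichletKernel N (t - u / N)‖ ^ 2 / (N : ℝ) ^ 2

theorem fejerWeight_nonneg (N : ℕ) (t : ℝ) (u : ℕ) : 0 ≤ fejerWeight N t u := by
  rw [fejerWeight]
  positivity

theorem sum_fejerWeight {N : ℕ} (hN : 0 < N) (t : ℝ) :
    ∑ u ∈ Finset.range N, fejerWeight N t u = 1 := by
  have : (N : ℝ) ≠ 0 := by exact_mod_cast hN.ne'
  simp only [fejerWeight]
  rw [← Finset.sum_div, sum_norm_dirichletKernel_sq hN, div_self (by positivity)]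

/-- Off the ε/2-neighbourhood the kernel is at most 1/ε, so each of at most N weights is at most
1/(εN)². -/
theorem sum_fejerWeight_far_le {N : ℕ} (hN : 0 < N) (t : ℝ) {ε : ℝ} (hε : 0 < ε) :
    ∑ u ∈ (Finset.range N).filter (fun u : ℕ => ¬ nd (t - u / N) ≤ ε / 2), fejerWeight N t u ≤
      1 / (N * ε ^ 2) := by
  have hN' : (0 : ℝ) < N := by exact_mod_cast hN
  have h1 : ∀ u ∈ (Finset.range N).filter (fun u : ℕ => ¬ nd (t - u / N) ≤ ε / 2),
      fejerWeight N t u ≤ 1 / (ε ^ 2 * (N : ℝ) ^ 2) := by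
    intro u hu
    have h2 := not_le.1 (Finset.mem_filter.1 hu).2
    have h3 := norm_dirichletKernel_mul_nd_le N (t - u / N)
    have h4 : ‖dirichletKernel N (t - u / N)‖ * ε ≤ 1 :=
      le_trans (mul_le_mul_of_nonneg_left (by linarith) (norm_nonneg _)) h3
    have h5 : (‖dirichletKernel N (t - u / N)‖ * ε) ^ 2 ≤ 1 :=
      pow_le_one₀ (by positivity) h4
    rw [mul_pow] at h5
    rw [fejerWeight, ← div_div]
    refine div_le_div_of_nonneg_right ?_ (by positivity)
    rw [le_div_iff₀ (by positivity)]
    exact h5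
  refine (Finset.sum_le_sum h1).trans ?_
  rw [Finset.sum_const, nsmul_eq_mul]
  have h6 : (((Finset.range N).filter (fun u : ℕ => ¬ nd (t - u / N) ≤ ε / 2)).card : ℝ) ≤ N := by
    have := Finset.card_filter_le (Finset.range N) (fun u : ℕ => ¬ nd (t - u / N) ≤ ε / 2)
    rw [Finset.card_range] at this
    exact_mod_cast this
  calc _ ≤ (N : ℝ) * (1 / (ε ^ 2 * (N : ℝ) ^ 2)) := by gcongr
    _ = _ := by field_simp

theorem trigBdd_dirichletKernel (N : ℕ) (h : ℕ) (s : ℝ) :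
    TrigBdd N (N * h) fun n => dirichletKernel N (h * goldenRatio * n - s) := by
  have h1 := TrigBdd.sum (Finset.range N) (A := fun _ => 1) (H := N * h) (by positivity)
    (f := fun a n => ex (-(a * s)) * ex (((a * h : ℕ) : ℤ) * goldenRatio * n)) (fun a ha => by
      refine (trigBdd_char (ex (-(a * s))) ((a * h : ℕ) : ℤ)).mono (norm_ex _).le ?_
      rw [Int.cast_natCast, Nat.abs_cast]
      have := (Finset.mem_range.1 ha).le
      exact_mod_cast Nat.mul_le_mul_right h this)
  simp only [Finset.sum_const, Finset.card_range, nsmul_eq_mul, mul_one] at h1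
  convert h1 using 2 with n
  rw [dirichletKernel]
  refine Finset.sum_congr rfl fun a _ => ?_
  rw [← ex_add]
  congr 1
  push_cast
  ring

theorem trigBdd_fejerWeight (N : ℕ) (h : ℕ) (u : ℕ) :
    TrigBdd 1 (2 * N * h) fun n => (fejerWeight N (h * goldenRatio * n) u : ℂ) := by
  rcases Nat.eq_zero_or_pos N with rfl | hN
  · simpa [fejerWeight] using (trigBdd_const 0).mono (by simp) le_rfl
  have hN' : (N : ℝ) ≠ 0 := by exact_mod_cast hN.ne'
  have h1 := trigBdd_dirichletKernel N h (u / N)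
  have h2 := (trigBdd_const (((N : ℝ) ^ 2)⁻¹ : ℝ)).mul (h1.mul h1.conj)
  have h3 := h2.mono (A' := 1) (H' := 2 * N * h) (le_of_eq (by
    rw [Complex.norm_real, Real.norm_of_nonneg (by positivity)]
    field_simp)) (le_of_eq (by ring))
  convert h3 using 2 with n
  rw [Complex.mul_conj', fejerWeight]
  push_cast
  rw [div_eq_inv_mul]

/-- F_(j+1) - φF_j is the j-th power of the conjugate, i.e. ±φ^(-j). So the phase φ^(-j)d can be
replaced by one whose frequency is an integer multiple of φ. -/
theorem nd_fib_mul_goldenRatio (j : ℕ) (d : ℤ) :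
    nd (Nat.fib j * goldenRatio * d) = nd ((goldenRatio ^ j)⁻¹ * d) := by
  have h1 : Nat.fib j * goldenRatio * d = -(goldenConj ^ j * d) + (Nat.fib (j + 1) * d : ℤ) := by
    rw [← fib_succ_sub_goldenRatio_mul_fib]
    push_cast
    ring
  have h2 : goldenConj = -goldenRatio⁻¹ := by rw [inv_goldenRatio, neg_neg]
  rw [h1, nd_add_int, nd_neg, h2, neg_pow, ← inv_pow]
  rcases neg_one_pow_eq_or ℝ j with h | h <;> rw [h]
  · rw [one_mul]
  · rw [neg_one_mul, neg_mul, nd_neg]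

/-- `n` is near the point `(u / N, v / N)` of the torus. -/
def Near (ε : ℝ) (j N n u v : ℕ) : Prop :=
  nd (Nat.fib (j + 1) * goldenRatio * n - u / N) ≤ ε / 2 ∧
    nd (Nat.fib j * goldenRatio * n - v / N) ≤ ε / 2

/-- Two integers near the same grid point have phases within ε of each other, so the torus
description of the digit applies. -/
theorem Near.digit_eq {ε : ℝ} (hε0 : 0 < ε) (hε : ε ≤ 1 / 100) {j N n m u v : ℕ}
    (hk : (goldenRatio ^ j)⁻¹ ≤ ε) (hn : Typical (10 * ε) (j + 1) n)
    (hm : Typical (10 * ε) (j + 1) m) (h1 : Near ε j N n u v) (h2 : Near ε j N m u v) :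
    digit (j + 1) n = digit (j + 1) m := by
  have key : ∀ (i w : ℕ), nd (Nat.fib i * goldenRatio * n - w / N) ≤ ε / 2 →
      nd (Nat.fib i * goldenRatio * m - w / N) ≤ ε / 2 →
      nd ((goldenRatio ^ i)⁻¹ * ((n : ℝ) - m)) ≤ ε := by
    intro i w a b
    have e1 := nd_fib_mul_goldenRatio i ((n : ℤ) - m)
    push_cast at e1
    rw [← e1]
    have e2 : Nat.fib i * goldenRatio * ((n : ℝ) - m) =
        (Nat.fib i * goldenRatio * n - w / N) + -(Nat.fib i * goldenRatio * m - w / N) := by ring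
    rw [e2]
    refine (nd_add_le _ _).trans ?_
    rw [nd_neg]
    linarith
  have e3 : goldenRatio * (goldenRatio ^ (j + 1))⁻¹ = (goldenRatio ^ j)⁻¹ := by
    have := goldenRatio_ne_zero
    rw [pow_succ]
    field_simp
  refine Typical.digit_eq hε0 hε (by rw [e3]; exact hk) hn hm
    (i₁ := round ((goldenRatio ^ (j + 1))⁻¹ * ((n : ℝ) - m)))
    (i₂ := round ((goldenRatio ^ j)⁻¹ * ((n : ℝ) - m))) ?_ ?_
  · exact key (j + 1) u h1.1 h2.1
  · rw [e3]
    exact key j v h1.2 h2.2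

/-- Smooth a function on the N × N grid of the torus with a product of two Fejér weights.
Coefficients total at most N², and frequencies reach 2N(F_(j+1) + F_j). At a typical n only grid
points far from n give the wrong value, with mass 1/(Nε²) per coordinate. -/
theorem exists_approximant {ε : ℝ} (hε0 : 0 < ε) (hε : ε ≤ 1 / 100) {j N : ℕ} (hN : 0 < N)
    (hk : (goldenRatio ^ j)⁻¹ ≤ ε) :
    ∃ g : ℕ → ℝ, (∀ n, 0 ≤ g n ∧ g n ≤ 1) ∧
      TrigBdd ((N : ℝ) ^ 2) (2 * N * Nat.fib (j + 2)) (fun n => (g n : ℂ)) ∧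
      ∀ n, Typical (10 * ε) (j + 1) n → |g n - digit (j + 1) n| ≤ 2 / (N * ε ^ 2) := by
  classical
  -- The value at a grid point is the digit of any typical integer near it. It is well defined by
  -- `Near.digit_eq`; the default is 0 when there is no such integer.
  let c : ℕ → ℕ → ℝ := fun u v =>
    if ∃ m, Typical (10 * ε) (j + 1) m ∧ digit (j + 1) m = 1 ∧ Near ε j N m u v then 1 else 0
  have hc0 : ∀ u v, 0 ≤ c u v := fun u v => by
    simp only [c]
    split_ifs <;> norm_num
  have hc1 : ∀ u v, c u v ≤ 1 := fun u v => by
    simp only [c]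
    split_ifs <;> norm_num
  let w₁ : ℕ → ℕ → ℝ := fun n u => fejerWeight N (Nat.fib (j + 1) * goldenRatio * n) u
  let w₂ : ℕ → ℕ → ℝ := fun n v => fejerWeight N (Nat.fib j * goldenRatio * n) v
  have hw₁ : ∀ n u, 0 ≤ w₁ n u := fun n u => fejerWeight_nonneg _ _ _
  have hw₂ : ∀ n u, 0 ≤ w₂ n u := fun n u => fejerWeight_nonneg _ _ _
  have hs₁ : ∀ n, ∑ u ∈ Finset.range N, w₁ n u = 1 := fun n => sum_fejerWeight hN _
  have hs₂ : ∀ n, ∑ u ∈ Finset.range N, w₂ n u = 1 := fun n => sum_fejerWeight hN _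
  have hs : ∀ n, ∑ u ∈ Finset.range N, ∑ v ∈ Finset.range N, w₁ n u * w₂ n v = 1 := fun n => by
    rw [← Finset.sum_mul_sum, hs₁, hs₂, one_mul]
  refine ⟨fun n => ∑ u ∈ Finset.range N, ∑ v ∈ Finset.range N, c u v * (w₁ n u * w₂ n v),
    fun n => ⟨?_, ?_⟩, ?_, fun n hn => ?_⟩
  · exact Finset.sum_nonneg fun u _ => Finset.sum_nonneg fun v _ =>
      mul_nonneg (hc0 u v) (mul_nonneg (hw₁ n u) (hw₂ n v))
  · rw [← hs n]
    exact Finset.sum_le_sum fun u _ => Finset.sum_le_sum fun v _ =>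
      mul_le_of_le_one_left (mul_nonneg (hw₁ n u) (hw₂ n v)) (hc1 u v)
  · have h1 : ∀ u v, TrigBdd 1 (2 * N * Nat.fib (j + 2))
        fun n => (c u v : ℂ) * ((w₁ n u : ℂ) * (w₂ n v : ℂ)) := by
      intro u v
      refine ((trigBdd_const (c u v : ℂ)).mul ((trigBdd_fejerWeight N (Nat.fib (j + 1)) u).mul
        (trigBdd_fejerWeight N (Nat.fib j) v))).mono ?_ (le_of_eq ?_)
      · rw [Complex.norm_real, Real.norm_of_nonneg (hc0 u v), mul_one, mul_one]
        exact hc1 u v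
      · rw [Nat.fib_add_two]
        push_cast
        ring
    have h2 := TrigBdd.sum (Finset.range N) (by positivity) fun u _ =>
      TrigBdd.sum (Finset.range N) (by positivity) fun v _ => h1 u v
    simp only [Finset.sum_const, Finset.card_range, nsmul_eq_mul, mul_one] at h2
    rw [← sq] at h2
    convert h2 using 2 with n
    push_cast
    rfl
  · have hδ0 : (0 : ℝ) ≤ digit (j + 1) n := Nat.cast_nonneg _
    have hδ1 : (digit (j + 1) n : ℝ) ≤ 1 := by
      rcases digit_eq_zero_or_one (j + 1) n with h | h <;> rw [h] <;> norm_num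
    let f₁ : ℕ → ℝ := fun u =>
      if ¬ nd (Nat.fib (j + 1) * goldenRatio * n - u / N) ≤ ε / 2 then 1 else 0
    let f₂ : ℕ → ℝ := fun v =>
      if ¬ nd (Nat.fib j * goldenRatio * n - v / N) ≤ ε / 2 then 1 else 0
    have hcδ : ∀ u v, |c u v - digit (j + 1) n| ≤ f₁ u + f₂ v := by
      intro u v
      have hle : |c u v - digit (j + 1) n| ≤ 1 := by
        rw [abs_le]
        constructor <;> linarith [hc0 u v, hc1 u v]
      have hf₁ : 0 ≤ f₁ u := by simp only [f₁]; split_ifs <;> norm_num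
      have hf₂ : 0 ≤ f₂ v := by simp only [f₂]; split_ifs <;> norm_num
      by_cases a : nd (Nat.fib (j + 1) * goldenRatio * n - u / N) ≤ ε / 2
      · by_cases b : nd (Nat.fib j * goldenRatio * n - v / N) ≤ ε / 2
        · have hnear : Near ε j N n u v := ⟨a, b⟩
          have : c u v = digit (j + 1) n := by
            simp only [c]
            split_ifs with h
            · obtain ⟨m, m1, m2, m3⟩ := h
              rw [Near.digit_eq hε0 hε hk hn m1 hnear m3, m2, Nat.cast_one]
            · rcases digit_eq_zero_or_one (j + 1) n with h0 | h0
              · rw [h0, Nat.cast_zero]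
              · exact absurd ⟨n, hn, h0, hnear⟩ h
          rw [this, sub_self, abs_zero]
          exact add_nonneg hf₁ hf₂
        · have : f₂ v = 1 := if_pos b
          linarith
      · have : f₁ u = 1 := if_pos a
        linarith
    have h1 : (∑ u ∈ Finset.range N, ∑ v ∈ Finset.range N, c u v * (w₁ n u * w₂ n v)) -
        digit (j + 1) n = ∑ u ∈ Finset.range N, ∑ v ∈ Finset.range N,
          (c u v - digit (j + 1) n) * (w₁ n u * w₂ n v) := by
      simp only [sub_mul, Finset.sum_sub_distrib]
      simp only [← Finset.mul_sum, ← Finset.sum_mul, hs₁, hs₂]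
      ring
    rw [h1]
    have h2 : |∑ u ∈ Finset.range N, ∑ v ∈ Finset.range N,
        (c u v - digit (j + 1) n) * (w₁ n u * w₂ n v)| ≤
        ∑ u ∈ Finset.range N, ∑ v ∈ Finset.range N, (f₁ u + f₂ v) * (w₁ n u * w₂ n v) := by
      refine (Finset.abs_sum_le_sum_abs _ _).trans (Finset.sum_le_sum fun u _ =>
        (Finset.abs_sum_le_sum_abs _ _).trans (Finset.sum_le_sum fun v _ => ?_))
      rw [abs_mul, abs_of_nonneg (mul_nonneg (hw₁ n u) (hw₂ n v))]
      exact mul_le_mul_of_nonneg_right (hcδ u v) (mul_nonneg (hw₁ n u) (hw₂ n v))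
    refine h2.trans ?_
    have h3 : ∑ u ∈ Finset.range N, ∑ v ∈ Finset.range N, (f₁ u + f₂ v) * (w₁ n u * w₂ n v) =
        ∑ u ∈ Finset.range N, f₁ u * w₁ n u + ∑ v ∈ Finset.range N, f₂ v * w₂ n v := by
      have e : ∀ u v, (f₁ u + f₂ v) * (w₁ n u * w₂ n v) =
          (f₁ u * w₁ n u) * w₂ n v + w₁ n u * (f₂ v * w₂ n v) := fun u v => by ring
      simp only [e, Finset.sum_add_distrib, ← Finset.sum_mul_sum, hs₁, hs₂, one_mul, mul_one]
    have h4 := sum_fejerWeight_far_le hN (Nat.fib (j + 1) * goldenRatio * n) hε0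
    have h5 := sum_fejerWeight_far_le hN (Nat.fib j * goldenRatio * n) hε0
    rw [Finset.sum_filter] at h4 h5
    have h6 : ∑ u ∈ Finset.range N, f₁ u * w₁ n u ≤ 1 / (N * ε ^ 2) := by
      refine le_trans (Finset.sum_le_sum fun u _ => ?_) h4
      simp only [f₁, w₁, ite_mul, one_mul, zero_mul]
      exact le_rfl
    have h7 : ∑ v ∈ Finset.range N, f₂ v * w₂ n v ≤ 1 / (N * ε ^ 2) := by
      refine le_trans (Finset.sum_le_sum fun v _ => ?_) h5
      simp only [f₂, w₂, ite_mul, one_mul, zero_mul]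
      exact le_rfl
    rw [h3]
    have : 2 / (N * ε ^ 2) = 1 / (N * ε ^ 2) + 1 / (N * ε ^ 2) := by ring
    linarith

/-! ### Expectations of products along the Markov chain -/

section chain

variable {Ω : Type*} [MeasurableSpace Ω] {P : Measure Ω}
  {Z : ℕ → Ω → Fin 2}

/-- The expectation of `∏_{i ≤ j} w i (Z i)` on the event `Z j = a`. -/
def chainFun (P : Measure Ω) (Z : ℕ → Ω → Fin 2) (w : ℕ → Fin 2 → ℝ) (j : ℕ) (a : Fin 2) : ℝ :=
  ∫ ω, (∏ i ∈ Finset.range (j + 1), w i (Z i ω)) * (if Z j ω = a then 1 else 0) ∂P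

theorem IsDigitChain.measurable_path (h : IsDigitChain P Z) (j : ℕ) :
    Measurable fun ω => fun i : Fin (j + 1) => Z i ω :=
  measurable_pi_lambda _ fun i => h.measurable i

theorem IsDigitChain.integrable_comp_path [IsProbabilityMeasure P] (h : IsDigitChain P Z) (j : ℕ)
    (F : (Fin (j + 1) → Fin 2) → ℝ) : Integrable (fun ω => F fun i => Z i ω) P := by
  have hm : Measurable fun ω => F fun i => Z i ω := (measurable_of_finite F).comp (h.measurable_path j)
  refine Integrable.of_bound hm.aestronglyMeasurable (∑ s, ‖F s‖) (Filter.Eventually.of_forall fun ω => ?_)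
  exact Finset.single_le_sum (f := fun s => ‖F s‖) (fun _ _ => norm_nonneg _) (Finset.mem_univ _)

theorem IsDigitChain.integrable_prod [IsProbabilityMeasure P] (h : IsDigitChain P Z) (w : ℕ → Fin 2 → ℝ) (j : ℕ)
    (f : Fin 2 → ℝ) :
    Integrable (fun ω => (∏ i ∈ Finset.range (j + 1), w i (Z i ω)) * f (Z j ω)) P := by
  have := h.integrable_comp_path j fun s => (∏ i : Fin (j + 1), w i (s i)) * f (s (Fin.last j))
  refine this.congr (Filter.Eventually.of_forall fun ω => ?_)
  dsimp only
  rw [Finset.prod_range]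
  rfl

/-- The Markov property for an arbitrary function of the past, obtained by splitting into the
finitely many paths. -/
theorem IsDigitChain.integral_mul_ite_succ [IsProbabilityMeasure P] (h : IsDigitChain P Z) (j : ℕ)
    (F : (Fin (j + 1) → Fin 2) → ℝ) (b : Fin 2) :
    ∫ ω, F (fun i => Z i ω) * (if Z (j + 1) ω = b then 1 else 0) ∂P =
      ∫ ω, F (fun i => Z i ω) * transition (Z j ω) b ∂P := by
  classical
  have hpath : ∀ s : Fin (j + 1) → Fin 2, MeasurableSet {ω | (fun i : Fin (j + 1) => Z i ω) = s} :=
    fun s => h.measurable_path j (measurableSet_singleton s)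
  have hZ : MeasurableSet {ω | Z (j + 1) ω = b} := h.measurable (j + 1) (measurableSet_singleton b)
  have e1 : ∀ ω, F (fun i => Z i ω) * (if Z (j + 1) ω = b then 1 else 0) =
      ∑ s, Set.indicator ({ω | (fun i : Fin (j + 1) => Z i ω) = s} ∩ {ω | Z (j + 1) ω = b})
        (fun _ => F s) ω := by
    intro ω
    rw [Finset.sum_eq_single (fun i : Fin (j + 1) => Z i ω)]
    · simp [Set.indicator_apply]
    · intro s _ hs
      rw [Set.indicator_of_notMem]
      exact fun hmem => hs hmem.1.symm
    · simp
  have e2 : ∀ ω, F (fun i => Z i ω) * transition (Z j ω) b =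
      ∑ s, Set.indicator {ω | (fun i : Fin (j + 1) => Z i ω) = s}
        (fun _ => F s * transition (s (Fin.last j)) b) ω := by
    intro ω
    rw [Finset.sum_eq_single (fun i : Fin (j + 1) => Z i ω)]
    · simp
    · intro s _ hs
      rw [Set.indicator_of_notMem]
      exact fun hmem => hs hmem.symm
    · simp
  simp_rw [e1, e2]
  rw [integral_finsetSum _ fun s _ => (integrable_const _).indicator ((hpath s).inter hZ),
    integral_finsetSum _ fun s _ => (integrable_const _).indicator (hpath s)]
  refine Finset.sum_congr rfl fun s _ => ?_
  rw [integral_indicator_const _ ((hpath s).inter hZ), integral_indicator_const _ (hpath s),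
    smul_eq_mul, smul_eq_mul]
  -- The path s is continued by the value b, so that one infinite sequence encodes both cylinders.
  have h1 := h.step j fun i => if hi : i < j + 1 then s ⟨i, hi⟩ else b
  have s1 : {ω | ∀ i ≤ j + 1, Z i ω = if hi : i < j + 1 then s ⟨i, hi⟩ else b} =
      {ω | (fun i : Fin (j + 1) => Z i ω) = s} ∩ {ω | Z (j + 1) ω = b} := by
    ext ω
    simp only [Set.mem_ofPred_eq, Set.mem_inter_iff, funext_iff]
    constructor
    · intro hω
      refine ⟨fun i => ?_, by simpa using hω (j + 1) le_rfl⟩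
      have := hω i (by omega)
      rwa [dif_pos i.2] at this
    · rintro ⟨h1, h2⟩ i hi
      by_cases hij : i < j + 1
      · rw [dif_pos hij]
        exact h1 ⟨i, hij⟩
      · rw [dif_neg hij]
        have : i = j + 1 := by omega
        rw [this]
        exact h2
  have s2 : {ω | ∀ i ≤ j, Z i ω = if hi : i < j + 1 then s ⟨i, hi⟩ else b} =
      {ω | (fun i : Fin (j + 1) => Z i ω) = s} := by
    ext ω
    simp only [Set.mem_ofPred_eq, funext_iff]
    constructor
    · intro hω i
      have := hω i (by omega)
      rwa [dif_pos i.2] at this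
    · intro h1 i hi
      rw [dif_pos (by omega)]
      exact h1 ⟨i, by omega⟩
  rw [s1, s2, dif_pos (Nat.lt_succ_self j), dif_neg (lt_irrefl _)] at h1
  rw [h1]
  have : (⟨j, Nat.lt_succ_self j⟩ : Fin (j + 1)) = Fin.last j := rfl
  rw [this]
  ring

theorem IsDigitChain.integral_prod_eq [IsProbabilityMeasure P] (h : IsDigitChain P Z) (w : ℕ → Fin 2 → ℝ) (j : ℕ)
    (f : Fin 2 → ℝ) :
    ∫ ω, (∏ i ∈ Finset.range (j + 1), w i (Z i ω)) * f (Z j ω) ∂P =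
      chainFun P Z w j 0 * f 0 + chainFun P Z w j 1 * f 1 := by
  have e : ∀ ω, (∏ i ∈ Finset.range (j + 1), w i (Z i ω)) * f (Z j ω) =
      (∏ i ∈ Finset.range (j + 1), w i (Z i ω)) * (if Z j ω = 0 then 1 else 0) * f 0 +
      (∏ i ∈ Finset.range (j + 1), w i (Z i ω)) * (if Z j ω = 1 then 1 else 0) * f 1 := by
    intro ω
    rcases (by decide : ∀ c : Fin 2, c = 0 ∨ c = 1) (Z j ω) with hc | hc <;> rw [hc] <;> simp
  simp_rw [e]
  rw [integral_add ((h.integrable_prod w j fun c => if c = 0 then 1 else 0).mul_const _)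
    ((h.integrable_prod w j fun c => if c = 1 then 1 else 0).mul_const _), integral_mul_const,
    integral_mul_const]
  rfl

theorem IsDigitChain.chainFun_succ [IsProbabilityMeasure P] (h : IsDigitChain P Z) (w : ℕ → Fin 2 → ℝ) (j : ℕ) (b : Fin 2) :
    chainFun P Z w (j + 1) b = w (j + 1) b *
      (chainFun P Z w j 0 * transition 0 b + chainFun P Z w j 1 * transition 1 b) := by
  rw [← h.integral_prod_eq w j fun a => transition a b, chainFun]
  have e : ∀ ω, (∏ i ∈ Finset.range (j + 1 + 1), w i (Z i ω)) *
      (if Z (j + 1) ω = b then 1 else 0) =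
      w (j + 1) b * ((∏ i ∈ Finset.range (j + 1), w i (Z i ω)) *
        (if Z (j + 1) ω = b then 1 else 0)) := by
    intro ω
    rw [Finset.prod_range_succ]
    split_ifs with hb
    · rw [hb]
      ring
    · simp
  simp_rw [e]
  rw [integral_const_mul]
  congr 1
  have := h.integral_mul_ite_succ j (fun s => ∏ i : Fin (j + 1), w i (s i)) b
  simpa only [Finset.prod_range] using this

theorem IsDigitChain.chainFun_zero (h : IsDigitChain P Z) (w : ℕ → Fin 2 → ℝ) (a : Fin 2) :
    chainFun P Z w 0 a = w 0 a * initialLaw a := by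
  rw [chainFun, ← h.initial a]
  have hm : MeasurableSet {ω | Z 0 ω = a} := h.measurable 0 (measurableSet_singleton a)
  have e : ∀ ω, (∏ i ∈ Finset.range (0 + 1), w i (Z i ω)) * (if Z 0 ω = a then 1 else 0) =
      Set.indicator {ω | Z 0 ω = a} (fun _ => w 0 a) ω := by
    intro ω
    simp only [zero_add, Finset.prod_range_one, Set.indicator_apply, Set.mem_ofPred_eq]
    split_ifs with hb
    · rw [hb, mul_one]
    · rw [mul_zero]
  simp_rw [e]
  rw [integral_indicator_const _ hm, smul_eq_mul, mul_comm]

theorem transition_eq : transition 0 0 = 1 / goldenRatio ∧ transition 0 1 = 1 / goldenRatio ^ 2 ∧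
    transition 1 0 = 1 ∧ transition 1 1 = 0 := ⟨rfl, rfl, rfl, rfl⟩

theorem initialLaw_eq : initialLaw 0 = goldenRatio / √5 ∧ initialLaw 1 = 1 / (goldenRatio * √5) := by
  have hsq := goldenRatio_sq
  have h5 := sqrt_five_eq
  have hpos := goldenRatio_pos
  have h1 : goldenRatio ^ 2 + 1 = goldenRatio * √5 := by
    rw [h5]
    linear_combination -hsq
  have h50 : (0 : ℝ) < √5 := by positivity
  constructor
  · change goldenRatio ^ 2 / (goldenRatio ^ 2 + 1) = _
    rw [h1]
    field_simp
  · change 1 / (goldenRatio ^ 2 + 1) = _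
    rw [h1]

end chain

/-! ### Digits of random integers and the Markov chain -/

/-- The sum of `∏_{k < j} w k (δ_k(n))` over `n < F_j`. -/
def digitWeight (w : ℕ → ℕ → ℝ) (j : ℕ) : ℝ :=
  ∑ n ∈ Finset.range (Nat.fib j), ∏ k ∈ Finset.range j, w k (digit k n)

/-- Integers below F_(j+2) either lie below F_(j+1) or have leading term F_(j+1), and in the second
case the digit at j is forced to be 0. -/
theorem digitWeight_add_two (w : ℕ → ℕ → ℝ) (j : ℕ) :
    digitWeight w (j + 2) = w (j + 1) 0 * digitWeight w (j + 1) +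
      w (j + 1) 1 * (w j 0 * digitWeight w j) := by
  simp only [digitWeight]
  have h2 : Nat.fib (j + 2) = Nat.fib (j + 1) + Nat.fib j := by rw [Nat.fib_add_two, add_comm]
  rw [h2, Finset.sum_range_add, Finset.mul_sum, Finset.mul_sum, Finset.mul_sum]
  congr 1
  · refine Finset.sum_congr rfl fun n hn => ?_
    rw [Finset.prod_range_succ, digit_eq_zero_of_lt (Finset.mem_range.1 hn) le_rfl, mul_comm]
  · refine Finset.sum_congr rfl fun n hn => ?_
    have hn := Finset.mem_range.1 hn
    rw [Finset.prod_range_succ, Finset.prod_range_succ, digit_fib_add_self hn,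
      digit_fib_add_of_ne hn (by omega), digit_eq_zero_of_lt hn le_rfl]
    have : ∏ k ∈ Finset.range j, w k (digit k (Nat.fib (j + 1) + n)) =
        ∏ k ∈ Finset.range j, w k (digit k n) := by
      refine Finset.prod_congr rfl fun k hk => ?_
      rw [digit_fib_add_of_ne hn]
      have := Finset.mem_range.1 hk
      omega
    rw [this]
    ring

theorem digitWeight_eq_fib {w : ℕ → ℕ → ℝ} {j : ℕ} (h : ∀ k < j, ∀ b, w k b = 1) :
    digitWeight w j = Nat.fib j := by
  rw [digitWeight, Finset.sum_congr rfl fun n _ => Finset.prod_eq_one fun k hk =>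
    h k (Finset.mem_range.1 hk) _]
  simp

theorem inv_goldenRatio_eq : goldenRatio⁻¹ = goldenRatio - 1 := by
  rw [inv_goldenRatio, goldenConj_eq]
  ring

theorem abs_fib_sub_le (j : ℕ) :
    |(Nat.fib j : ℝ) - goldenRatio ^ j / √5| = (goldenRatio ^ j)⁻¹ / √5 := by
  have h : (Nat.fib j : ℝ) - goldenRatio ^ j / √5 = -(goldenConj ^ j / √5) := by
    rw [coe_fib_eq]
    ring
  have h2 : |goldenConj| = goldenRatio⁻¹ := by
    rw [inv_goldenRatio, abs_of_neg goldenConj_neg]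
  rw [h, abs_neg, abs_div, abs_pow, h2, abs_of_pos (by positivity : (0 : ℝ) < √5), inv_pow]

/-- Separates the total mass u + v from the defect φ²v - u, which vanishes for the stationary law;
the coefficient 5 - 3φ arises from φ² = φ + 1. -/
theorem goldenRatio_stationary_identity (p u v : ℝ) :
    (p * u + p * goldenRatio * v) / goldenRatio = p * goldenRatio / (2 * goldenRatio - 1) *
      (u + v + (goldenRatio ^ 2 * v - u) * (5 - 3 * goldenRatio)) := by
  have hpos := goldenRatio_pos
  have hsq := goldenRatio_sq
  have h1 := one_lt_goldenRatio
  have h2 : 0 < 2 * goldenRatio - 1 := by linarith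
  generalize goldenRatio = g at *
  have e : (2 * g - 1) * (u + g * v) = g ^ 2 * (u + v + (g ^ 2 * v - u) * (5 - 3 * g)) := by
    linear_combination (-(3 * g - 1) * u + g * (3 * g ^ 2 - 2 * g + 1) * v) * hsq
  rw [div_eq_iff hpos.ne', div_mul_eq_mul_div, div_mul_eq_mul_div, eq_div_iff h2.ne']
  linear_combination p * e

section chain

variable {Ω : Type*} [MeasurableSpace Ω] {P : Measure Ω} [IsProbabilityMeasure P]
  {Z : ℕ → Ω → Fin 2}

/-- Stationarity of the initial law. -/
theorem IsDigitChain.chainFun_one (h : IsDigitChain P Z) {w : ℕ → Fin 2 → ℝ} {j : ℕ}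
    (hw : ∀ k ≤ j, ∀ b, w k b = 1) (a : Fin 2) : chainFun P Z w j a = initialLaw a := by
  obtain ⟨i0, i1⟩ := initialLaw_eq
  obtain ⟨t00, t01, t10, t11⟩ := transition_eq
  have hpos := goldenRatio_pos
  have h50 : (0 : ℝ) < √5 := by positivity
  have hsq := goldenRatio_sq
  induction j generalizing a with
  | zero => rw [h.chainFun_zero, hw 0 le_rfl, one_mul]
  | succ j ih =>
    have ih := ih fun k hk => hw k (by omega)
    rw [h.chainFun_succ, hw _ le_rfl, one_mul, ih, ih]
    rcases (by decide : ∀ c : Fin 2, c = 0 ∨ c = 1) a with rfl | rfl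
    · rw [i0, i1, t00, t10]
      generalize goldenRatio = g at hpos hsq ⊢
      field_simp
      linear_combination -hsq
    · rw [i0, i1, t01, t11]
      generalize goldenRatio = g at hpos hsq ⊢
      field_simp
      ring

/-- After scaling by φ^j in state 0 and φ^(j+1) in state 1 the transition probabilities cancel, and
the chain obeys the recursion of the digit weights. With nonnegative weights a relative error is not
amplified, so the initial one, φ^(-2m) from Binet's formula, persists. -/
theorem IsDigitChain.digitWeight_bounds (h : IsDigitChain P Z) {w : ℕ → ℕ → ℝ}
    (hw0 : ∀ k b, 0 ≤ w k b) {m : ℕ} (hw : ∀ k ≤ m + 1, ∀ b, w k b = 1) {j : ℕ} (hj : m + 1 ≤ j) :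
    |digitWeight w (j + 1) - (goldenRatio ^ j * chainFun P Z (fun i b => w i b) j 0 +
        goldenRatio ^ (j + 1) * chainFun P Z (fun i b => w i b) j 1) / goldenRatio| ≤
      (goldenRatio ^ (2 * m))⁻¹ * ((goldenRatio ^ j * chainFun P Z (fun i b => w i b) j 0 +
        goldenRatio ^ (j + 1) * chainFun P Z (fun i b => w i b) j 1) / goldenRatio) := by
  obtain ⟨t00, t01, t10, t11⟩ := transition_eq
  obtain ⟨i0, i1⟩ := initialLaw_eq
  have hpos := goldenRatio_pos
  have h50 : (0 : ℝ) < √5 := by positivity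
  set V := chainFun P Z fun i b => w i b with hV
  set ρ := (goldenRatio ^ (2 * m))⁻¹ with hρ
  -- the two parts of `digitWeight w (j + 2)`
  suffices H : ∀ i, |w (m + 1 + i) 0 * digitWeight w (m + 1 + i) -
        goldenRatio ^ (m + 1 + i) * V (m + 1 + i) 0 / goldenRatio| ≤
        ρ * (goldenRatio ^ (m + 1 + i) * V (m + 1 + i) 0 / goldenRatio) ∧
      |w (m + 1 + i) 1 * (w (m + i) 0 * digitWeight w (m + i)) -
        goldenRatio ^ (m + 2 + i) * V (m + 1 + i) 1 / goldenRatio| ≤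
        ρ * (goldenRatio ^ (m + 2 + i) * V (m + 1 + i) 1 / goldenRatio) by
    obtain ⟨i, rfl⟩ := Nat.exists_eq_add_of_le hj
    obtain ⟨H1, H2⟩ := H i
    have e1 : m + 1 + i + 1 = m + i + 2 := by ring
    have e2 : m + i + 1 = m + 1 + i := by ring
    have e3 : m + i + 2 = m + 2 + i := by ring
    rw [e1, digitWeight_add_two, e2, e3, add_div, mul_add]
    refine le_trans (le_trans (le_of_eq ?_) (abs_add_le _ _)) (add_le_add H1 H2)
    congr 1
    ring
  intro i
  induction i with
  | zero =>
    simp only [add_zero]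
    have hV0 : ∀ a, V (m + 1) a = initialLaw a := h.chainFun_one fun k hk b => hw k hk b
    rw [hw _ le_rfl, hw _ le_rfl, hw _ (by omega : m ≤ m + 1), one_mul, one_mul, one_mul,
      digitWeight_eq_fib fun k hk => hw k (by omega), digitWeight_eq_fib fun k hk => hw k (by omega),
      hV0, hV0, i0, i1]
    have e1 : goldenRatio ^ (m + 1) * (goldenRatio / √5) / goldenRatio = goldenRatio ^ (m + 1) / √5 := by
      field_simp
    have e2 : goldenRatio ^ (m + 2) * (1 / (goldenRatio * √5)) / goldenRatio = goldenRatio ^ m / √5 := by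
      generalize goldenRatio = g at hpos ⊢
      field_simp
      ring
    rw [e1, e2, abs_fib_sub_le, abs_fib_sub_le]
    have e3 : ρ * goldenRatio ^ m = (goldenRatio ^ m)⁻¹ := by
      rw [hρ, two_mul, pow_add]
      field_simp
    have e4 : ρ * goldenRatio ^ (m + 1) = (goldenRatio ^ m)⁻¹ * goldenRatio := by
      rw [pow_succ, ← mul_assoc, e3]
    constructor
    · rw [← mul_div_assoc, e4, pow_succ, mul_inv]
      have := one_lt_goldenRatio
      gcongr
      exact (inv_le_one_of_one_le₀ this.le).trans this.le
    · rw [← mul_div_assoc, e3]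
  | succ i ih =>
    obtain ⟨H1, H2⟩ := ih
    have s0 : V (m + 1 + i + 1) 0 = w (m + 1 + i + 1) 0 * (V (m + 1 + i) 0 / goldenRatio +
        V (m + 1 + i) 1) := by
      rw [hV, h.chainFun_succ, t00, t10]
      simp only [Fin.val_zero]
      ring
    have s1 : V (m + 1 + i + 1) 1 = w (m + 1 + i + 1) 1 * (V (m + 1 + i) 0 / goldenRatio ^ 2) := by
      rw [hV, h.chainFun_succ, t01, t11]
      simp only [Fin.val_one]
      ring
    have e1 : m + 1 + (i + 1) = m + 1 + i + 1 := by ring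
    have e2 : m + 2 + (i + 1) = m + 1 + i + 2 := by ring
    have e3 : m + (i + 1) = m + 1 + i := by ring
    have e4 : m + 2 + i = m + 1 + i + 1 := by ring
    rw [e4] at H2
    rw [e1, e2, e3, s0, s1]
    set k := m + 1 + i with hk
    have hd : digitWeight w (k + 1) = w k 0 * digitWeight w k +
        w k 1 * (w (m + i) 0 * digitWeight w (m + i)) := by
      have : k + 1 = m + i + 2 := by omega
      have e5 : m + i + 1 = k := by omega
      rw [this, digitWeight_add_two, e5]
    constructor
    · rw [hd]
      have a1 : goldenRatio ^ (k + 1) * (w (k + 1) 0 * (V k 0 / goldenRatio + V k 1)) / goldenRatio =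
          w (k + 1) 0 * (goldenRatio ^ k * V k 0 / goldenRatio +
            goldenRatio ^ (k + 1) * V k 1 / goldenRatio) := by
        rw [pow_succ]
        field_simp
      rw [a1, ← mul_sub, abs_mul, abs_of_nonneg (hw0 _ _), mul_left_comm ρ]
      refine mul_le_mul_of_nonneg_left ?_ (hw0 _ _)
      rw [mul_add]
      refine le_trans (le_trans (le_of_eq ?_) (abs_add_le _ _)) (add_le_add H1 H2)
      congr 1
      ring
    · have a1 : goldenRatio ^ (k + 2) * (w (k + 1) 1 * (V k 0 / goldenRatio ^ 2)) / goldenRatio =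
          w (k + 1) 1 * (goldenRatio ^ k * V k 0 / goldenRatio) := by
        rw [pow_add]
        field_simp
      rw [a1, ← mul_sub, abs_mul, abs_of_nonneg (hw0 _ _), mul_left_comm ρ]
      exact mul_le_mul_of_nonneg_left H1 (hw0 _ _)

omit [IsProbabilityMeasure P] in
theorem chainFun_nonneg {w : ℕ → Fin 2 → ℝ} (hw : ∀ k b, 0 ≤ w k b) (j : ℕ) (a : Fin 2) :
    0 ≤ chainFun P Z w j a :=
  integral_nonneg fun ω => mul_nonneg (Finset.prod_nonneg fun i _ => hw _ _) (by split_ifs <;> simp)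

theorem IsDigitChain.integral_prod_eq_add (h : IsDigitChain P Z) (w : ℕ → Fin 2 → ℝ) (j : ℕ) :
    ∫ ω, ∏ i ∈ Finset.range (j + 1), w i (Z i ω) ∂P = chainFun P Z w j 0 + chainFun P Z w j 1 := by
  have := h.integral_prod_eq w j fun _ => 1
  simpa using this

theorem IsDigitChain.integral_prod_le_one (h : IsDigitChain P Z) {w : ℕ → Fin 2 → ℝ}
    (hw : ∀ k b, 0 ≤ w k b) (hw1 : ∀ k b, w k b ≤ 1) (j : ℕ) :
    chainFun P Z w j 0 + chainFun P Z w j 1 ≤ 1 := by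
  rw [← h.integral_prod_eq_add]
  have h1 : Integrable (fun ω => ∏ i ∈ Finset.range (j + 1), w i (Z i ω)) P := by
    have := h.integrable_prod w j fun _ => 1
    simpa using this
  calc _ ≤ ∫ _, (1 : ℝ) ∂P := integral_mono h1 (integrable_const _) fun ω =>
        Finset.prod_le_one (fun i _ => hw _ _) fun i _ => hw1 _ _
    _ = 1 := by simp

/-- Where the weights are trivial the chain approaches its stationary law. -/
theorem IsDigitChain.chainFun_add (h : IsDigitChain P Z) {w : ℕ → Fin 2 → ℝ} {K : ℕ}
    (hw : ∀ k > K, ∀ b, w k b = 1) (i : ℕ) :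
    chainFun P Z w (K + i) 0 + chainFun P Z w (K + i) 1 =
        chainFun P Z w K 0 + chainFun P Z w K 1 ∧
      goldenRatio ^ 2 * chainFun P Z w (K + i) 1 - chainFun P Z w (K + i) 0 =
        (-(goldenRatio ^ 2)⁻¹) ^ i *
          (goldenRatio ^ 2 * chainFun P Z w K 1 - chainFun P Z w K 0) := by
  obtain ⟨t00, t01, t10, t11⟩ := transition_eq
  have hpos := goldenRatio_pos
  have hsq := goldenRatio_sq
  have hi1 : 1 / goldenRatio = goldenRatio - 1 := by rw [one_div, inv_goldenRatio_eq]
  have hi2 : 1 / goldenRatio ^ 2 = 2 - goldenRatio := by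
    rw [one_div, ← inv_pow, inv_goldenRatio_eq]
    linear_combination hsq
  induction i with
  | zero => simp
  | succ i ih =>
    obtain ⟨h1, h2⟩ := ih
    rw [← add_assoc, h.chainFun_succ, h.chainFun_succ, hw _ (by omega), hw _ (by omega), one_mul,
      one_mul, t00, t01, t10, t11, pow_succ _ i, mul_right_comm, ← h1, ← h2, ← one_div, hi1, hi2]
    set u := chainFun P Z w (K + i) 0
    set v := chainFun P Z w (K + i) 1
    constructor
    · ring
    · linear_combination ((1 - goldenRatio) * (u + v)) * hsq

set_option maxHeartbeats 800000 in
/-- The joint law of digits of a random integer `n < F_J` is close to the one of the chain. -/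
theorem IsDigitChain.abs_avg_digit_sub_le (h : IsDigitChain P Z) {S : Finset ℕ} {m K J : ℕ}
    (hm : 4 ≤ m) (hS : ∀ k ∈ S, m ≤ k ∧ k ≤ K) (hJ : K + m + 1 ≤ J) (hmK : m ≤ K) :
    |(1 / (Nat.fib J : ℝ)) * ∑ n ∈ Finset.range (Nat.fib J), ∏ k ∈ S, (digit k n : ℝ) -
      ∫ ω, ∏ k ∈ S, (((Z k ω : Fin 2) : ℕ) : ℝ) ∂P| ≤ 8 * (goldenRatio ^ m)⁻¹ := by
  classical
  -- Truncation at 1 keeps the weights in [0, 1] for all natural b; on digits it changes nothing.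
  set w : ℕ → ℕ → ℝ := fun k b => if k ∈ S then (min b 1 : ℕ) else 1 with hw
  have hw0 : ∀ k b, 0 ≤ w k b := fun k b => by
    simp only [hw]
    split_ifs <;> positivity
  have hw1 : ∀ k b, w k b ≤ 1 := fun k b => by
    simp only [hw]
    split_ifs
    · exact_mod_cast min_le_right _ _
    · exact le_rfl
  -- The recursion starts at m - 2 so that all weights up to m - 1 are trivial; 2(m - 2) ≥ m then
  -- uses m ≥ 4.
  have hwlow : ∀ k ≤ (m - 2) + 1, ∀ b, w k b = 1 := fun k hk b => by
    simp only [hw]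
    rw [if_neg fun hkS => by have := hS k hkS; omega]
  have hwhigh : ∀ k > K, ∀ b : Fin 2, w k b = 1 := fun k hk b => by
    simp only [hw]
    rw [if_neg fun hkS => by have := hS k hkS; omega]
  have hprod : ∀ (f : ℕ → ℕ) (j : ℕ), (∀ k, f k ≤ 1) → K < j →
      ∏ k ∈ Finset.range j, w k (f k) = ∏ k ∈ S, (f k : ℝ) := by
    intro f j hf hj
    simp only [hw]
    rw [Finset.prod_ite_mem, Finset.inter_eq_right.2 fun k hk =>
      Finset.mem_range.2 (by have := hS k hk; omega)]
    exact Finset.prod_congr rfl fun k _ => by rw [min_eq_left (hf k)]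
  have e1 : ∑ n ∈ Finset.range (Nat.fib J), ∏ k ∈ S, (digit k n : ℝ) = digitWeight w J := by
    refine Finset.sum_congr rfl fun n _ => (hprod (fun k => digit k n) J (fun k => ?_) (by omega)).symm
    rcases digit_eq_zero_or_one k n with h | h <;> simp [h]
  set V := chainFun P Z fun i b => w i b with hV
  have e2 : ∫ ω, ∏ k ∈ S, (((Z k ω : Fin 2) : ℕ) : ℝ) ∂P = V K 0 + V K 1 := by
    rw [hV, ← h.integral_prod_eq_add]
    refine integral_congr_ae (Filter.Eventually.of_forall fun ω => ?_)
    exact (hprod (fun k => (Z k ω : ℕ)) (K + 1) (fun k => by omega) (by omega)).symm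
  rw [e1, e2]
  obtain ⟨i, rfl⟩ : ∃ i, J = K + i + 1 := ⟨J - (K + 1), by omega⟩
  have hb := h.digitWeight_bounds hw0 hwlow (j := K + i) (by omega)
  obtain ⟨c1, c2⟩ := h.chainFun_add hwhigh i
  have hV0 : ∀ j a, 0 ≤ V j a := fun j a => chainFun_nonneg (fun k b => hw0 k b) j a
  have hVs : V K 0 + V K 1 ≤ 1 := h.integral_prod_le_one (fun k b => hw0 k b) (fun k b => hw1 k b) K
  rw [← hV] at hb c1 c2
  set s := V K 0 + V K 1 with hs
  set q := (goldenRatio ^ m)⁻¹ with hq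
  obtain ⟨g1, g2⟩ := goldenRatio_bounds
  have hpos := goldenRatio_pos
  have hone := one_lt_goldenRatio
  have hsq := goldenRatio_sq
  have h5 := sqrt_five_eq
  have h50 : (0 : ℝ) < √5 := by positivity
  set E := goldenRatio ^ 2 * V (K + i) 1 - V (K + i) 0 with hE
  have hs0 : 0 ≤ s := add_nonneg (hV0 _ _) (hV0 _ _)
  have hq0 : 0 < q := by positivity
  have hq1 : q ≤ 1 := inv_le_one_of_one_le₀ (one_le_pow₀ hone.le)
  -- Above K the defect shrinks by -φ^(-2) at each step, and there are at least m steps because K +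
  -- m + 1 ≤ J.
  have hEq : |E| ≤ goldenRatio ^ 2 * q := by
    rw [c2, abs_mul, abs_pow, abs_neg, abs_of_pos (by positivity : 0 < (goldenRatio ^ 2)⁻¹), mul_comm]
    refine mul_le_mul ?_ ?_ (by positivity) (by positivity)
    · have := hV0 K 0
      have := hV0 K 1
      rw [abs_le]
      constructor <;> nlinarith
    · rw [inv_pow, hq, ← pow_mul]
      exact inv_anti₀ (by positivity) (pow_le_pow_right₀ hone.le (by omega))
  have hρ : (goldenRatio ^ (2 * (m - 2)))⁻¹ ≤ q :=
    inv_anti₀ (by positivity) (pow_le_pow_right₀ hone.le (by omega))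
  set M := goldenRatio ^ (K + i + 1) / √5 with hM
  have hM0 : 0 < M := by positivity
  have main : (goldenRatio ^ (K + i) * V (K + i) 0 + goldenRatio ^ (K + i + 1) * V (K + i) 1) /
      goldenRatio = M * (s + E * (5 - 3 * goldenRatio)) := by
    rw [← c1, hE, hM, h5, pow_succ]
    exact goldenRatio_stationary_identity _ _ _
  rw [main] at hb
  have hM2 : M ≤ 12 / 10 * Nat.fib (K + i + 1) := by
    have h1 := goldenRatio_pow_le_fib (K + i - 1)
    have e1 : K + i - 1 + 2 = K + i + 1 := by omega
    rw [hM, div_le_iff₀ h50, ← e1, pow_add, hsq, h5]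
    nlinarith
  have hfib : |(Nat.fib (K + i + 1) : ℝ) - M| ≤ M * q := by
    rw [hM, abs_fib_sub_le, div_mul_eq_mul_div]
    gcongr
    calc (goldenRatio ^ (K + i + 1))⁻¹ ≤ q :=
          inv_anti₀ (by positivity) (pow_le_pow_right₀ hone.le (by omega))
      _ ≤ _ := le_mul_of_one_le_left hq0.le (one_le_pow₀ hone.le)
  have hF0 : (0 : ℝ) < Nat.fib (K + i + 1) := by exact_mod_cast Nat.fib_pos.2 (Nat.succ_pos _)
  have key : |digitWeight w (K + i + 1) - Nat.fib (K + i + 1) * s| ≤ M * (6 * q) := by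
    set e := E * (5 - 3 * goldenRatio) with he
    have he1 : |e| ≤ 4 / 10 * q := by
      rw [he, abs_mul, abs_of_pos (by linarith : 0 < 5 - 3 * goldenRatio)]
      calc _ ≤ (goldenRatio ^ 2 * q) * (146 / 1000) :=
            mul_le_mul hEq (by linarith) (by linarith) (by positivity)
        _ ≤ _ := by rw [hsq]; nlinarith
    have hx : (goldenRatio ^ (2 * (m - 2)))⁻¹ * (M * (s + e)) ≤ q * (M * (14 / 10)) := by
      have h1 : s + e ≤ 14 / 10 := by
        have := le_abs_self e
        linarith
      calc _ ≤ (goldenRatio ^ (2 * (m - 2)))⁻¹ * (M * (14 / 10)) := by gcongr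
        _ ≤ _ := by gcongr
    have h1 : digitWeight w (K + i + 1) - Nat.fib (K + i + 1) * s =
        (digitWeight w (K + i + 1) - M * (s + e)) + M * e - (Nat.fib (K + i + 1) - M) * s := by ring
    have h2 : |M * e| ≤ M * (4 / 10 * q) := by
      rw [abs_mul, abs_of_pos hM0]
      gcongr
    have h3 : |((Nat.fib (K + i + 1) : ℝ) - M) * s| ≤ M * q := by
      rw [abs_mul, abs_of_nonneg hs0]
      calc _ ≤ (M * q) * 1 := mul_le_mul hfib hVs hs0 (by positivity)
        _ = _ := mul_one _
    rw [h1]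
    have h4 := abs_sub (digitWeight w (K + i + 1) - M * (s + e) + M * e)
      (((Nat.fib (K + i + 1) : ℝ) - M) * s)
    have h5 := abs_add_le (digitWeight w (K + i + 1) - M * (s + e)) (M * e)
    have h6 : 0 < M * q := by positivity
    linarith
  have e3 : 1 / (Nat.fib (K + i + 1) : ℝ) * digitWeight w (K + i + 1) - s =
      (digitWeight w (K + i + 1) - Nat.fib (K + i + 1) * s) / Nat.fib (K + i + 1) := by
    field_simp
  rw [e3, abs_div, abs_of_pos hF0, div_le_iff₀ hF0]
  nlinarith

end chain

/-! ### The joint law of the digits of random primes -/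

theorem fib_maxLength_le (x : ℝ) : Nat.fib (maxLength x) ≤ ⌊x⌋₊ := by
  rw [maxLength_eq]
  exact Nat.fib_greatestFib_le _

theorem lt_fib_maxLength_add_one (x : ℝ) : ⌊x⌋₊ < Nat.fib (maxLength x + 1) := by
  rw [maxLength_eq]
  exact Nat.lt_fib_greatestFib_add_one _

theorem log_floor_le_maxLength {x : ℝ} (hx : 2 ≤ x) : Real.log ⌊x⌋₊ ≤ maxLength x := by
  have h2 : 2 ≤ ⌊x⌋₊ := Nat.le_floor (by simpa using hx)
  have h0 : (0 : ℝ) < ⌊x⌋₊ := by exact_mod_cast (by omega : 0 < ⌊x⌋₊)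
  have hpos := goldenRatio_pos
  have h1 : (⌊x⌋₊ : ℝ) ≤ goldenRatio ^ maxLength x :=
    le_trans (by exact_mod_cast (lt_fib_maxLength_add_one x).le) (fib_succ_le_goldenRatio_pow _)
  have h3 : Real.log goldenRatio ≤ 1 := by
    have := Real.log_le_sub_one_of_pos hpos
    have := goldenRatio_bounds.2
    linarith
  calc Real.log ⌊x⌋₊ ≤ Real.log (goldenRatio ^ maxLength x) := Real.log_le_log h0 h1
    _ = maxLength x * Real.log goldenRatio := Real.log_pow _ _
    _ ≤ maxLength x * 1 := by gcongr
    _ = _ := mul_one _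

/-- A Chebyshev lower bound for π, with log ⌊x⌋ replaced by the length L. -/
theorem floor_le_mul_card_primesUpTo {x : ℝ} (hx : 2 ≤ x) :
    (⌊x⌋₊ : ℝ) ≤ 8 * maxLength x * (primesUpTo x).card := by
  have h2 : 2 ≤ ⌊x⌋₊ := Nat.le_floor (by simpa using hx)
  have hL := log_floor_le_maxLength hx
  set n := ⌊x⌋₊
  have hn : (2 : ℝ) ≤ n := by exact_mod_cast h2
  have hc : (primesUpTo x).card = Nat.primeCounting n := Nat.primesLE_card_eq_primeCounting n
  have h3 := Chebyshev.pi_ge n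
  have hlog : 0 < Real.log n := Real.log_pos (by linarith)
  rw [← hc, div_le_iff₀ hlog] at h3
  have l2 := Real.log_two_gt_d9
  have l2' := Real.log_two_lt_d9
  -- From 3²/2³ = 9/8 and log(9/8) ≤ 1/8.
  have l3 : Real.log 3 ≤ 111 / 100 := by
    have e : 2 * Real.log 3 = 3 * Real.log 2 + Real.log (9 / 8) := by
      have h9 : (9 / 8 : ℝ) = 3 ^ 2 / 2 ^ 3 := by norm_num
      rw [h9, Real.log_div (by norm_num) (by norm_num), Real.log_pow, Real.log_pow]
      push_cast
      ring
    have := Real.log_le_sub_one_of_pos (show (0 : ℝ) < 9 / 8 by norm_num)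
    linarith
  -- The tangent at 3; its slope 1/3 is below log 2 - 1/8, so the bound already holds from n = 2.
  have l4 : Real.log (n + 1) ≤ Real.log 3 + (n - 2) / 3 := by
    have e : (n + 1 : ℝ) = 3 * ((n + 1) / 3) := by ring
    rw [e, Real.log_mul (by norm_num) (by positivity)]
    have := Real.log_le_sub_one_of_pos (show (0 : ℝ) < (n + 1) / 3 by positivity)
    linarith
  have h4 : (n : ℝ) / 8 ≤ n * Real.log 2 - Real.log (n + 1) := by nlinarith
  have h5 : ((primesUpTo x).card : ℝ) * Real.log n ≤ (primesUpTo x).card * maxLength x := by gcongr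
  linarith

theorem primesUpTo_nonempty {x : ℝ} (hx : 2 ≤ x) : (primesUpTo x).Nonempty := by
  refine ⟨2, Finset.mem_filter.2 ⟨Finset.mem_range.2 ?_, Nat.prime_two⟩⟩
  have h2 : 2 ≤ ⌊x⌋₊ := Nat.le_floor (by simpa using hx)
  omega

theorem abs_prod_sub_prod_le {ι : Type*} (s : Finset ι) {a b : ι → ℝ}
    (ha : ∀ i ∈ s, 0 ≤ a i ∧ a i ≤ 1) (hb : ∀ i ∈ s, 0 ≤ b i ∧ b i ≤ 1) :
    |∏ i ∈ s, a i - ∏ i ∈ s, b i| ≤ ∑ i ∈ s, |a i - b i| := by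
  classical
  induction s using Finset.induction_on with
  | empty => simp
  | insert j s hj ih =>
    have ih := ih (fun i hi => ha i (Finset.mem_insert_of_mem hi))
      fun i hi => hb i (Finset.mem_insert_of_mem hi)
    rw [Finset.prod_insert hj, Finset.prod_insert hj, Finset.sum_insert hj]
    obtain ⟨a0, a1⟩ := ha j (Finset.mem_insert_self _ _)
    have p0 : 0 ≤ ∏ i ∈ s, b i := Finset.prod_nonneg fun i hi => (hb i (Finset.mem_insert_of_mem hi)).1
    have p1 : ∏ i ∈ s, b i ≤ 1 := Finset.prod_le_one
      (fun i hi => (hb i (Finset.mem_insert_of_mem hi)).1)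
      fun i hi => (hb i (Finset.mem_insert_of_mem hi)).2
    have e : a j * ∏ i ∈ s, a i - b j * ∏ i ∈ s, b i =
        (a j - b j) * ∏ i ∈ s, b i + a j * (∏ i ∈ s, a i - ∏ i ∈ s, b i) := by ring
    rw [e]
    refine (abs_add_le _ _).trans (add_le_add ?_ ?_)
    · rw [abs_mul, abs_of_nonneg p0]
      exact mul_le_of_le_one_right (abs_nonneg _) p1
    · rw [abs_mul, abs_of_nonneg a0]
      exact (mul_le_of_le_one_left (abs_nonneg _) a1).trans ih

open Classical in
-- At distance m from both ends, φ^(-k) and φ^k/F_J are both O(ε); the constant is 740 + 30 +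
-- 12·1.62 < 790.
theorem card_not_typical_le_of_le {ε : ℝ} (hε : 0 < ε) {m L k J : ℕ}
    (hm : goldenRatio * (goldenRatio ^ m)⁻¹ ≤ ε) (hm0 : 0 < m) (hk : m ≤ k) (hkL : k + m ≤ L)
    (hJ : L ≤ J) :
    (((Finset.range (Nat.fib J)).filter fun n => ¬ Typical (10 * ε) k n).card : ℝ) ≤
      790 * ε * Nat.fib J := by
  have hpos := goldenRatio_pos
  have hone := one_lt_goldenRatio
  have hsq := goldenRatio_sq
  obtain ⟨g1, g2⟩ := goldenRatio_bounds
  have h1 := card_not_typical_le (J := J) (k := k) (by omega) (by omega) (by linarith : 0 ≤ 10 * ε)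
  have h2 : (goldenRatio ^ k)⁻¹ ≤ ε := by
    calc (goldenRatio ^ k)⁻¹ ≤ (goldenRatio ^ m)⁻¹ :=
          inv_anti₀ (by positivity) (pow_le_pow_right₀ hone.le hk)
      _ ≤ goldenRatio * (goldenRatio ^ m)⁻¹ := le_mul_of_one_le_left (by positivity) hone.le
      _ ≤ ε := hm
  have h3 : goldenRatio ^ k ≤ 162 / 100 * ε * Nat.fib J := by
    have e1 : goldenRatio ^ k ≤ goldenRatio ^ L * (goldenRatio ^ m)⁻¹ := by
      rw [← div_eq_mul_inv, le_div_iff₀ (by positivity), ← pow_add]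
      exact pow_le_pow_right₀ hone.le hkL
    have e2 : goldenRatio ^ L ≤ goldenRatio ^ 2 * Nat.fib J := by
      obtain ⟨l, rfl⟩ : ∃ l, L = l + 2 := ⟨L - 2, by omega⟩
      rw [pow_add, mul_comm]
      gcongr
      refine (goldenRatio_pow_le_fib l).trans ?_
      exact_mod_cast Nat.fib_mono hJ
    calc goldenRatio ^ k ≤ goldenRatio ^ L * (goldenRatio ^ m)⁻¹ := e1
      _ ≤ (goldenRatio ^ 2 * Nat.fib J) * (goldenRatio ^ m)⁻¹ := by gcongr
      _ = goldenRatio * (goldenRatio * (goldenRatio ^ m)⁻¹) * Nat.fib J := by ring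
      _ ≤ (162 / 100) * ε * Nat.fib J := by
        gcongr
        linarith
  have h4 : (Nat.fib J : ℝ) * (74 * (10 * ε) + 30 * (goldenRatio ^ k)⁻¹) ≤
      Nat.fib J * (74 * (10 * ε) + 30 * ε) := by gcongr
  have h5 : 0 ≤ ε * Nat.fib J := by positivity
  linarith

/-- Replacing the digits by approximants, on average. -/
theorem norm_avg_prod_sub_le {S s : Finset ℕ} {g : ℕ → ℕ → ℝ} {η c r : ℝ} {d : ℕ}
    (hd : S.card ≤ d) (hc : 0 ≤ c) (hr : 0 ≤ r) (hs : s.Nonempty)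
    (hg : ∀ k ∈ S, ∀ n, 0 ≤ g k n ∧ g k n ≤ 1)
    (hgd : ∀ k ∈ S, ∀ n, Typical η k n → |g k n - digit k n| ≤ c)
    (hcard : ∀ k ∈ S, ∀ t ⊆ s, (∀ n ∈ t, ¬ Typical η k n) → (t.card : ℝ) ≤ r * s.card) :
    ‖avg s (fun n => ∏ k ∈ S, (digit k n : ℂ)) - avg s (fun n => ∏ k ∈ S, (g k n : ℂ))‖ ≤
      d * (c + r) := by
  classical
  have hs0 : (0 : ℝ) < s.card := by exact_mod_cast hs.card_pos
  rw [← avg_sub]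
  have h1 : ∀ n ∈ s, ‖∏ k ∈ S, (digit k n : ℂ) - ∏ k ∈ S, (g k n : ℂ)‖ ≤
      ∑ k ∈ S, (c + if Typical η k n then 0 else 1) := by
    intro n _
    have e : ∏ k ∈ S, (digit k n : ℂ) - ∏ k ∈ S, (g k n : ℂ) =
        ((∏ k ∈ S, (digit k n : ℝ) - ∏ k ∈ S, g k n : ℝ) : ℂ) := by push_cast; rfl
    have hdig : ∀ k, (0 : ℝ) ≤ digit k n ∧ (digit k n : ℝ) ≤ 1 := fun k => by
      rcases digit_eq_zero_or_one k n with h | h <;> rw [h] <;> norm_num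
    rw [e, Complex.norm_real, Real.norm_eq_abs]
    refine (abs_prod_sub_prod_le S (fun k _ => hdig k) fun k hk => hg k hk n).trans ?_
    refine Finset.sum_le_sum fun k hk => ?_
    split_ifs with ht
    · rw [abs_sub_comm, add_zero]
      exact hgd k hk n ht
    · obtain ⟨a, b⟩ := hdig k
      obtain ⟨a', b'⟩ := hg k hk n
      rw [abs_le]
      constructor <;> linarith
  refine (norm_avg_le s h1).trans ?_
  rw [Finset.sum_comm, one_div, inv_mul_le_iff₀ hs0]
  calc ∑ k ∈ S, ∑ n ∈ s, (c + if Typical η k n then 0 else 1) ≤ ∑ k ∈ S, (c + r) * s.card := by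
        refine Finset.sum_le_sum fun k hk => ?_
        have h2 := hcard k hk (s.filter fun n => ¬ Typical η k n) (Finset.filter_subset _ _)
          fun n hn => (Finset.mem_filter.1 hn).2
        rw [Finset.sum_add_distrib, Finset.sum_const, nsmul_eq_mul]
        have h3 : ∑ n ∈ s, (if Typical η k n then (0 : ℝ) else 1) =
            (s.filter fun n => ¬ Typical η k n).card := by
          rw [← Finset.sum_boole]
          refine Finset.sum_congr rfl fun n _ => ?_
          split_ifs <;> rfl
        rw [h3]
        linarith
    _ = S.card * ((c + r) * s.card) := by rw [Finset.sum_const, nsmul_eq_mul]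
    _ ≤ d * ((c + r) * s.card) := by gcongr
    _ = _ := by ring

/-- Replace digits by approximants in both averages, then compare the two averages of one
trigonometric sum. Non-typical primes are bounded by non-typical integers, which loses a factor O(L)
against the number of primes. -/
theorem norm_avg_primesUpTo_digit_sub_le {x : ℝ} (hx : 2 ≤ x) {S : Finset ℕ} {m d N U : ℕ} {ε : ℝ}
    (hm0 : 0 < m) (hS : ∀ k ∈ S, m ≤ k ∧ k + m ≤ maxLength x) (hmL : m ≤ maxLength x)
    (hd : S.card ≤ d) (hε0 : 0 < ε)
    (hε : ε ≤ 1 / 100) (hm : goldenRatio * (goldenRatio ^ m)⁻¹ ≤ ε) (hN : 0 < N) (hU : 0 < U)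
    (hNU : 48 * d * N * (U : ℝ) ^ 8 ≤ goldenRatio ^ m) :
    ‖avg (primesUpTo x) (fun n => ∏ k ∈ S, (digit k n : ℂ)) -
        avg (Finset.range (Nat.fib (2 * maxLength x + 2))) (fun n => ∏ k ∈ S, (digit k n : ℂ))‖ ≤
      d * (4 / (N * ε ^ 2) + 13430 * maxLength x * ε) +
        (N : ℝ) ^ (2 * d) * (208 * maxLength x * (1 + maxLength x) ^ 3 / √U +
          (goldenRatio ^ maxLength x)⁻¹) := by
  classical
  have hpos := goldenRatio_pos
  have hone := one_lt_goldenRatio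
  have hsq := goldenRatio_sq
  obtain ⟨g1, g2⟩ := goldenRatio_bounds
  have hX2 : 2 ≤ ⌊x⌋₊ := Nat.le_floor (by simpa using hx)
  have f1 := fib_maxLength_le x
  have f2 := lt_fib_maxLength_add_one x
  have f3 := floor_le_mul_card_primesUpTo hx
  have f4 := log_floor_le_maxLength hx
  have hP := primesUpTo_nonempty hx
  have hPX : ∀ p ∈ primesUpTo x, p ≤ ⌊x⌋₊ := fun p hp =>
    Nat.lt_succ_iff.1 (Finset.mem_range.1 (Finset.mem_filter.1 hp).1)
  set X := ⌊x⌋₊ with hX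
  set L := maxLength x with hL
  have hL1 : 1 ≤ L := by
    by_contra hcon
    have : L = 0 := by omega
    rw [this] at f2
    simp at f2
    omega
  have hL1' : (1 : ℝ) ≤ L := by exact_mod_cast hL1
  have hP0 : (0 : ℝ) < (primesUpTo x).card := by exact_mod_cast hP.card_pos
  have hfibL : Nat.fib (L + 1) ≤ 2 * X := by
    obtain ⟨l, hl⟩ : ∃ l, L = l + 1 := ⟨L - 1, by omega⟩
    rw [hl] at f1 ⊢
    have : Nat.fib (l + 1 + 1) = Nat.fib l + Nat.fib (l + 1) := Nat.fib_add_two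
    have := Nat.fib_mono (Nat.le_succ l)
    simp only [Nat.succ_eq_add_one] at this
    omega
  have hg : ∀ k : ℕ, ∃ g : ℕ → ℝ, k ∈ S → (∀ n, 0 ≤ g n ∧ g n ≤ 1) ∧
      TrigBdd ((N : ℝ) ^ 2) (2 * N * Nat.fib (k + 1)) (fun n => (g n : ℂ)) ∧
      ∀ n, Typical (10 * ε) k n → |g n - digit k n| ≤ 2 / (N * ε ^ 2) := by
    intro k
    by_cases hk : k ∈ S
    · obtain ⟨j, rfl⟩ : ∃ j, k = j + 1 := ⟨k - 1, by have := hS k hk; omega⟩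
      have hj : (goldenRatio ^ j)⁻¹ ≤ ε := by
        refine le_trans ?_ hm
        rw [← div_eq_mul_inv, le_div_iff₀ (by positivity), inv_mul_le_iff₀ (by positivity), ← pow_succ]
        exact pow_le_pow_right₀ hone.le (hS _ hk).1
      obtain ⟨g, hg⟩ := exists_approximant hε0 hε hN hj
      exact ⟨g, fun _ => hg⟩
    · exact ⟨0, fun h => absurd h hk⟩
  choose g hg using hg
  -- The integer sample is taken of size at least φ^(2L), so that geometric sums of size 2|h| ≤ φ^L
  -- average to at most φ^(-L).
  set R := Finset.range (Nat.fib (2 * L + 2)) with hR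
  have hRne : R.Nonempty := by
    rw [hR, Finset.nonempty_range_iff]
    exact (Nat.fib_pos.2 (by omega)).ne'
  have hRcard : R.card = Nat.fib (2 * L + 2) := Finset.card_range _
  -- digits to approximants
  have A1 := norm_avg_prod_sub_le (s := primesUpTo x) (g := g) (η := 10 * ε) (c := 2 / (N * ε ^ 2))
    (r := 12640 * L * ε) hd (by positivity) (by positivity) hP (fun k hk => (hg k hk).1)
    (fun k hk => (hg k hk).2.2) (by
      intro k hk t ht htt
      have h1 := card_not_typical_le_of_le hε0 hm hm0 (hS k hk).1 (hS k hk).2 (Nat.le_succ L)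
      have h2 : t.card ≤ ((Finset.range (Nat.fib (L + 1))).filter
          fun n => ¬ Typical (10 * ε) k n).card := by
        refine Finset.card_le_card fun n hn => Finset.mem_filter.2 ⟨Finset.mem_range.2 ?_, htt n hn⟩
        exact (hPX n (ht hn)).trans_lt f2
      calc (t.card : ℝ) ≤ _ := by exact_mod_cast h2
        _ ≤ 790 * ε * Nat.fib (L + 1) := h1
        _ ≤ 790 * ε * (2 * X) := by
          gcongr
          exact_mod_cast hfibL
        _ ≤ 790 * ε * (2 * (8 * L * (primesUpTo x).card)) := by gcongr
        _ = _ := by ring)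
  have A2 := norm_avg_prod_sub_le (s := R) (g := g) (η := 10 * ε) (c := 2 / (N * ε ^ 2))
    (r := 790 * ε) hd (by positivity) (by positivity) hRne (fun k hk => (hg k hk).1)
    (fun k hk => (hg k hk).2.2) (by
      intro k hk t ht htt
      have h1 := card_not_typical_le_of_le hε0 hm hm0 (hS k hk).1 (hS k hk).2
        (by omega : L ≤ 2 * L + 2)
      have h2 : t.card ≤ ((Finset.range (Nat.fib (2 * L + 2))).filter
          fun n => ¬ Typical (10 * ε) k n).card :=
        Finset.card_le_card fun n hn => Finset.mem_filter.2 ⟨ht hn, htt n hn⟩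
      rw [hRcard]
      exact le_trans (by exact_mod_cast h2) h1)
  -- the approximants
  set H : ℝ := d * (2 * N * Nat.fib (L - m + 1)) with hH
  have A3 : TrigBdd ((N : ℝ) ^ (2 * d)) H fun n => ∏ k ∈ S, (g k n : ℂ) := by
    have h1 := TrigBdd.prod S (A := (N : ℝ) ^ 2) (H := 2 * N * Nat.fib (L - m + 1))
      (f := fun k n => (g k n : ℂ)) fun k hk => (hg k hk).2.1.mono le_rfl (by
        have : Nat.fib (k + 1) ≤ Nat.fib (L - m + 1) :=
          Nat.fib_mono (by have := hS k hk; omega)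
        gcongr)
    refine h1.mono ?_ ?_
    · rw [← pow_mul]
      exact pow_le_pow_right₀ (by exact_mod_cast hN) (by omega)
    · rw [hH]
      gcongr
  -- The room φ^m between the top position and L absorbs d, N and U⁸. The 48 in the hypothesis is
  -- 8·2 from the frequency bound times 3 from φ^L ≤ 3X.
  have hHX : 8 * H * (U : ℝ) ^ 8 ≤ X := by
    have h1 : (Nat.fib (L - m + 1) : ℝ) * goldenRatio ^ m ≤ goldenRatio ^ L := by
      calc _ ≤ goldenRatio ^ (L - m) * goldenRatio ^ m := by
            gcongr
            exact fib_succ_le_goldenRatio_pow _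
        _ = _ := by rw [← pow_add, Nat.sub_add_cancel hmL]
    have h2 : goldenRatio ^ L ≤ 3 * X := by
      have h3 : goldenRatio ^ L ≤ goldenRatio ^ 2 * Nat.fib L := by
        rcases Nat.lt_or_ge L 2 with h | h
        · have : L = 1 := by omega
          rw [this]
          simp
        · obtain ⟨l, hl⟩ : ∃ l, L = l + 2 := ⟨L - 2, by omega⟩
          rw [hl, pow_add, mul_comm]
          gcongr
          exact goldenRatio_pow_le_fib l
      calc goldenRatio ^ L ≤ goldenRatio ^ 2 * Nat.fib L := h3
        _ ≤ 3 * X := by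
          gcongr
          rw [hsq]
          linarith
    have h4 : (48 * d * N * (U : ℝ) ^ 8) * Nat.fib (L - m + 1) ≤ 3 * X :=
      calc _ ≤ goldenRatio ^ m * Nat.fib (L - m + 1) := by gcongr
        _ = _ := mul_comm _ _
        _ ≤ _ := h1.trans h2
    rw [hH]
    linarith
  have hU1 : (1 : ℝ) ≤ U := by exact_mod_cast hU
  have hH0 : 0 ≤ H := by positivity
  have hHX' : 8 * H ≤ X := by
    have : 8 * H * 1 ≤ 8 * H * (U : ℝ) ^ 8 := by
      gcongr
      exact one_le_pow₀ hU1
    linarith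
  have A4 := A3.norm_avg_sub_le hP hRne (δ := 208 * L * (1 + L) ^ 3 / √U + (goldenRatio ^ L)⁻¹)
    (by positivity) (by
      intro h hh hhH
      refine add_le_add ?_ ?_
      · rw [avg, norm_mul, norm_div, norm_one, Complex.norm_natCast, one_div,
          inv_mul_le_iff₀ hP0]
        have hZ : 8 * |h| * (U : ℤ) ^ 8 ≤ (⌊x⌋₊ : ℤ) := by
          have : 8 * |(h : ℝ)| * (U : ℝ) ^ 8 ≤ X := le_trans (by gcongr) hHX
          exact_mod_cast this
        have h1 := norm_sum_primesUpTo_ex_le hh hU hZ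
        rw [← hX] at h1
        have hX0 : (1 : ℝ) ≤ X := by exact_mod_cast (by omega : 1 ≤ X)
        have hl0 := Real.log_nonneg hX0
        calc _ ≤ 26 * (X : ℝ) * (1 + Real.log X) ^ 3 / √U := h1
          _ ≤ 26 * (8 * L * (primesUpTo x).card) * (1 + L) ^ 3 / √U := by gcongr
          _ = _ := by ring
      · have hR0 : (0 : ℝ) < R.card := by exact_mod_cast hRne.card_pos
        rw [avg, norm_mul, norm_div, norm_one, Complex.norm_natCast, one_div,
          inv_mul_le_iff₀ hR0]
        refine (norm_sum_range_ex_le hh _).trans ?_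
        have h1 : (X : ℝ) ≤ goldenRatio ^ L :=
          le_trans (by exact_mod_cast f2.le) (fib_succ_le_goldenRatio_pow _)
        have h2 : goldenRatio ^ (2 * L) ≤ R.card := by
          rw [hRcard]
          exact goldenRatio_pow_le_fib _
        rw [← div_eq_mul_inv, le_div_iff₀ (by positivity)]
        calc 2 * |(h : ℝ)| * goldenRatio ^ L ≤ goldenRatio ^ L * goldenRatio ^ L := by
              gcongr
              linarith
          _ = goldenRatio ^ (2 * L) := by rw [two_mul, pow_add]
          _ ≤ _ := h2)
  set a1 := avg (primesUpTo x) fun n => ∏ k ∈ S, (digit k n : ℂ)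
  set a2 := avg R fun n => ∏ k ∈ S, (digit k n : ℂ)
  set b1 := avg (primesUpTo x) fun n => ∏ k ∈ S, (g k n : ℂ)
  set b2 := avg R fun n => ∏ k ∈ S, (g k n : ℂ)
  have e : a1 - a2 = (a1 - b1) + (b1 - b2) - (a2 - b2) := by ring
  rw [e]
  have t1 := norm_sub_le ((a1 - b1) + (b1 - b2)) (a2 - b2)
  have t2 := norm_add_le (a1 - b1) (b1 - b2)
  have t3 : (d : ℝ) * (2 / (N * ε ^ 2) + 12640 * L * ε) + d * (2 / (N * ε ^ 2) + 790 * ε) ≤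
      d * (4 / (N * ε ^ 2) + 13430 * L * ε) := by
    rw [← mul_add]
    refine mul_le_mul_of_nonneg_left ?_ (Nat.cast_nonneg d)
    have : ε * 1 ≤ ε * L := by gcongr
    have e4 : (4 : ℝ) / (N * ε ^ 2) = 2 / (N * ε ^ 2) + 2 / (N * ε ^ 2) := by ring
    rw [e4]
    linarith
  linarith

/-- The joint law of digits of random primes is close to the one of the Markov chain. -/
theorem IsDigitChain.norm_avg_primesUpTo_sub_le {Ω : Type*} [MeasurableSpace Ω] {P : Measure Ω}
    [IsProbabilityMeasure P] {Z : ℕ → Ω → Fin 2} (hZ : IsDigitChain P Z) {x : ℝ} (hx : 2 ≤ x)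
    {S : Finset ℕ} {m d N U : ℕ} {ε : ℝ} (hm4 : 4 ≤ m)
    (hS : ∀ k ∈ S, m ≤ k ∧ k + m ≤ maxLength x) (hmL : 2 * m ≤ maxLength x)
    (hd : S.card ≤ d) (hε0 : 0 < ε) (hε : ε ≤ 1 / 100)
    (hm : goldenRatio * (goldenRatio ^ m)⁻¹ ≤ ε) (hN : 0 < N) (hU : 0 < U)
    (hNU : 48 * d * N * (U : ℝ) ^ 8 ≤ goldenRatio ^ m) :
    ‖avg (primesUpTo x) (fun n => ∏ k ∈ S, (digit k n : ℂ)) -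
        ((∫ ω, ∏ k ∈ S, (((Z k ω : Fin 2) : ℕ) : ℝ) ∂P : ℝ) : ℂ)‖ ≤
      d * (4 / (N * ε ^ 2) + 13430 * maxLength x * ε) +
        (N : ℝ) ^ (2 * d) * (208 * maxLength x * (1 + maxLength x) ^ 3 / √U +
          (goldenRatio ^ maxLength x)⁻¹) + 8 * (goldenRatio ^ m)⁻¹ := by
  have h1 := norm_avg_primesUpTo_digit_sub_le hx (by omega) hS (by omega) hd hε0 hε hm hN hU hNU
  have h2 := hZ.abs_avg_digit_sub_le (K := maxLength x - m) (J := 2 * maxLength x + 2) hm4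
    (fun k hk => ⟨(hS k hk).1, by have := hS k hk; omega⟩) (by omega) (by omega)
  have e : avg (Finset.range (Nat.fib (2 * maxLength x + 2))) (fun n => ∏ k ∈ S, (digit k n : ℂ)) =
      ((1 / (Nat.fib (2 * maxLength x + 2) : ℝ) * ∑ n ∈ Finset.range (Nat.fib (2 * maxLength x + 2)),
        ∏ k ∈ S, (digit k n : ℝ) : ℝ) : ℂ) := by
    rw [avg, Finset.card_range]
    push_cast
    rfl
  rw [e] at h1
  rw [← Real.norm_eq_abs, ← Complex.norm_real, Complex.ofReal_sub] at h2
  exact (norm_sub_le_norm_sub_add_norm_sub _ _ _).trans (add_le_add h1 h2)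

/-! ### Exponential moments of the chain -/

/-- From state 0 the chain emits the word 0 with probability 1/φ or the word 10 with probability
1/φ². The centred digit sums -μ and 1 - 2μ of these words average to 0, so e^y ≤ 1 + y + y² leaves
only the second-order factor. -/
theorem exp_two_point_le {l : ℝ} (hl : |l| ≤ 1) :
    1 / goldenRatio + 1 / goldenRatio ^ 2 * Real.exp (l * (1 - mean)) ≤
      Real.exp (l ^ 2) * Real.exp (l * mean) := by
  have hpos := goldenRatio_pos
  have hsq := goldenRatio_sq
  have hm : mean * (goldenRatio ^ 2 + 1) = 1 := by
    rw [mean]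
    field_simp
  have hm0 : 0 < mean := by
    rw [mean]
    positivity
  have hm1 : mean < 1 := by nlinarith
  have hi1 : 1 / goldenRatio = goldenRatio - 1 := by rw [one_div, inv_goldenRatio_eq]
  have hi2 : 1 / goldenRatio ^ 2 = 2 - goldenRatio := by
    rw [one_div, ← inv_pow, inv_goldenRatio_eq]
    linear_combination hsq
  obtain ⟨g1, g2⟩ := goldenRatio_bounds
  have hq : (2 - goldenRatio) * (1 - mean) = mean := by
    have : (2 - goldenRatio) * (goldenRatio ^ 2) = 1 := by
      linear_combination (1 - goldenRatio) * hsq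
    linear_combination (goldenRatio - 2) * hm + mean * this
  have key : ∀ y : ℝ, |y| ≤ 1 → Real.exp (l * y) ≤ 1 + l * y + l ^ 2 := by
    intro y hy
    have hly : |l * y| ≤ 1 := by
      rw [abs_mul]
      exact mul_le_one₀ hl (abs_nonneg _) hy
    have h1 := (abs_le.1 (Real.abs_exp_sub_one_sub_id_le hly)).2
    have h2 : (l * y) ^ 2 ≤ l ^ 2 := by
      rw [mul_pow]
      refine mul_le_of_le_one_right (sq_nonneg _) ?_
      rw [← sq_abs]
      exact pow_le_one₀ (abs_nonneg _) hy
    linarith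
  have k1 := key (-mean) (by rw [abs_neg, abs_of_pos hm0]; exact hm1.le)
  have k2 := key (1 - mean - mean) (by rw [abs_le]; constructor <;> linarith)
  have h3 : 1 + l ^ 2 ≤ Real.exp (l ^ 2) := by
    have := Real.add_one_le_exp (l ^ 2)
    linarith
  have e1 : 1 / goldenRatio + 1 / goldenRatio ^ 2 * Real.exp (l * (1 - mean)) =
      ((goldenRatio - 1) * Real.exp (l * -mean) +
        (2 - goldenRatio) * Real.exp (l * (1 - mean - mean))) * Real.exp (l * mean) := by
    rw [hi1, hi2, add_mul, mul_assoc, ← Real.exp_add, mul_assoc, ← Real.exp_add]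
    have : l * -mean + l * mean = 0 := by ring
    rw [this, Real.exp_zero, mul_one]
    congr 3
    ring
  rw [e1]
  refine mul_le_mul_of_nonneg_right ?_ (Real.exp_pos _).le
  have k1' := mul_le_mul_of_nonneg_left k1 (by linarith : 0 ≤ goldenRatio - 1)
  have k2' := mul_le_mul_of_nonneg_left k2 (by linarith : 0 ≤ 2 - goldenRatio)
  have e2 : (goldenRatio - 1) * (1 + l * -mean + l ^ 2) +
      (2 - goldenRatio) * (1 + l * (1 - mean - mean) + l ^ 2) = 1 + l ^ 2 := by
    linear_combination l * hq
  linarith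

theorem mean_pos : 0 < mean := by
  rw [mean]
  positivity

theorem mean_lt_one : mean < 1 := by
  rw [mean, div_lt_one (by positivity)]
  have := goldenRatio_pos
  nlinarith

section chain

variable {Ω : Type*} [MeasurableSpace Ω] {P : Measure Ω} [IsProbabilityMeasure P]
  {Z : ℕ → Ω → Fin 2}

/-- An almost-supermartingale argument along the window; starting and ending corrections cost a
factor e each. -/
theorem IsDigitChain.integral_exp_le (h : IsDigitChain P Z) {l : ℝ} (hl : |l| ≤ 1) {A B : ℕ}
    (hA : 1 ≤ A) (hAB : A ≤ B + 1) :
    ∫ ω, Real.exp (l * ∑ k ∈ Finset.Icc A B, ((((Z k ω : Fin 2) : ℕ) : ℝ) - mean)) ∂P ≤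
      Real.exp (2 + l ^ 2 * (Finset.Icc A B).card) := by
  obtain ⟨t00, t01, t10, t11⟩ := transition_eq
  have hm0 := mean_pos
  have hm1 := mean_lt_one
  obtain ⟨a, rfl⟩ : ∃ a, A = a + 1 := ⟨A - 1, by omega⟩
  obtain ⟨n, rfl⟩ : ∃ n, B = a + n := ⟨B - a, by omega⟩
  set w : ℕ → Fin 2 → ℝ := fun i b =>
    if a + 1 ≤ i then Real.exp (l * (((b : ℕ) : ℝ) - mean)) else 1 with hw
  have hw0 : ∀ i b, 0 ≤ w i b := fun i b => by
    simp only [hw]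
    split_ifs <;> positivity
  set V := chainFun P Z w with hV
  have hV0 : ∀ j b, 0 ≤ V j b := fun j b => chainFun_nonneg hw0 j b
  have hcard : (Finset.Icc (a + 1) (a + n)).card = n := by
    rw [Nat.card_Icc]
    omega
  have hlm : |l * mean| ≤ 1 := by
    rw [abs_mul]
    exact mul_le_one₀ hl (abs_nonneg _) (by rw [abs_of_pos hm0]; exact hm1.le)
  obtain ⟨hlm1, hlm2⟩ := abs_le.1 hlm
  -- State 0 carries the extra weight e^(lμ) because state 1 must still pay e^(-lμ) for its forced
  -- return to 0. With it a step from 1 is neutral and a step from 0 costs at most e^(l²).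
  have hind : ∀ i, V (a + i) 0 * Real.exp (l * mean) + V (a + i) 1 ≤ Real.exp (1 + l ^ 2 * i) := by
    intro i
    induction i with
    | zero =>
      have hsum : V a 0 + V a 1 = 1 := by
        have hone : ∀ k ≤ a, ∀ b, w k b = 1 := fun k hk b => by
          simp only [hw]
          rw [if_neg (by omega)]
        rw [hV, h.chainFun_one hone, h.chainFun_one hone]
        change goldenRatio ^ 2 / (goldenRatio ^ 2 + 1) + 1 / (goldenRatio ^ 2 + 1) = 1
        rw [← add_div, div_self (by positivity)]
      have e1 : Real.exp (l * mean) ≤ Real.exp 1 := Real.exp_le_exp.2 hlm2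
      have e2 : 1 ≤ Real.exp 1 := Real.one_le_exp (by norm_num)
      simp only [add_zero, Nat.cast_zero, mul_zero]
      nlinarith [hV0 a 0, hV0 a 1]
    | succ i ih =>
      have s0 : V (a + (i + 1)) 0 = Real.exp (-(l * mean)) *
          (V (a + i) 0 * (1 / goldenRatio) + V (a + i) 1) := by
        rw [hV, ← add_assoc, h.chainFun_succ, t00, t10]
        simp only [hw]
        rw [if_pos (by omega)]
        simp
      have s1 : V (a + (i + 1)) 1 = Real.exp (l * (1 - mean)) *
          (V (a + i) 0 * (1 / goldenRatio ^ 2)) := by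
        rw [hV, ← add_assoc, h.chainFun_succ, t01, t11]
        simp only [hw]
        rw [if_pos (by omega)]
        simp
      have e0 : Real.exp (-(l * mean)) * Real.exp (l * mean) = 1 := by
        rw [← Real.exp_add, neg_add_cancel, Real.exp_zero]
      have hE : 1 ≤ Real.exp (l ^ 2) := Real.one_le_exp (sq_nonneg _)
      have e1 : V (a + (i + 1)) 0 * Real.exp (l * mean) + V (a + (i + 1)) 1 =
          V (a + i) 0 * (1 / goldenRatio + 1 / goldenRatio ^ 2 * Real.exp (l * (1 - mean))) +
            V (a + i) 1 := by
        rw [s0, s1]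
        linear_combination (V (a + i) 0 * (1 / goldenRatio) + V (a + i) 1) * e0
      calc _ = _ := e1
        _ ≤ V (a + i) 0 * (Real.exp (l ^ 2) * Real.exp (l * mean)) +
            Real.exp (l ^ 2) * V (a + i) 1 :=
          add_le_add (mul_le_mul_of_nonneg_left (exp_two_point_le hl) (hV0 _ _))
            (le_mul_of_one_le_left (hV0 _ _) hE)
        _ = Real.exp (l ^ 2) * (V (a + i) 0 * Real.exp (l * mean) + V (a + i) 1) := by ring
        _ ≤ Real.exp (l ^ 2) * Real.exp (1 + l ^ 2 * i) := by gcongr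
        _ = _ := by
          rw [← Real.exp_add]
          congr 1
          push_cast
          ring
  have hint : ∫ ω, Real.exp (l * ∑ k ∈ Finset.Icc (a + 1) (a + n),
      ((((Z k ω : Fin 2) : ℕ) : ℝ) - mean)) ∂P = V (a + n) 0 + V (a + n) 1 := by
    rw [hV, ← h.integral_prod_eq_add]
    refine integral_congr_ae (Filter.Eventually.of_forall fun ω => ?_)
    simp only [hw]
    rw [← Finset.prod_filter, Finset.mul_sum, Real.exp_sum]
    refine Finset.prod_congr ?_ fun _ _ => rfl
    ext k
    simp only [Finset.mem_Icc, Finset.mem_filter, Finset.mem_range]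
    omega
  rw [hint, hcard]
  have h1 := hind n
  have h2 : 1 ≤ Real.exp 1 * Real.exp (l * mean) := by
    rw [← Real.exp_add]
    exact Real.one_le_exp (by linarith)
  have h3 : 1 ≤ Real.exp 1 := Real.one_le_exp (by norm_num)
  calc V (a + n) 0 + V (a + n) 1 ≤
        V (a + n) 0 * (Real.exp 1 * Real.exp (l * mean)) + V (a + n) 1 * Real.exp 1 :=
        add_le_add (le_mul_of_one_le_right (hV0 _ _) h2) (le_mul_of_one_le_right (hV0 _ _) h3)
    _ = Real.exp 1 * (V (a + n) 0 * Real.exp (l * mean) + V (a + n) 1) := by ring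
    _ ≤ Real.exp 1 * Real.exp (1 + l ^ 2 * n) := by gcongr
    _ = _ := by
      rw [← Real.exp_add]
      congr 1
      ring

end chain

/-! ### The method of moments -/

theorem hasDerivAt_sum_pow_div_factorial (c : ℂ) (d : ℕ) (y : ℝ) :
    HasDerivAt (fun y : ℝ => ∑ j ∈ Finset.range (d + 1), (c * y) ^ j / (j.factorial : ℂ))
      (c * ∑ j ∈ Finset.range d, (c * y) ^ j / (j.factorial : ℂ)) y := by
  have h0 : HasDerivAt (fun y : ℝ => c * (y : ℂ)) c y := by
    simpa using (Complex.ofRealCLM.hasDerivAt (x := y)).const_mul c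
  induction d with
  | zero => simpa using hasDerivAt_const y (1 : ℂ)
  | succ d ih =>
    have h1 := (h0.pow (d + 1)).div_const ((d + 1).factorial : ℂ)
    have e1 : (fun y : ℝ => ∑ j ∈ Finset.range (d + 1 + 1), (c * y) ^ j / (j.factorial : ℂ)) =
        fun y : ℝ => ∑ j ∈ Finset.range (d + 1), (c * y) ^ j / (j.factorial : ℂ) +
          (c * y) ^ (d + 1) / ((d + 1).factorial : ℂ) := by
      funext y
      rw [Finset.sum_range_succ]
    rw [e1]
    refine (ih.add h1).congr_deriv ?_
    rw [Finset.sum_range_succ, mul_add, Nat.factorial_succ]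
    have : (d.factorial : ℂ) ≠ 0 := by exact_mod_cast d.factorial_ne_zero
    have : (d : ℂ) + 1 ≠ 0 := by exact_mod_cast d.succ_ne_zero
    push_cast
    field_simp

/-- Induction on d: the derivative of the remainder has the norm of the previous remainder, and the
bound is integrated from 0. -/
theorem norm_exp_mul_sub_le {c : ℂ} (hc : c.re = 0) (hc1 : ‖c‖ = 1) (d : ℕ) {y : ℝ} (hy : 0 ≤ y) :
    ‖Complex.exp (c * y) - ∑ j ∈ Finset.range d, (c * y) ^ j / (j.factorial : ℂ)‖ ≤
      y ^ d / d.factorial := by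
  induction d generalizing y with
  | zero => simp [Complex.norm_exp, hc]
  | succ d ih =>
    have h0 : ∀ y : ℝ, HasDerivAt (fun y : ℝ => c * (y : ℂ)) c y := fun y => by
      simpa using (Complex.ofRealCLM.hasDerivAt (x := y)).const_mul c
    have hf : ∀ y : ℝ, HasDerivAt (fun y : ℝ => Complex.exp (c * y) -
        ∑ j ∈ Finset.range (d + 1), (c * y) ^ j / (j.factorial : ℂ))
        (c * (Complex.exp (c * y) - ∑ j ∈ Finset.range d, (c * y) ^ j / (j.factorial : ℂ))) y := by
      intro y
      refine ((h0 y).cexp.sub (hasDerivAt_sum_pow_div_factorial c d y)).congr_deriv ?_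
      ring
    have hB : ∀ y : ℝ, HasDerivAt (fun y : ℝ => y ^ (d + 1) / ((d + 1).factorial : ℝ))
        (y ^ d / d.factorial) y := by
      intro y
      refine ((hasDerivAt_pow (d + 1) y).div_const ((d + 1).factorial : ℝ)).congr_deriv ?_
      rw [Nat.factorial_succ]
      have : (d.factorial : ℝ) ≠ 0 := by exact_mod_cast d.factorial_ne_zero
      have : (d : ℝ) + 1 ≠ 0 := by exact_mod_cast d.succ_ne_zero
      push_cast
      field_simp
    refine image_norm_le_of_norm_deriv_right_le_deriv_boundary (a := 0) (b := y)
      (fun z _ => (hf z).continuousAt.continuousWithinAt) (fun z _ => (hf z).hasDerivWithinAt)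
      (B := fun y => y ^ (d + 1) / ((d + 1).factorial : ℝ)) ?_ hB ?_ ⟨hy, le_rfl⟩
    · rw [Finset.sum_eq_single 0]
      · simp
      · intro j _ hj
        simp [hj]
      · simp
    · intro z hz
      rw [norm_mul, hc1, one_mul]
      exact ih hz.1

/-- Taylor's formula for `exp (i y)`. -/
theorem norm_exp_I_mul_sub_le (d : ℕ) (y : ℝ) :
    ‖Complex.exp (Complex.I * y) -
      ∑ j ∈ Finset.range d, (Complex.I * y) ^ j / (j.factorial : ℂ)‖ ≤ |y| ^ d / d.factorial := by
  rcases le_total 0 y with hy | hy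
  · rw [abs_of_nonneg hy]
    exact norm_exp_mul_sub_le (by simp) (by simp) d hy
  · have h := norm_exp_mul_sub_le (c := -Complex.I) (by simp) (by simp) d (neg_nonneg.2 hy)
    have e : -Complex.I * ((-y : ℝ) : ℂ) = Complex.I * y := by
      push_cast
      ring
    rw [e] at h
    rwa [abs_of_nonpos hy]

section moments

variable {α : Type*} [Fintype α]

/-- Multiplying a product over S by the variable with index l gives the product over insert l S, by
idempotence. Keeping S general lets each factor of the power be absorbed in turn. -/
theorem abs_sum_mul_pow_mul_prod_le {D : α → ℝ} {Y : ℕ → α → ℝ} {W : Finset ℕ} {d : ℕ} {δ : ℝ}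
    (hY : ∀ k a, Y k a * Y k a = Y k a)
    (h : ∀ S ⊆ W, S.card ≤ d → |∑ a, D a * ∏ k ∈ S, Y k a| ≤ δ) (i : ℕ) :
    ∀ S ⊆ W, S.card + i ≤ d →
      |∑ a, D a * ((∑ k ∈ W, Y k a) ^ i * ∏ k ∈ S, Y k a)| ≤ (W.card : ℝ) ^ i * δ := by
  classical
  induction i with
  | zero =>
    intro S hS hd
    simpa using h S hS hd
  | succ i ih =>
    intro S hS hd
    have e : ∑ a, D a * ((∑ k ∈ W, Y k a) ^ (i + 1) * ∏ k ∈ S, Y k a) =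
        ∑ l ∈ W, ∑ a, D a * ((∑ k ∈ W, Y k a) ^ i * ∏ k ∈ insert l S, Y k a) := by
      rw [Finset.sum_comm]
      refine Finset.sum_congr rfl fun a _ => ?_
      rw [← Finset.mul_sum, ← Finset.mul_sum, pow_succ, mul_assoc, Finset.sum_mul W]
      congr 2
      refine Finset.sum_congr rfl fun l _ => ?_
      by_cases hl : l ∈ S
      · rw [Finset.insert_eq_of_mem hl, ← Finset.mul_prod_erase S _ hl, ← mul_assoc, hY]
      · rw [Finset.prod_insert hl]
    rw [e]
    calc _ ≤ ∑ l ∈ W, |∑ a, D a * ((∑ k ∈ W, Y k a) ^ i * ∏ k ∈ insert l S, Y k a)| :=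
          Finset.abs_sum_le_sum_abs _ _
      _ ≤ ∑ l ∈ W, (W.card : ℝ) ^ i * δ := by
        refine Finset.sum_le_sum fun l hl => ih _ (Finset.insert_subset hl hS) ?_
        have := Finset.card_insert_le l S
        omega
      _ = _ := by
        rw [Finset.sum_const, nsmul_eq_mul, pow_succ]
        ring

/-- Binomial expansion; c ≤ |W| makes the absolute coefficients sum to at most (2|W|)^j. -/
theorem abs_sum_mul_sub_pow_le {D : α → ℝ} {Y : ℕ → α → ℝ} {W : Finset ℕ} {d : ℕ} {δ c : ℝ}
    (hY : ∀ k a, Y k a * Y k a = Y k a)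
    (h : ∀ S ⊆ W, S.card ≤ d → |∑ a, D a * ∏ k ∈ S, Y k a| ≤ δ) (hc : 0 ≤ c) (hcW : c ≤ W.card)
    {j : ℕ} (hj : j ≤ d) :
    |∑ a, D a * (∑ k ∈ W, Y k a - c) ^ j| ≤ (2 * W.card : ℝ) ^ j * δ := by
  have hδ : 0 ≤ δ := (abs_nonneg _).trans (h ∅ (Finset.empty_subset _) (by simp))
  have e : ∑ a, D a * (∑ k ∈ W, Y k a - c) ^ j = ∑ i ∈ Finset.range (j + 1),
      ((-c) ^ (j - i) * (j.choose i)) * ∑ a, D a * (∑ k ∈ W, Y k a) ^ i := by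
    simp_rw [Finset.mul_sum]
    rw [Finset.sum_comm]
    refine Finset.sum_congr rfl fun a _ => ?_
    rw [sub_eq_add_neg, add_pow, Finset.mul_sum]
    refine Finset.sum_congr rfl fun i _ => ?_
    ring
  rw [e]
  calc _ ≤ ∑ i ∈ Finset.range (j + 1),
        |((-c) ^ (j - i) * (j.choose i)) * ∑ a, D a * (∑ k ∈ W, Y k a) ^ i| :=
        Finset.abs_sum_le_sum_abs _ _
    _ ≤ ∑ i ∈ Finset.range (j + 1),
        ((W.card : ℝ) ^ i * (W.card : ℝ) ^ (j - i) * (j.choose i)) * δ := by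
      refine Finset.sum_le_sum fun i hi => ?_
      have h1 := abs_sum_mul_pow_mul_prod_le hY h i ∅ (Finset.empty_subset _) (by
        have := Finset.mem_range.1 hi
        simp only [Finset.card_empty]
        omega)
      simp only [Finset.prod_empty, mul_one] at h1
      rw [abs_mul, abs_mul, abs_pow, abs_neg, abs_of_nonneg hc, Nat.abs_cast]
      calc _ ≤ ((W.card : ℝ) ^ (j - i) * (j.choose i)) * ((W.card : ℝ) ^ i * δ) := by gcongr
        _ = _ := by ring
    _ = _ := by rw [← Finset.sum_mul, ← add_pow, two_mul]

/-- If the joint moments of order `≤ d` of two families of `0`-`1` variables agree up to `δ`, then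
the characteristic functions of their sums are close. -/
theorem norm_sum_sub_mul_exp_le {p q : α → ℝ} (hp : ∀ a, 0 ≤ p a) (hq : ∀ a, 0 ≤ q a)
    (hpq : ∑ a, p a = ∑ a, q a) {Y : ℕ → α → ℝ} {W : Finset ℕ} {d : ℕ} (hd : Even d) (hd0 : 0 < d)
    {δ c : ℝ} (hY : ∀ k a, Y k a * Y k a = Y k a)
    (h : ∀ S ⊆ W, S.card ≤ d → |∑ a, (p a - q a) * ∏ k ∈ S, Y k a| ≤ δ) (hc : 0 ≤ c)
    (hcW : c ≤ W.card) (θ : ℝ) :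
    ‖∑ a, ((p a - q a : ℝ) : ℂ) *
        Complex.exp (Complex.I * ((θ * (∑ k ∈ W, Y k a - c) : ℝ) : ℂ))‖ ≤
      ∑ j ∈ Finset.range d, (|θ| * (2 * W.card)) ^ (j + 1) * δ +
        2 * (θ ^ d / d.factorial * ∑ a, q a * (∑ k ∈ W, Y k a - c) ^ d) := by
  set v : α → ℝ := fun a => ∑ k ∈ W, Y k a - c with hv
  have hδ : 0 ≤ δ := (abs_nonneg _).trans (h ∅ (Finset.empty_subset _) (by simp))
  have hmom : ∀ j ≤ d, |∑ a, (p a - q a) * v a ^ j| ≤ (2 * W.card : ℝ) ^ j * δ :=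
    fun j hj => abs_sum_mul_sub_pow_le hY h hc hcW hj
  have hf1 : ∀ j : ℕ, (1 : ℝ) ≤ j.factorial := fun j => by exact_mod_cast j.factorial_pos
  have hterm : ∀ j ≤ d, |θ| ^ j / j.factorial * |∑ a, (p a - q a) * v a ^ j| ≤
      (|θ| * (2 * W.card)) ^ j * δ := by
    intro j hj
    calc _ ≤ |θ| ^ j * ((2 * W.card : ℝ) ^ j * δ) := by
          gcongr
          · exact div_le_self (by positivity) (hf1 j)
          · exact hmom j hj
      _ = _ := by rw [mul_pow]; ring
  set r : α → ℂ := fun a => Complex.exp (Complex.I * ((θ * v a : ℝ) : ℂ)) -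
    ∑ j ∈ Finset.range d, (Complex.I * ((θ * v a : ℝ) : ℂ)) ^ j / (j.factorial : ℂ) with hr
  have hrn : ∀ a, ‖r a‖ ≤ θ ^ d / d.factorial * v a ^ d := by
    intro a
    refine (norm_exp_I_mul_sub_le d (θ * v a)).trans (le_of_eq ?_)
    rw [Even.pow_abs hd, mul_pow]
    ring
  have e1 : ∑ a, ((p a - q a : ℝ) : ℂ) * Complex.exp (Complex.I * ((θ * v a : ℝ) : ℂ)) =
      ∑ j ∈ Finset.range d, (Complex.I * θ) ^ j / (j.factorial : ℂ) *
        ((∑ a, (p a - q a) * v a ^ j : ℝ) : ℂ) + ∑ a, ((p a - q a : ℝ) : ℂ) * r a := by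
    have : ∀ a, ((p a - q a : ℝ) : ℂ) * Complex.exp (Complex.I * ((θ * v a : ℝ) : ℂ)) =
        ∑ j ∈ Finset.range d, (Complex.I * θ) ^ j / (j.factorial : ℂ) *
          (((p a - q a) * v a ^ j : ℝ) : ℂ) + ((p a - q a : ℝ) : ℂ) * r a := by
      intro a
      have hx : Complex.exp (Complex.I * ((θ * v a : ℝ) : ℂ)) =
          ∑ j ∈ Finset.range d, (Complex.I * ((θ * v a : ℝ) : ℂ)) ^ j / (j.factorial : ℂ) + r a :=
        (add_sub_cancel _ _).symm
      rw [hx, mul_add, Finset.mul_sum]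
      congr 1
      refine Finset.sum_congr rfl fun j _ => ?_
      push_cast
      rw [mul_pow, mul_pow, mul_pow]
      ring
    rw [Finset.sum_congr rfl fun a _ => this a, Finset.sum_add_distrib, Finset.sum_comm]
    congr 1
    refine Finset.sum_congr rfl fun j _ => ?_
    rw [Complex.ofReal_sum, Finset.mul_sum]
  -- The term j = 0 vanishes because both measures have equal mass, so every surviving term contains
  -- θ.
  have e2 : ‖∑ j ∈ Finset.range d, (Complex.I * θ) ^ j / (j.factorial : ℂ) *
        ((∑ a, (p a - q a) * v a ^ j : ℝ) : ℂ)‖ ≤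
      ∑ j ∈ Finset.range (d - 1), (|θ| * (2 * W.card)) ^ (j + 1) * δ := by
    obtain ⟨d', hd'⟩ : ∃ d', d = d' + 1 := ⟨d - 1, by omega⟩
    have h0 : ∑ a, (p a - q a) * v a ^ 0 = 0 := by
      simp [Finset.sum_sub_distrib, hpq]
    rw [hd', Finset.sum_range_succ', h0]
    simp only [Complex.ofReal_zero, mul_zero, add_zero, Nat.add_sub_cancel]
    refine norm_sum_le_of_le _ fun j hj => ?_
    refine le_trans (le_of_eq ?_) (hterm (j + 1) (by have := Finset.mem_range.1 hj; omega))
    rw [norm_mul, norm_div, norm_pow, norm_mul, Complex.norm_I, one_mul, Complex.norm_natCast,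
      Complex.norm_real, Complex.norm_real, Real.norm_eq_abs, Real.norm_eq_abs]
  -- The d-th moment under p is that under q plus their difference, so no separate tail bound for p
  -- is needed; evenness of d makes the moments nonnegative.
  have e3 : ‖∑ a, ((p a - q a : ℝ) : ℂ) * r a‖ ≤
      2 * (θ ^ d / d.factorial * ∑ a, q a * v a ^ d) + (|θ| * (2 * W.card)) ^ d * δ := by
    have hθ : θ ^ d = |θ| ^ d := (Even.pow_abs hd _).symm
    calc _ ≤ ∑ a, (p a + q a) * (θ ^ d / d.factorial * v a ^ d) := by
          refine norm_sum_le_of_le _ fun a _ => ?_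
          rw [norm_mul, Complex.norm_real, Real.norm_eq_abs]
          refine mul_le_mul ?_ (hrn a) (norm_nonneg _) (add_nonneg (hp a) (hq a))
          refine (abs_sub _ _).trans (le_of_eq ?_)
          rw [abs_of_nonneg (hp a), abs_of_nonneg (hq a)]
      _ = 2 * (θ ^ d / d.factorial * ∑ a, q a * v a ^ d) +
          θ ^ d / d.factorial * ∑ a, (p a - q a) * v a ^ d := by
        rw [Finset.mul_sum, Finset.mul_sum, Finset.mul_sum, ← Finset.sum_add_distrib]
        refine Finset.sum_congr rfl fun a _ => ?_
        ring
      _ ≤ _ := by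
        refine add_le_add le_rfl (le_trans ?_ (hterm d le_rfl))
        rw [hθ]
        exact mul_le_mul_of_nonneg_left (le_abs_self _) (by positivity)
  rw [e1]
  refine (norm_add_le _ _).trans ((add_le_add e2 e3).trans (le_of_eq ?_))
  obtain ⟨d', hd'⟩ : ∃ d', d = d' + 1 := ⟨d - 1, by omega⟩
  rw [hd', Finset.sum_range_succ _ d', Nat.add_sub_cancel]
  ring

end moments

theorem pow_le_factorial_mul_exp_add {d : ℕ} (hd : Even d) {l : ℝ} (hl : 0 < l) (y : ℝ) :
    y ^ d ≤ d.factorial / l ^ d * (Real.exp (l * y) + Real.exp (-l * y)) := by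
  have h1 := Real.pow_div_factorial_le_exp _ (abs_nonneg (l * y)) d
  have hf : (0 : ℝ) < d.factorial := by exact_mod_cast d.factorial_pos
  have h2 : Real.exp |l * y| ≤ Real.exp (l * y) + Real.exp (-l * y) := by
    rcases abs_cases (l * y) with ⟨h, _⟩ | ⟨h, _⟩ <;> rw [h]
    · linarith [Real.exp_pos (-l * y)]
    · rw [← neg_mul]
      linarith [Real.exp_pos (l * y)]
  rw [Even.pow_abs hd, div_le_iff₀ hf, mul_pow] at h1
  rw [div_mul_eq_mul_div, le_div_iff₀ (by positivity)]
  nlinarith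

/-! ### Comparison of the characteristic functions -/

/-- The coordinates of a configuration in `{0, 1} ^ n`. -/
def coord {n : ℕ} (k : ℕ) (a : Fin n → Fin 2) : ℝ := if h : k < n then ((a ⟨k, h⟩ : ℕ) : ℝ) else 0

theorem coord_mul_self {n : ℕ} (k : ℕ) (a : Fin n → Fin 2) : coord k a * coord k a = coord k a := by
  rw [coord]
  split_ifs with h
  · rcases (by decide : ∀ c : Fin 2, c = 0 ∨ c = 1) (a ⟨k, h⟩) with hc | hc <;> rw [hc] <;> simp
  · simp

/-- The digits of `p` at the positions below `n`. -/
def digitPath (n p : ℕ) : Fin n → Fin 2 := fun i => if digit i p = 1 then 1 else 0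

theorem coord_digitPath {n k : ℕ} (hk : k < n) (p : ℕ) : coord k (digitPath n p) = digit k p := by
  rw [coord, dif_pos hk, digitPath]
  rcases digit_eq_zero_or_one k p with h | h <;> simp [h]

theorem avg_comp_eq_sum {α : Type*} [Fintype α] [DecidableEq α] (s : Finset ℕ) (f : ℕ → α)
    (F : α → ℂ) :
    avg s (fun n => F (f n)) =
      ∑ a, (((s.filter fun n => f n = a).card / s.card : ℝ) : ℂ) * F a := by
  have h1 : ∑ n ∈ s, F (f n) = ∑ a, ((s.filter fun n => f n = a).card : ℂ) * F a := by
    rw [← Finset.sum_fiberwise s f]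
    refine Finset.sum_congr rfl fun a _ => ?_
    rw [Finset.sum_congr rfl fun n hn => by rw [(Finset.mem_filter.1 hn).2], Finset.sum_const,
      nsmul_eq_mul]
  rw [avg, h1, Finset.mul_sum]
  refine Finset.sum_congr rfl fun a _ => ?_
  push_cast
  ring

theorem window_subset (ν x : ℝ) : window ν x ⊆ Finset.range (maxLength x + 1) :=
  Finset.filter_subset _ _

section chain

variable {Ω : Type*} [MeasurableSpace Ω] {P : Measure Ω} [IsProbabilityMeasure P]
  {Z : ℕ → Ω → Fin 2}

theorem IsDigitChain.integral_path_eq (h : IsDigitChain P Z) {E : Type*} [NormedAddCommGroup E]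
    [NormedSpace ℝ E] [CompleteSpace E] (n : ℕ) (F : (Fin n → Fin 2) → E) :
    ∫ ω, F (fun i => Z i ω) ∂P =
      ∑ a, (P.map fun ω (i : Fin n) => Z i ω).real {a} • F a := by
  have hm : Measurable fun ω => fun i : Fin n => Z i ω :=
    measurable_pi_lambda _ fun i => h.measurable i
  have : IsProbabilityMeasure (P.map fun ω (i : Fin n) => Z i ω) :=
    Measure.isProbabilityMeasure_map hm.aemeasurable
  rw [← integral_map (φ := fun ω (i : Fin n) => Z i ω) hm.aemeasurable
    (StronglyMeasurable.of_discrete.aestronglyMeasurable), integral_fintype .of_finite]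

/-- Both variables are transported to the finite space of digit configurations at positions 0, …, L,
where the moment comparison applies. -/
theorem IsDigitChain.norm_phi_sub_le (hZ : IsDigitChain P Z) {ν x t : ℝ} (hx : 2 ≤ x) {d : ℕ}
    (hd : Even d) (hd0 : 0 < d) {δ : ℝ}
    (h : ∀ S ⊆ window ν x, S.card ≤ d →
      ‖avg (primesUpTo x) (fun n => ∏ k ∈ S, (digit k n : ℂ)) -
        ((∫ ω, ∏ k ∈ S, (((Z k ω : Fin 2) : ℕ) : ℝ) ∂P : ℝ) : ℂ)‖ ≤ δ) :
    ‖phi₂ ν x t - phi₃ P Z ν x t‖ ≤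
      ∑ j ∈ Finset.range d, (|t / √(windowCard ν x * variance)| * (2 * windowCard ν x)) ^ (j + 1) * δ +
        2 * ((t / √(windowCard ν x * variance)) ^ d / d.factorial *
          ∫ ω, ((truncChainSum Z ν x ω : ℝ) - windowCard ν x * mean) ^ d ∂P) := by
  classical
  set n := maxLength x + 1 with hn
  set θ := t / √(windowCard ν x * variance) with hθ
  set c := (windowCard ν x : ℝ) * mean with hc
  have hs0 : (0 : ℝ) < (primesUpTo x).card := by exact_mod_cast (primesUpTo_nonempty hx).card_pos
  have hW : ∀ k ∈ window ν x, k < n := fun k hk => Finset.mem_range.1 (window_subset ν x hk)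
  set p : (Fin n → Fin 2) → ℝ := fun a =>
    ((primesUpTo x).filter fun q => digitPath n q = a).card / (primesUpTo x).card with hp
  set q : (Fin n → Fin 2) → ℝ := fun a => (P.map fun ω (i : Fin n) => Z i ω).real {a} with hq
  have hcoordZ : ∀ k < n, ∀ ω, coord k (fun i : Fin n => Z i ω) = (((Z k ω : Fin 2) : ℕ) : ℝ) :=
    fun k hk ω => by rw [coord, dif_pos hk]
  have hEp : ∀ F : (Fin n → Fin 2) → ℂ, avg (primesUpTo x) (fun m => F (digitPath n m)) =
      ∑ a, ((p a : ℝ) : ℂ) * F a := fun F => avg_comp_eq_sum _ _ F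
  have hEq : ∀ F : (Fin n → Fin 2) → ℂ, ∫ ω, F (fun i => Z i ω) ∂P = ∑ a, ((q a : ℝ) : ℂ) * F a := by
    intro F
    rw [hZ.integral_path_eq]
    simp only [Complex.real_smul, hq]
  have hEq' : ∀ F : (Fin n → Fin 2) → ℝ, ∫ ω, F (fun i => Z i ω) ∂P = ∑ a, q a * F a := by
    intro F
    rw [hZ.integral_path_eq]
    simp only [smul_eq_mul, hq]
  have hpq : ∑ a, p a = ∑ a, q a := by
    have h1 := hEp fun _ => 1
    have h2 := hEq fun _ => 1
    rw [avg_const (primesUpTo_nonempty hx)] at h1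
    simp only [integral_const, probReal_univ, one_smul, mul_one] at h1 h2
    rw [h1] at h2
    exact_mod_cast h2
  have main := norm_sum_sub_mul_exp_le (p := p) (q := q) (fun a => by positivity)
    (fun a => measureReal_nonneg) hpq (Y := fun k a => coord k a) (W := window ν x) hd hd0 (δ := δ)
    (c := c) coord_mul_self (by
      intro S hS hSd
      refine le_trans (le_of_eq ?_) (h S hS hSd)
      have e1 : avg (primesUpTo x) (fun m => ∏ k ∈ S, (digit k m : ℂ)) =
          ((∑ a, p a * ∏ k ∈ S, coord k a : ℝ) : ℂ) := by
        have := hEp fun a => ((∏ k ∈ S, coord k a : ℝ) : ℂ)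
        push_cast at this ⊢
        rw [← this]
        congr 1
        funext m
        refine Finset.prod_congr rfl fun k hk => ?_
        rw [coord_digitPath (hW k (hS hk))]
        simp
      have e2 : ∫ ω, ∏ k ∈ S, (((Z k ω : Fin 2) : ℕ) : ℝ) ∂P = ∑ a, q a * ∏ k ∈ S, coord k a := by
        rw [← hEq']
        refine integral_congr_ae (Filter.Eventually.of_forall fun ω => ?_)
        exact Finset.prod_congr rfl fun k hk => (hcoordZ k (hW k (hS hk)) ω).symm
      rw [e1, e2, ← Complex.ofReal_sub, Complex.norm_real, Real.norm_eq_abs, ← Finset.sum_sub_distrib]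
      congr 1
      refine Finset.sum_congr rfl fun a _ => ?_
      ring)
    (mul_nonneg (Nat.cast_nonneg _) mean_pos.le)
    (mul_le_of_le_one_right (Nat.cast_nonneg _) mean_lt_one.le) θ
  have e2 : phi₂ ν x t = ∑ a, ((p a : ℝ) : ℂ) *
      Complex.exp (Complex.I * ((θ * (∑ k ∈ window ν x, coord k a - c) : ℝ) : ℂ)) := by
    rw [← hEp]
    change avg (primesUpTo x) _ = _
    congr 1
    funext m
    rw [Finset.sum_congr rfl fun k hk => coord_digitPath (hW k hk) m]
    congr 1
    rw [mul_assoc]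
    congr 1
    rw [normalize, truncDigitSum, hθ, hc]
    push_cast
    ring
  have e3 : phi₃ P Z ν x t = ∑ a, ((q a : ℝ) : ℂ) *
      Complex.exp (Complex.I * ((θ * (∑ k ∈ window ν x, coord k a - c) : ℝ) : ℂ)) := by
    rw [← hEq, phi₃]
    refine integral_congr_ae (Filter.Eventually.of_forall fun ω => ?_)
    dsimp only
    rw [Finset.sum_congr rfl fun k hk => hcoordZ k (hW k hk) ω, mul_assoc]
    congr 2
    rw [normalize, truncChainSum, hθ, hc]
    push_cast
    ring
  have e4 : ∫ ω, ((truncChainSum Z ν x ω : ℝ) - c) ^ d ∂P =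
      ∑ a, q a * (∑ k ∈ window ν x, coord k a - c) ^ d := by
    rw [← hEq']
    refine integral_congr_ae (Filter.Eventually.of_forall fun ω => ?_)
    dsimp only
    rw [Finset.sum_congr rfl fun k hk => hcoordZ k (hW k hk) ω, truncChainSum]
    push_cast
    rfl
  rw [e2, e3, e4, ← Finset.sum_sub_distrib]
  refine le_trans (le_of_eq ?_) main
  congr 1
  refine Finset.sum_congr rfl fun a _ => ?_
  push_cast
  ring

/-- Bounds on integers may be rounded up. A nonempty window gives ⌈L^ν⌉ ≤ L, which makes the
truncated subtraction harmless. -/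
theorem window_eq_Icc {ν x : ℝ} :
    window ν x = Finset.Icc ⌈(maxLength x : ℝ) ^ ν⌉₊ (maxLength x - ⌈(maxLength x : ℝ) ^ ν⌉₊) ∨
      window ν x = ∅ := by
  rcases (window ν x).eq_empty_or_nonempty with h | ⟨k₀, hk₀⟩
  · exact Or.inr h
  refine Or.inl ?_
  have hmem : ∀ k, k ∈ window ν x ↔ k < maxLength x + 1 ∧ (maxLength x : ℝ) ^ ν ≤ k ∧
      (k : ℝ) ≤ maxLength x - (maxLength x : ℝ) ^ ν := fun k => by
    simp [window]
  have hiff : ∀ k ≤ maxLength x, ((k : ℝ) ≤ maxLength x - (maxLength x : ℝ) ^ ν ↔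
      k + ⌈(maxLength x : ℝ) ^ ν⌉₊ ≤ maxLength x) := by
    intro k hk
    have : ⌈(maxLength x : ℝ) ^ ν⌉₊ ≤ maxLength x - k ↔
        (maxLength x : ℝ) ^ ν ≤ ((maxLength x - k : ℕ) : ℝ) := Nat.ceil_le
    rw [Nat.cast_sub hk] at this
    constructor
    · intro h
      have := this.2 (by linarith)
      omega
    · intro h
      have := this.1 (by omega)
      linarith
  have h0 := (hmem k₀).1 hk₀
  have h1 := (hiff k₀ (by omega)).1 h0.2.2
  ext k
  rw [hmem, Finset.mem_Icc, Nat.ceil_le]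
  constructor
  · rintro ⟨a, b, c⟩
    have := (hiff k (by omega)).1 c
    exact ⟨b, by omega⟩
  · rintro ⟨a, b⟩
    exact ⟨by omega, a, (hiff k (by omega)).2 (by omega)⟩

/-- A high moment is dominated by the exponential moments at l and -l; the parameter l is left free
to be optimised. -/
theorem IsDigitChain.integral_pow_le (hZ : IsDigitChain P Z) {ν x : ℝ} (hL : 1 ≤ maxLength x)
    (hW : 1 ≤ windowCard ν x) {d : ℕ} (hd : Even d) {l : ℝ} (hl0 : 0 < l) (hl1 : l ≤ 1) :
    ∫ ω, ((truncChainSum Z ν x ω : ℝ) - windowCard ν x * mean) ^ d ∂P ≤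
      d.factorial / l ^ d * (2 * Real.exp (2 + l ^ 2 * windowCard ν x)) := by
  have hL' : (0 : ℝ) < maxLength x := by exact_mod_cast hL
  rcases window_eq_Icc (ν := ν) (x := x) with hI | hI
  swap
  · rw [windowCard, hI] at hW
    simp at hW
  set m := ⌈(maxLength x : ℝ) ^ ν⌉₊ with hm
  have hm1 : 1 ≤ m := Nat.ceil_pos.2 (Real.rpow_pos_of_pos hL' _)
  set B := maxLength x - m with hB
  have hmB : m ≤ B + 1 := by
    rw [windowCard, hI, Nat.card_Icc] at hW
    omega
  have hsum : ∀ ω, (truncChainSum Z ν x ω : ℝ) - windowCard ν x * mean =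
      ∑ k ∈ Finset.Icc m B, ((((Z k ω : Fin 2) : ℕ) : ℝ) - mean) := by
    intro ω
    rw [truncChainSum, windowCard, hI, Finset.sum_sub_distrib, Finset.sum_const, nsmul_eq_mul]
    push_cast
    rfl
  have hcard : (windowCard ν x : ℝ) = (Finset.Icc m B).card := by rw [windowCard, hI]
  have hint : ∀ G : ℝ → ℝ, Integrable (fun ω =>
      G (∑ k ∈ Finset.Icc m B, ((((Z k ω : Fin 2) : ℕ) : ℝ) - mean))) P := by
    intro G
    have := hZ.integrable_comp_path B fun s => G (∑ k ∈ Finset.Icc m B, (coord k s - mean))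
    refine this.congr (Filter.Eventually.of_forall fun ω => ?_)
    dsimp only
    congr 1
    refine Finset.sum_congr rfl fun k hk => ?_
    rw [coord, dif_pos (Nat.lt_succ_iff.2 (Finset.mem_Icc.1 hk).2)]
  have h1 := hZ.integral_exp_le (l := l) (by rw [abs_of_pos hl0]; exact hl1) hm1 hmB
  have h2 := hZ.integral_exp_le (l := -l) (by rw [abs_neg, abs_of_pos hl0]; exact hl1) hm1 hmB
  rw [neg_sq] at h2
  simp_rw [hsum]
  rw [hcard]
  calc _ ≤ ∫ ω, (d.factorial / l ^ d *
        (Real.exp (l * ∑ k ∈ Finset.Icc m B, ((((Z k ω : Fin 2) : ℕ) : ℝ) - mean)) +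
          Real.exp (-l * ∑ k ∈ Finset.Icc m B, ((((Z k ω : Fin 2) : ℕ) : ℝ) - mean)))) ∂P :=
        integral_mono (hint fun y => y ^ d)
          (hint fun y => d.factorial / l ^ d * (Real.exp (l * y) + Real.exp (-l * y)))
          fun ω => pow_le_factorial_mul_exp_add hd hl0 _
    _ = d.factorial / l ^ d *
        (∫ ω, Real.exp (l * ∑ k ∈ Finset.Icc m B, ((((Z k ω : Fin 2) : ℕ) : ℝ) - mean)) ∂P +
          ∫ ω, Real.exp (-l * ∑ k ∈ Finset.Icc m B, ((((Z k ω : Fin 2) : ℕ) : ℝ) - mean)) ∂P) := by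
      rw [integral_const_mul, integral_add (hint fun y => Real.exp (l * y))
        (hint fun y => Real.exp (-l * y))]
    _ ≤ _ := by
      gcongr
      linarith

end chain

/-! ### Choice of the parameters -/

theorem exp_div_three_le_goldenRatio_pow (m : ℕ) : Real.exp (m / 3) ≤ goldenRatio ^ m := by
  have hpos := goldenRatio_pos
  have hsq := goldenRatio_sq
  have h1 : Real.exp 1 ≤ goldenRatio ^ 3 := by
    have e : goldenRatio ^ 3 = 2 * goldenRatio + 1 := by
      linear_combination (goldenRatio + 1) * hsq
    rw [e]
    have := goldenRatio_bounds.1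
    have := Real.exp_one_lt_d9
    linarith
  refine le_of_pow_le_pow_left₀ (n := 3) (by norm_num) (by positivity) ?_
  rw [← Real.exp_nat_mul, ← pow_mul, mul_comm m 3, pow_mul]
  have e : ((3 : ℕ) : ℝ) * ((m : ℝ) / 3) = m * 1 := by
    push_cast
    ring
  rw [e, Real.exp_nat_mul]
  exact pow_le_pow_left₀ (Real.exp_pos _).le h1 m

theorem exp_le_ceil_exp_le {a b : ℝ} (ha : 0 ≤ a) (hab : a + 1 ≤ b) :
    Real.exp a ≤ ⌈Real.exp a⌉₊ ∧ (⌈Real.exp a⌉₊ : ℝ) ≤ Real.exp b := by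
  refine ⟨Nat.le_ceil _, ?_⟩
  have h1 := Nat.ceil_lt_add_one (Real.exp_pos a).le
  have h2 : 1 ≤ Real.exp a := Real.one_le_exp ha
  have h3 : 2 ≤ Real.exp 1 := by
    have := Real.add_one_le_exp 1
    linarith
  have h4 : Real.exp a * Real.exp 1 ≤ Real.exp b := by
    rw [← Real.exp_add]
    exact Real.exp_le_exp.2 hab
  nlinarith

set_option maxHeartbeats 1000000 in
-- Each error is a fixed power of L, at most e^r, times an exponential in a higher power of r; with
-- r ≥ 100 the higher power always wins.
theorem exists_parameters {L m d : ℕ} {r : ℝ} (hr : 100 ≤ r) (hE : 10 ^ 6 * (L : ℝ) ^ 5 ≤ Real.exp r)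
    (hd4 : d ≤ 4 * r ^ 4) (hdL : d ≤ L) (hm : r ^ 12 ≤ m) (hmL : m ≤ L) :
    ∃ (ε : ℝ) (N U : ℕ), 0 < ε ∧ ε ≤ 1 / 100 ∧ goldenRatio * (goldenRatio ^ m)⁻¹ ≤ ε ∧ 0 < N ∧
      0 < U ∧ 48 * d * N * (U : ℝ) ^ 8 ≤ goldenRatio ^ m ∧
      d * (4 / (N * ε ^ 2) + 13430 * L * ε) +
        (N : ℝ) ^ (2 * d) * (208 * L * (1 + L) ^ 3 / √U + (goldenRatio ^ L)⁻¹) +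
        8 * (goldenRatio ^ m)⁻¹ ≤ Real.exp (2 - r ^ 6) := by
  have hpos := goldenRatio_pos
  have hone := one_lt_goldenRatio
  have hr0 : 0 < r := by linarith
  have hp : ∀ n : ℕ, 100 * r ^ n ≤ r ^ (n + 1) := fun n => by
    rw [pow_succ, mul_comm]
    gcongr
  have p1 := hp 1
  have p2 := hp 2
  have p3 := hp 3
  have p4 := hp 4
  have p5 := hp 5
  have p6 := hp 6
  have p7 := hp 7
  have p8 := hp 8
  have p9 := hp 9
  have p10 := hp 10
  have p11 := hp 11
  norm_num at p1 p2 p3 p4 p5 p6 p7 p8 p9 p10 p11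
  have hL1 : (1 : ℝ) ≤ L := by
    have h1 : (1 : ℝ) ≤ m := le_trans (one_le_pow₀ (by linarith)) hm
    have h2 : (m : ℝ) ≤ L := by exact_mod_cast hmL
    linarith
  have hdL' : (d : ℝ) ≤ L := by exact_mod_cast hdL
  have hL2 : (L : ℝ) ≤ (L : ℝ) ^ 5 := le_self_pow₀ hL1 (by norm_num)
  have hL3 : (L : ℝ) * L ≤ (L : ℝ) ^ 5 := by
    rw [← pow_two]
    exact pow_le_pow_right₀ hL1 (by norm_num)
  have hL4 : (L : ℝ) ^ 4 ≤ (L : ℝ) ^ 5 := pow_le_pow_right₀ hL1 (by norm_num)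
  have hφm : Real.exp (r ^ 12 / 3) ≤ goldenRatio ^ m :=
    le_trans (Real.exp_le_exp.2 (by linarith)) (exp_div_three_le_goldenRatio_pow m)
  have hφm' : (goldenRatio ^ m)⁻¹ ≤ Real.exp (-(r ^ 12 / 3)) := by
    rw [Real.exp_neg]
    exact inv_anti₀ (Real.exp_pos _) hφm
  have hφL : (goldenRatio ^ L)⁻¹ ≤ Real.exp (-(r ^ 12 / 3)) :=
    le_trans (inv_anti₀ (by positivity) (pow_le_pow_right₀ hone.le hmL)) hφm'
  -- With ε = e^(-2r^6), N of size e^(8r^6) makes Nε² at least e^(4r^6). Then N^(2d) ≤ e^(72r^10),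
  -- which √U of size e^(75r^10) must beat, and NU⁸ still stays below e^(r^12/3) ≤ φ^m.
  obtain ⟨n1, n2⟩ := exp_le_ceil_exp_le (a := 8 * r ^ 6) (b := 9 * r ^ 6) (by positivity) (by linarith)
  obtain ⟨u1, u2⟩ := exp_le_ceil_exp_le (a := 150 * r ^ 10) (b := 151 * r ^ 10) (by positivity)
    (by linarith)
  set N := ⌈Real.exp (8 * r ^ 6)⌉₊
  set U := ⌈Real.exp (150 * r ^ 10)⌉₊
  have hN0 : (0 : ℝ) < N := lt_of_lt_of_le (Real.exp_pos _) n1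
  have hU0 : (0 : ℝ) < U := lt_of_lt_of_le (Real.exp_pos _) u1
  have hd0 : (0 : ℝ) ≤ d := Nat.cast_nonneg d
  have e6 : (10 : ℝ) ^ 6 ≤ Real.exp r := by nlinarith
  have eε : Real.exp (-(2 * r ^ 6)) ≤ 1 / 100 := by
    rw [Real.exp_neg, one_div]
    refine inv_anti₀ (by norm_num) ?_
    have : Real.exp r ≤ Real.exp (2 * r ^ 6) := Real.exp_le_exp.2 (by linarith)
    linarith
  refine ⟨Real.exp (-(2 * r ^ 6)), N, U, Real.exp_pos _, eε, ?_, by exact_mod_cast hN0,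
    by exact_mod_cast hU0, ?_, ?_⟩
  · have hφ : goldenRatio ≤ Real.exp 1 := by
      have := goldenRatio_bounds.2
      have := Real.add_one_le_exp 1
      linarith
    calc _ ≤ Real.exp 1 * Real.exp (-(r ^ 12 / 3)) := by gcongr
      _ = Real.exp (1 + -(r ^ 12 / 3)) := (Real.exp_add _ _).symm
      _ ≤ _ := Real.exp_le_exp.2 (by linarith)
  · have h48 : 48 * (d : ℝ) ≤ Real.exp r := by linarith
    calc _ ≤ Real.exp r * Real.exp (9 * r ^ 6) * (Real.exp (151 * r ^ 10)) ^ 8 := by gcongr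
      _ = Real.exp (r + 9 * r ^ 6 + 8 * (151 * r ^ 10)) := by
        rw [← Real.exp_nat_mul, Real.exp_add, Real.exp_add]
        norm_num
      _ ≤ Real.exp (r ^ 12 / 3) := Real.exp_le_exp.2 (by linarith)
      _ ≤ _ := hφm
  · have t1 : (d : ℝ) * (4 / (N * Real.exp (-(2 * r ^ 6)) ^ 2)) ≤ Real.exp (-r ^ 6) := by
      have h1 : Real.exp (4 * r ^ 6) ≤ N * Real.exp (-(2 * r ^ 6)) ^ 2 := by
        calc Real.exp (4 * r ^ 6) = Real.exp (8 * r ^ 6) * Real.exp (-(2 * r ^ 6)) ^ 2 := by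
              rw [← Real.exp_nat_mul, ← Real.exp_add]
              congr 1
              push_cast
              ring
          _ ≤ _ := by gcongr
      calc _ ≤ (d : ℝ) * (4 / Real.exp (4 * r ^ 6)) := by gcongr
        _ = (4 * d) * Real.exp (-(4 * r ^ 6)) := by
          rw [Real.exp_neg]
          ring
        _ ≤ Real.exp r * Real.exp (-(4 * r ^ 6)) := by
          gcongr
          linarith
        _ = Real.exp (r + -(4 * r ^ 6)) := (Real.exp_add _ _).symm
        _ ≤ _ := Real.exp_le_exp.2 (by linarith)
    have t2 : (d : ℝ) * (13430 * L * Real.exp (-(2 * r ^ 6))) ≤ Real.exp (-r ^ 6) := by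
      calc _ ≤ (L : ℝ) * (13430 * L * Real.exp (-(2 * r ^ 6))) := by gcongr
        _ = (13430 * (L * L)) * Real.exp (-(2 * r ^ 6)) := by ring
        _ ≤ Real.exp r * Real.exp (-(2 * r ^ 6)) := by
          gcongr
          linarith
        _ = Real.exp (r + -(2 * r ^ 6)) := (Real.exp_add _ _).symm
        _ ≤ _ := Real.exp_le_exp.2 (by linarith)
    have hNd : (N : ℝ) ^ (2 * d) ≤ Real.exp (72 * r ^ 10) := by
      calc (N : ℝ) ^ (2 * d) ≤ Real.exp (9 * r ^ 6) ^ (2 * d) := by gcongr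
        _ = Real.exp (18 * r ^ 6 * d) := by
          rw [← Real.exp_nat_mul]
          congr 1
          push_cast
          ring
        _ ≤ Real.exp (18 * r ^ 6 * (4 * r ^ 4)) := by gcongr
        _ = _ := by
          congr 1
          ring
    have t3 : (N : ℝ) ^ (2 * d) * (208 * L * (1 + L) ^ 3 / √U) ≤ Real.exp (-r ^ 6) := by
      have h1 : 208 * (L : ℝ) * (1 + L) ^ 3 ≤ Real.exp r := by
        calc 208 * (L : ℝ) * (1 + L) ^ 3 ≤ 208 * L * (L + L) ^ 3 := by gcongr
          _ = 1664 * (L : ℝ) ^ 4 := by ring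
          _ ≤ Real.exp r := by linarith
      have h2 : Real.exp (75 * r ^ 10) ≤ √U := by
        rw [Real.le_sqrt (Real.exp_pos _).le hU0.le, ← Real.exp_nat_mul]
        refine le_trans (le_of_eq ?_) u1
        congr 1
        push_cast
        ring
      calc _ ≤ Real.exp (72 * r ^ 10) * (Real.exp r / Real.exp (75 * r ^ 10)) := by gcongr
        _ = Real.exp (72 * r ^ 10 + r + -(75 * r ^ 10)) := by
          rw [Real.exp_add, Real.exp_add, Real.exp_neg]
          ring
        _ ≤ _ := Real.exp_le_exp.2 (by linarith)
    have t4 : (N : ℝ) ^ (2 * d) * (goldenRatio ^ L)⁻¹ ≤ Real.exp (-r ^ 6) := by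
      calc _ ≤ Real.exp (72 * r ^ 10) * Real.exp (-(r ^ 12 / 3)) := by gcongr
        _ = Real.exp (72 * r ^ 10 + -(r ^ 12 / 3)) := (Real.exp_add _ _).symm
        _ ≤ _ := Real.exp_le_exp.2 (by linarith)
    have t5 : 8 * (goldenRatio ^ m)⁻¹ ≤ Real.exp (-r ^ 6) := by
      calc _ ≤ Real.exp r * Real.exp (-(r ^ 12 / 3)) := by
            gcongr
            linarith
        _ = Real.exp (r + -(r ^ 12 / 3)) := (Real.exp_add _ _).symm
        _ ≤ _ := Real.exp_le_exp.2 (by linarith)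
    have h5 : 5 * Real.exp (-r ^ 6) ≤ Real.exp (2 - r ^ 6) := by
      have : 2 - r ^ 6 = 1 + 1 + -r ^ 6 := by ring
      rw [this, Real.exp_add, Real.exp_add]
      have := Real.exp_one_gt_d9
      gcongr
      nlinarith
    rw [mul_add, mul_add]
    linarith

/-! ### Conclusion -/

theorem le_variance : 88 / 1000 ≤ variance := by
  have hpos := goldenRatio_pos
  have hsq := goldenRatio_sq
  have h5 := sqrt_five_eq
  have h51 := sqrt_five_lt
  have h50 : (0 : ℝ) < √5 := by positivity
  have h1 : goldenRatio ^ 2 + 1 = goldenRatio * √5 := by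
    rw [h5]
    linear_combination -hsq
  -- Since φ² + 1 = φ√5, the powers of φ cancel.
  have h2 : variance = 1 / (5 * √5) := by
    have h3 : √(5 : ℝ) ^ 3 = 5 * √5 := by
      rw [pow_succ, Real.sq_sqrt (by norm_num)]
    rw [variance, h1, mul_pow, h3]
    have : goldenRatio ^ 3 ≠ 0 := by positivity
    rw [div_mul_eq_div_div, div_self this]
  rw [h2, le_div_iff₀ (by positivity)]
  linarith

theorem two_mul_windowCard_le {ν x : ℝ} (hW : 1 ≤ windowCard ν x) :
    2 * (windowCard ν x : ℝ) ≤ 7 * windowCard ν x * √(windowCard ν x * variance) := by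
  have hW' : (1 : ℝ) ≤ windowCard ν x := by exact_mod_cast hW
  have h1 : 2 / 7 ≤ √(windowCard ν x * variance) := by
    rw [Real.le_sqrt' (by norm_num)]
    have := le_variance
    nlinarith
  nlinarith

theorem windowCard_le {ν x : ℝ} (hL : 1 ≤ maxLength x) : windowCard ν x ≤ maxLength x := by
  have hL' : (0 : ℝ) < maxLength x := by exact_mod_cast hL
  have hm1 : 1 ≤ ⌈(maxLength x : ℝ) ^ ν⌉₊ := Nat.ceil_pos.2 (Real.rpow_pos_of_pos hL' _)
  rcases window_eq_Icc (ν := ν) (x := x) with hI | hI <;> rw [windowCard, hI]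
  · rw [Nat.card_Icc]
    omega
  · simp

theorem one_le_maxLength {x : ℝ} (hx : 2 ≤ x) : 1 ≤ maxLength x := by
  by_contra hcon
  have h0 : maxLength x = 0 := by omega
  have h1 := lt_fib_maxLength_add_one x
  have h2 : 2 ≤ ⌊x⌋₊ := Nat.le_floor (by simpa using hx)
  rw [h0, zero_add, Nat.fib_one] at h1
  omega

theorem abs_normalize_le {ν x s : ℝ} (hW : 1 ≤ windowCard ν x) (h0 : 0 ≤ s)
    (h1 : s ≤ windowCard ν x) : |normalize ν x s| ≤ 7 / 2 * windowCard ν x := by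
  have hW' : (1 : ℝ) ≤ windowCard ν x := by exact_mod_cast hW
  have h2 := two_mul_windowCard_le hW
  have hv := le_variance
  have h3 : 0 < √(windowCard ν x * variance) := Real.sqrt_pos.2 (by positivity)
  have hm0 := mean_pos
  have hm1 := mean_lt_one
  rw [normalize, abs_div, abs_of_pos h3, div_le_iff₀ h3]
  have h4 : |s - windowCard ν x * mean| ≤ windowCard ν x := by
    rw [abs_le]
    constructor <;> nlinarith
  linarith

theorem norm_cexp_sub_one_le (t y : ℝ) :
    ‖Complex.exp (Complex.I * t * y) - 1‖ ≤ |t| * |y| := by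
  have := Real.norm_exp_I_mul_ofReal_sub_one_le (x := t * y)
  rw [Complex.ofReal_mul, ← mul_assoc] at this
  rwa [Real.norm_eq_abs, abs_mul] at this

section chain

variable {Ω : Type*} [MeasurableSpace Ω] {P : Measure Ω} [IsProbabilityMeasure P]
  {Z : ℕ → Ω → Fin 2}

/-- Both functions are compared with 1; this serves the bounded values of L. -/
theorem IsDigitChain.norm_phi_sub_le_trivial (hZ : IsDigitChain P Z) {ν x : ℝ} (hx : 2 ≤ x)
    (hW : 1 ≤ windowCard ν x) (t : ℝ) :
    ‖phi₂ ν x t - phi₃ P Z ν x t‖ ≤ 7 * maxLength x * |t| := by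
  have hP := primesUpTo_nonempty hx
  have hP0 : (0 : ℝ) < (primesUpTo x).card := by exact_mod_cast hP.card_pos
  have hWL : (windowCard ν x : ℝ) ≤ maxLength x := by exact_mod_cast windowCard_le (one_le_maxLength hx)
  have h2 : ‖phi₂ ν x t - 1‖ ≤ |t| * (7 / 2 * windowCard ν x) := by
    have e : phi₂ ν x t - 1 = avg (primesUpTo x) fun p =>
        Complex.exp (Complex.I * t * normalize ν x (truncDigitSum ν x p)) - 1 := by
      rw [avg_sub, avg_const hP]
      rfl
    rw [e]
    refine (norm_avg_le _ fun p _ => (norm_cexp_sub_one_le t _).trans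
      (mul_le_mul_of_nonneg_left (abs_normalize_le hW (Nat.cast_nonneg _) ?_) (abs_nonneg t))).trans ?_
    · have : truncDigitSum ν x p ≤ windowCard ν x := by
        refine (Finset.sum_le_card_nsmul _ _ 1 fun k _ => ?_).trans (by simp [windowCard])
        rcases digit_eq_zero_or_one k p with h | h <;> rw [h]
        simp
      exact_mod_cast this
    · rw [Finset.sum_const, nsmul_eq_mul, ← mul_assoc, one_div_mul_cancel hP0.ne', one_mul]
  have h3 : ‖phi₃ P Z ν x t - 1‖ ≤ |t| * (7 / 2 * windowCard ν x) := by
    have hmeas : Measurable fun ω =>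
        Complex.exp (Complex.I * t * normalize ν x (truncChainSum Z ν x ω)) := by
      have h1 : Measurable fun ω => truncChainSum Z ν x ω :=
        Finset.measurable_sum _ fun k _ => (measurable_of_finite _).comp (hZ.measurable k)
      have h2 : Measurable fun n : ℕ => Complex.exp (Complex.I * t * normalize ν x n) :=
        Measurable.of_discrete
      exact h2.comp h1
    have hint : Integrable (fun ω =>
        Complex.exp (Complex.I * t * normalize ν x (truncChainSum Z ν x ω))) P := by
      refine Integrable.of_bound hmeas.aestronglyMeasurable 1 (Filter.Eventually.of_forall fun ω => ?_)
      rw [mul_assoc, ← Complex.ofReal_mul, mul_comm, Complex.norm_exp_ofReal_mul_I]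
    have e : phi₃ P Z ν x t - 1 = ∫ ω,
        (Complex.exp (Complex.I * t * normalize ν x (truncChainSum Z ν x ω)) - 1) ∂P := by
      rw [integral_sub hint (integrable_const _)]
      simp [phi₃]
    rw [e]
    have h := norm_integral_le_of_norm_le_const (μ := P) (C := |t| * (7 / 2 * windowCard ν x))
      (f := fun ω => Complex.exp (Complex.I * t * normalize ν x (truncChainSum Z ν x ω)) - 1)
      (Filter.Eventually.of_forall fun ω => (norm_cexp_sub_one_le t _).trans
        (mul_le_mul_of_nonneg_left (abs_normalize_le hW (Nat.cast_nonneg _) (by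
          have : truncChainSum Z ν x ω ≤ windowCard ν x := by
            refine (Finset.sum_le_card_nsmul _ _ 1 fun k _ => ?_).trans (by simp [windowCard])
            omega
          exact_mod_cast this)) (abs_nonneg t)))
    simpa using h
  have e : phi₂ ν x t - phi₃ P Z ν x t = (phi₂ ν x t - 1) - (phi₃ P Z ν x t - 1) := by ring
  rw [e]
  refine (norm_sub_le _ _).trans ?_
  nlinarith [abs_nonneg t]

/-- The Taylor remainder of order 2e. The factorials cancel and the bound becomes (42t²/e)^e, with
one factor |t| kept aside. -/
theorem IsDigitChain.second_moment_term_le (hZ : IsDigitChain P Z) {ν x t M : ℝ} (hx : 2 ≤ x)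
    (hW : 1 ≤ windowCard ν x) {e : ℕ} (he : 0 < e) (hdW : 2 * e ≤ windowCard ν x) (hM : 1 ≤ M)
    (ht : |t| ≤ M) (hMe : 120 * M ^ 2 ≤ e) :
    2 * ((t / √(windowCard ν x * variance)) ^ (2 * e) / (2 * e).factorial *
      ∫ ω, ((truncChainSum Z ν x ω : ℝ) - windowCard ν x * mean) ^ (2 * e) ∂P) ≤
      30 * (|t| * Real.exp (-e)) := by
  have hv := le_variance
  have hW' : (1 : ℝ) ≤ windowCard ν x := by exact_mod_cast hW
  have he0 : (0 : ℝ) < e := by exact_mod_cast he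
  have hdW' : 2 * (e : ℝ) ≤ windowCard ν x := by exact_mod_cast hdW
  set w := (windowCard ν x : ℝ) with hw
  have hf : (0 : ℝ) < (2 * e).factorial := by exact_mod_cast (2 * e).factorial_pos
  -- A choice making l²w proportional to e; l ≤ 1 is the condition 2e ≤ w.
  set l := √(2 * e / w) with hl
  have hlsq : l ^ 2 = 2 * e / w := Real.sq_sqrt (by positivity)
  have hl0 : 0 < l := Real.sqrt_pos.2 (by positivity)
  have hl1 : l ≤ 1 := by
    rw [hl, Real.sqrt_le_iff, one_pow, div_le_one (by linarith)]
    exact ⟨zero_le_one, hdW'⟩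
  have h1 := hZ.integral_pow_le (one_le_maxLength hx) hW (even_two_mul e) hl0 hl1
  rw [← hw] at h1
  have hθ : (t / √(w * variance)) ^ 2 = t ^ 2 / (w * variance) := by
    rw [div_pow, Real.sq_sqrt (by positivity)]
  have hwl : l ^ 2 * w = 2 * e := by
    rw [hlsq]
    field_simp
  have hE2 : Real.exp 2 ≤ 739 / 100 := by
    have h2 : Real.exp 2 = Real.exp 1 * Real.exp 1 := by
      rw [← Real.exp_add]
      norm_num
    have := Real.exp_one_lt_d9
    have := Real.exp_pos 1
    rw [h2]
    nlinarith
  have hbase : t ^ 2 / (w * variance) / (2 * e / w) * Real.exp 2 ≤ t ^ 2 * (42 / e) := by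
    have e1 : t ^ 2 / (w * variance) / (2 * e / w) * Real.exp 2 =
        t ^ 2 * ((Real.exp 2 / (2 * variance)) / e) := by
      field_simp
    rw [e1]
    gcongr
    rw [div_le_iff₀ (by linarith)]
    linarith
  have hMt : |t| ^ (2 * e) ≤ |t| * (M ^ 2) ^ e := by
    obtain ⟨n, hn⟩ : ∃ n, 2 * e = n + 1 := ⟨2 * e - 1, by omega⟩
    rw [← pow_mul, hn, pow_succ, mul_comm]
    gcongr
    exact (pow_le_pow_left₀ (abs_nonneg t) ht n).trans (pow_le_pow_right₀ hM (Nat.le_succ n))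
  -- Here 42/120 = 0.35 lies below 1/e ≈ 0.367.
  have hfin : M ^ 2 * (42 / e) ≤ Real.exp (-1) := by
    rw [Real.exp_neg, ← one_div, le_div_iff₀ (Real.exp_pos 1), mul_div_assoc', div_mul_eq_mul_div,
      div_le_one he0]
    have h3 := Real.exp_one_lt_d9
    nlinarith [sq_nonneg M]
  calc _ ≤ 2 * ((t / √(w * variance)) ^ (2 * e) / (2 * e).factorial *
        ((2 * e).factorial / l ^ (2 * e) * (2 * Real.exp (2 + l ^ 2 * w)))) := by
        have : 0 ≤ (t / √(w * variance)) ^ (2 * e) := (even_two_mul e).pow_nonneg _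
        gcongr
    _ = 4 * Real.exp 2 * (t ^ 2 / (w * variance) / (2 * e / w) * Real.exp 2) ^ e := by
      have h4 : Real.exp (2 + l ^ 2 * w) = Real.exp 2 * Real.exp 2 ^ e := by
        rw [hwl, ← Real.exp_nat_mul, ← Real.exp_add]
        congr 1
        ring
      rw [h4, pow_mul, pow_mul, hθ, hlsq, mul_pow, div_pow _ (2 * e / w)]
      have : (2 * (e : ℝ) / w) ^ e ≠ 0 := by positivity
      field_simp
      ring
    _ ≤ 4 * Real.exp 2 * (t ^ 2 * (42 / e)) ^ e := by
      gcongr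
    _ = 4 * Real.exp 2 * (|t| ^ (2 * e) * (42 / e) ^ e) := by
      rw [mul_pow, pow_mul, sq_abs]
    _ ≤ 4 * Real.exp 2 * ((|t| * (M ^ 2) ^ e) * (42 / e) ^ e) := by gcongr
    _ = 4 * Real.exp 2 * (|t| * (M ^ 2 * (42 / e)) ^ e) := by rw [mul_pow]; ring
    _ ≤ 30 * (|t| * Real.exp (-1) ^ e) := by
      gcongr
      linarith
    _ = _ := by
      rw [← Real.exp_nat_mul]
      congr 3
      ring

end chain

/-- About 2r^4 powers of a base at most e^r cost exp(O(r^5)), which exp(-r^6) absorbs; one factor T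
is kept for |t|. -/
theorem sum_pow_mul_exp_le {L u T r : ℝ} {e : ℕ} (hL : 1 ≤ L) (hu0 : 0 ≤ u) (hT0 : 0 ≤ T)
    (hu : u ≤ T * (7 * L)) (hT : T ≤ L) (hr : 100 ≤ r) (hE : 10 ^ 6 * L ^ 5 ≤ Real.exp r)
    (heL : 2 * (e : ℝ) ≤ L) (her : (e : ℝ) < r ^ 4 + 1) :
    ∑ j ∈ Finset.range (2 * e), u ^ (j + 1) * Real.exp (2 - r ^ 6) ≤ T * Real.exp (-r ^ 4) := by
  have hL2 : L ^ 2 ≤ L ^ 5 := pow_le_pow_right₀ hL (by norm_num)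
  have hL5 : L ≤ L ^ 5 := le_self_pow₀ hL (by norm_num)
  have hL0 : L ≤ L ^ 2 := le_self_pow₀ hL (by norm_num)
  have hB1 : 1 ≤ 7 * L ^ 2 := by linarith
  have hBr : 7 * L ^ 2 ≤ Real.exp r := by linarith
  have hdr : 2 * (e : ℝ) ≤ Real.exp r := by linarith
  have hu2 : u ≤ 7 * L ^ 2 := by
    refine hu.trans ?_
    calc T * (7 * L) ≤ L * (7 * L) := by gcongr
      _ = _ := by ring
  have hj : ∀ j ∈ Finset.range (2 * e), u ^ (j + 1) * Real.exp (2 - r ^ 6) ≤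
      T * (7 * L ^ 2) ^ (2 * e) * Real.exp (2 - r ^ 6) := by
    intro j hj
    have hj := Finset.mem_range.1 hj
    refine mul_le_mul_of_nonneg_right ?_ (Real.exp_pos _).le
    calc u ^ (j + 1) = u * u ^ j := pow_succ' u j
      _ ≤ (T * (7 * L)) * (7 * L ^ 2) ^ j := by gcongr
      _ ≤ (T * (7 * L ^ 2)) * (7 * L ^ 2) ^ j := by gcongr
      _ = T * (7 * L ^ 2) ^ (j + 1) := by rw [mul_assoc, ← pow_succ']
      _ ≤ _ := by
        gcongr
        omega
  refine (Finset.sum_le_sum hj).trans ?_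
  rw [Finset.sum_const, Finset.card_range, nsmul_eq_mul]
  calc _ = T * ((2 * e) * ((7 * L ^ 2) ^ (2 * e) * Real.exp (2 - r ^ 6))) := by
        push_cast
        ring
    _ ≤ T * (Real.exp r * (Real.exp r ^ (2 * e) * Real.exp (2 - r ^ 6))) := by gcongr
    _ = T * Real.exp (r + (2 * e * r + (2 - r ^ 6))) := by
      rw [← Real.exp_nat_mul, ← Real.exp_add, ← Real.exp_add]
      push_cast
      rfl
    _ ≤ _ := by
      refine mul_le_mul_of_nonneg_left (Real.exp_le_exp.2 ?_) hT0
      have h1 : 2 * (e : ℝ) * r ≤ 2 * (r ^ 4 + 1) * r := by gcongr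
      have h6 : 2 * (r ^ 4 + 1) * r = 2 * r ^ 5 + 2 * r := by ring
      have hp : ∀ n : ℕ, 100 * r ^ n ≤ r ^ (n + 1) := fun n => by
        rw [pow_succ, mul_comm]
        gcongr
      have p1 : 100 * r ≤ r ^ 2 := by simpa using hp 1
      have p2 : 100 * r ^ 2 ≤ r ^ 3 := hp 2
      have p3 : 100 * r ^ 3 ≤ r ^ 4 := hp 3
      have p4 : 100 * r ^ 4 ≤ r ^ 5 := hp 4
      have p5 : 100 * r ^ 5 ≤ r ^ 6 := hp 5
      linarith

theorem IsDigitChain.norm_phi_sub_le_of_large {Ω : Type*} [MeasurableSpace Ω] {P : Measure Ω}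
    [IsProbabilityMeasure P] {Z : ℕ → Ω → Fin 2} (hZ : IsDigitChain P Z) {κ τ ν x t : ℝ}
    (hx : 2 ≤ x) (hW : 1 ≤ windowCard ν x) (hτ : 0 < τ) (hτκ : 2 * τ < κ) (hκν : κ < ν / 3)
    (hν : ν < 1 / 2) (hr : 100 ≤ (maxLength x : ℝ) ^ (κ / 4))
    (hE : 10 ^ 6 * (maxLength x : ℝ) ^ (5 : ℕ) ≤ Real.exp ((maxLength x : ℝ) ^ (κ / 4)))
    (hLτ : 120 * (maxLength x : ℝ) ^ (2 * τ) ≤ (maxLength x : ℝ) ^ κ)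
    (ht : |t| ≤ (maxLength x : ℝ) ^ τ) :
    ‖phi₂ ν x t - phi₃ P Z ν x t‖ ≤ 31 * (|t| * Real.exp (-(maxLength x : ℝ) ^ κ)) := by
  have hL1 := one_le_maxLength hx
  have hL1' : (1 : ℝ) ≤ maxLength x := by exact_mod_cast hL1
  have hWL := windowCard_le (ν := ν) hL1
  have hWL' : (windowCard ν x : ℝ) ≤ maxLength x := by exact_mod_cast hWL
  set L := maxLength x with hL
  set r := (L : ℝ) ^ (κ / 4) with hrdef
  have hL0 : (0 : ℝ) ≤ L := by linarith
  have hrpow : ∀ n : ℕ, r ^ n = (L : ℝ) ^ (κ / 4 * n) := fun n => by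
    rw [hrdef, Real.rpow_mul hL0, Real.rpow_natCast]
  have hr4 : r ^ 4 = (L : ℝ) ^ κ := by
    rw [hrpow]
    congr 1
    push_cast
    ring
  -- The only use of κ < ν/3: the distance L^ν of the window from both ends must reach r^12 =
  -- L^(3κ).
  have hr12 : r ^ 12 ≤ (L : ℝ) ^ ν := by
    rw [hrpow]
    refine Real.rpow_le_rpow_of_exponent_le hL1' ?_
    push_cast
    linarith
  have hsqrt : (L : ℝ) ^ ν ≤ √L := by
    rw [Real.sqrt_eq_rpow]
    exact Real.rpow_le_rpow_of_exponent_le hL1' hν.le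
  have hss : √(L : ℝ) * √L = L := Real.mul_self_sqrt hL0
  have hτ1 : (L : ℝ) ^ τ ≤ L := by
    conv_rhs => rw [← Real.rpow_one (L : ℝ)]
    exact Real.rpow_le_rpow_of_exponent_le hL1' (by linarith)
  have hr0 : 100 ≤ r ^ 4 := hr.trans (le_self_pow₀ (by linarith) (by norm_num))
  have hr412 : r ^ 4 ≤ r ^ 12 := pow_le_pow_right₀ (by linarith) (by norm_num)
  set m := ⌈(L : ℝ) ^ ν⌉₊ with hm
  have hm1 : (L : ℝ) ^ ν ≤ m := Nat.le_ceil _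
  have hm2 : (m : ℝ) < (L : ℝ) ^ ν + 1 := Nat.ceil_lt_add_one (Real.rpow_nonneg hL0 _)
  have hI : window ν x = Finset.Icc m (L - m) := by
    rcases window_eq_Icc (ν := ν) (x := x) with hI | hI
    · exact hI
    · rw [windowCard, hI] at hW
      simp at hW
  have hcard : windowCard ν x = L - m + 1 - m := by rw [windowCard, hI, Nat.card_Icc]
  have hmL : 2 * m ≤ L := by omega
  have hcard' : (windowCard ν x : ℝ) = L + 1 - 2 * m := by
    have : windowCard ν x + 2 * m = L + 1 := by omega
    have : (windowCard ν x : ℝ) + 2 * m = L + 1 := by exact_mod_cast this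
    linarith
  -- The moment order is 2e with e just above L^κ, so the Taylor remainder already has the size
  -- exp(-L^κ).
  set e := ⌈r ^ 4⌉₊ with he
  have he1 : r ^ 4 ≤ e := Nat.le_ceil _
  have he2 : (e : ℝ) < r ^ 4 + 1 := Nat.ceil_lt_add_one (by positivity)
  have he0 : 0 < e := Nat.ceil_pos.2 (by positivity)
  have hdW : 2 * e ≤ windowCard ν x := by
    have : (2 * e : ℝ) ≤ windowCard ν x := by
      rw [hcard']
      nlinarith
    exact_mod_cast this
  have hmr : r ^ 12 ≤ m := hr12.trans hm1
  obtain ⟨ε, N, U, hε0, hε1, hε2, hN, hU, hNU, hδ⟩ := exists_parameters (L := L) (m := m)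
    (d := 2 * e) hr hE (by push_cast; linarith) (hdW.trans hWL) hmr (by omega)
  have hm4 : 4 ≤ m := by
    have : (4 : ℝ) ≤ m := by linarith
    exact_mod_cast this
  have hmain := hZ.norm_phi_sub_le (ν := ν) (t := t) hx (even_two_mul e) (by omega)
    (δ := Real.exp (2 - r ^ 6)) (fun S hS hSd =>
      (hZ.norm_avg_primesUpTo_sub_le hx hm4 (fun k hk => by
        have := Finset.mem_Icc.1 (hI ▸ hS hk)
        omega) hmL hSd hε0 hε1 hε2 hN hU hNU).trans hδ)
  have hsecond := hZ.second_moment_term_le hx hW he0 hdW (Real.one_le_rpow hL1' hτ.le) ht (by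
    rw [← Real.rpow_natCast, ← Real.rpow_mul hL0]
    push_cast
    rw [mul_comm τ 2]
    exact hLτ.trans (hr4 ▸ he1))
  have hu : |t / √(windowCard ν x * variance)| * (2 * windowCard ν x) ≤ |t| * (7 * L) := by
    have hv := le_variance
    have hW' : (1 : ℝ) ≤ windowCard ν x := by exact_mod_cast hW
    have h3 : 0 < √(windowCard ν x * variance) := Real.sqrt_pos.2 (by positivity)
    rw [abs_div, abs_of_pos h3, div_mul_eq_mul_div, div_le_iff₀ h3, mul_assoc]
    refine mul_le_mul_of_nonneg_left ((two_mul_windowCard_le hW).trans ?_) (abs_nonneg t)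
    gcongr
  have hfirst : ∑ j ∈ Finset.range (2 * e),
      (|t / √(windowCard ν x * variance)| * (2 * windowCard ν x)) ^ (j + 1) * Real.exp (2 - r ^ 6) ≤
      |t| * Real.exp (-r ^ 4) := by
    refine sum_pow_mul_exp_le hL1' (by positivity) (abs_nonneg t) hu (ht.trans hτ1) hr hE ?_ he2
    exact le_trans (by exact_mod_cast hdW) hWL'
  have he3 : Real.exp (-(e : ℝ)) ≤ Real.exp (-r ^ 4) := Real.exp_le_exp.2 (by linarith)
  rw [← hr4]
  have h7 : |t| * Real.exp (-(e : ℝ)) ≤ |t| * Real.exp (-r ^ 4) :=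
    mul_le_mul_of_nonneg_left he3 (abs_nonneg t)
  linarith

/-- The last claim is where 2τ < κ enters; the exponential one holds because y^5 is a fixed power of
y^(κ/4). -/
theorem eventually_parameters {κ τ : ℝ} (hτ : 0 < τ) (hτκ : 2 * τ < κ) :
    ∀ᶠ y : ℝ in Filter.atTop, 100 ≤ y ^ (κ / 4) ∧ 10 ^ 6 * y ^ (5 : ℕ) ≤ Real.exp (y ^ (κ / 4)) ∧
      120 * y ^ (2 * τ) ≤ y ^ κ := by
  have hκ : 0 < κ / 4 := by linarith
  have h1 := (tendsto_rpow_atTop hκ).eventually_ge_atTop 100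
  have h2 := (tendsto_rpow_atTop (by linarith : 0 < κ - 2 * τ)).eventually_ge_atTop 120
  have h3 : ∀ᶠ z : ℝ in Filter.atTop, z ^ (20 / κ) * Real.exp (-1 * z) < (10 ^ 6 : ℝ)⁻¹ :=
    (tendsto_rpow_mul_exp_neg_mul_atTop_nhds_zero (20 / κ) 1 one_pos).eventually_lt_const
      (by positivity)
  filter_upwards [h1, h2, (tendsto_rpow_atTop hκ).eventually h3, Filter.eventually_gt_atTop 0]
    with y e1 e2 e3 e4
  refine ⟨e1, ?_, ?_⟩
  · have h5 : (y ^ (κ / 4)) ^ (20 / κ) = y ^ (5 : ℕ) := by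
      rw [← Real.rpow_mul e4.le, ← Real.rpow_natCast]
      congr 1
      have : κ ≠ 0 := by linarith
      field_simp
      norm_num
    rw [h5, neg_one_mul, Real.exp_neg, ← div_eq_mul_inv, div_lt_iff₀ (Real.exp_pos _)] at e3
    have := mul_le_mul_of_nonneg_left e3.le (by positivity : (0 : ℝ) ≤ 10 ^ 6)
    rwa [mul_inv_cancel_left₀ (by positivity)] at this
  · have h6 : y ^ κ = y ^ (κ - 2 * τ) * y ^ (2 * τ) := by
      rw [← Real.rpow_add e4]
      congr 1
      ring
    rw [h6]
    exact mul_le_mul_of_nonneg_right e2 (Real.rpow_nonneg e4.le _)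

end ZeckendorfPrimes

end

theorem mainTheorem9 (τ κ : ℝ) (hτ : 0 < τ) (hτκ : 2 * τ < κ) :
    ∃ c₁ : ℝ, 0 < c₁ ∧
      ∀ ν : ℝ, κ < ν / 3 → ν < 1 / 2 →
        ∃ C : ℝ, 0 < C ∧
          ∀ (Ω : Type*) [MeasurableSpace Ω] (P : MeasureTheory.Measure Ω)
            [MeasureTheory.IsProbabilityMeasure P] (Z : ℕ → Ω → Fin 2),
            ZeckendorfPrimes.IsDigitChain P Z →
            ∀ x : ℝ, 2 ≤ x → 1 ≤ ZeckendorfPrimes.windowCard ν x →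
              ∀ t : ℝ, |t| ≤ (ZeckendorfPrimes.maxLength x : ℝ) ^ τ →
                ‖ZeckendorfPrimes.phi₂ ν x t - ZeckendorfPrimes.phi₃ P Z ν x t‖ ≤
                  C * (|t| * Real.exp (-c₁ * (ZeckendorfPrimes.maxLength x : ℝ) ^ κ)) := by
  refine ⟨1, one_pos, fun ν hκν hν => ?_⟩
  obtain ⟨L₀, hL₀⟩ := Filter.eventually_atTop.1 (ZeckendorfPrimes.eventually_parameters hτ hτκ)
  have hκ : 0 < κ := by linarith
  -- 31 = 30 + 1 serves lengths above L₀; the other term makes the trivial bound suffice below it,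
  -- where exp(-L^κ) ≥ exp(-|L₀|^κ).
  refine ⟨31 + 7 * |L₀| * Real.exp (|L₀| ^ κ), by positivity, ?_⟩
  intro Ω _ P _ Z hZ x hx hW t ht
  rw [neg_one_mul]
  set L : ℝ := (ZeckendorfPrimes.maxLength x : ℝ)
  have hpos : 0 ≤ |t| * Real.exp (-L ^ κ) := by positivity
  rcases le_total L₀ L with h | h
  · obtain ⟨h1, h2, h3⟩ := hL₀ L h
    refine (hZ.norm_phi_sub_le_of_large hx hW hτ hτκ hκν hν h1 h2 h3 ht).trans ?_
    refine mul_le_mul_of_nonneg_right ?_ hpos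
    have : 0 ≤ 7 * |L₀| * Real.exp (|L₀| ^ κ) := by positivity
    linarith
  · have hL0 : 0 ≤ L := Nat.cast_nonneg _
    have h' : L ≤ |L₀| := h.trans (le_abs_self _)
    have h1 : 1 ≤ Real.exp (|L₀| ^ κ) * Real.exp (-L ^ κ) := by
      rw [← Real.exp_add]
      refine Real.one_le_exp ?_
      have := Real.rpow_le_rpow hL0 h' hκ.le
      linarith
    calc _ ≤ 7 * L * |t| := hZ.norm_phi_sub_le_trivial hx hW t
      _ ≤ 7 * |L₀| * |t| * (Real.exp (|L₀| ^ κ) * Real.exp (-L ^ κ)) := by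
        refine le_trans ?_ (le_mul_of_one_le_right (by positivity) h1)
        gcongr
      _ = (7 * |L₀| * Real.exp (|L₀| ^ κ)) * (|t| * Real.exp (-L ^ κ)) := by ring
      _ ≤ _ := by
        gcongr
        linarith
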